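/- Let $({}^{(4)}\mathcal M,{}^{(4)}g_{ab})$ be a smooth 4-dimensional Lorentzian manifold of signature $(-+++)$ with an everywhere spacelike, hypersurface-orthogonal Killing vector field $\xi^a$, and put $\xi_a={}^{(4)}g_{ab}\xi^b$ and $\lambda={}^{(4)}g_{ab}\xi^a\xi^b>0$. Assume that the space of orbits of $\xi^a$ is identified with a smooth embedded 3-dimensional hypersurface $M\subset{}^{(4)}\mathcal M$ that is everywhere orthogonal to $\xi^a$ and meets every orbit in exactly one point. Let $\phi$ be a smooth function on ${}^{(4)}\mathcal M$ with $\mathcal L_\xi\phi=0$, and let $G>0$ be Newton's constant. Let ${}^{(3)}g_{ab}={}^{(4)}g_{ab}-\lambda^{-1}\xi_a\xi_b$ be the metric induced on $M$ and $g_{ab}=\lambda\,{}^{(3)}g_{ab}$ the conformally rescaled one; let ${}^{(n)}R_{ab},{}^{(n)}\nabla_a,{}^{(n)}\square$ ($n=3,4$) and $R_{ab},\nabla_a,\square$ denote the Ricci tensor, the Levi-Civita connection and the d'Alembert operator of ${}^{(n)}g_{ab}$ and $g_{ab}$, respectively, with the sign convention in which round spheres have positive Ricci tensor. On $M$, write $\lambda$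 and $\phi$ for the restrictions of these functions to $M$. Then ${}^{(3)}g_{ab}$ and $g_{ab}$ are smooth Lorentzian metrics on $M$, and the following systems of equations are equivalent. 1. (4-dimensional gravity minimally coupled to a massless scalar field, on ${}^{(4)}\mathcal M$) $$ {}^{(4)}R_{ab}=8\pi G\,({}^{(4)}\nabla_a\phi)\,{}^{(4)}\nabla_b\phi,\qquad {}^{(4)}\square\phi=0. $$ 2. (on $M$, with ${}^{(3)}g_{ab}$) $$ {}^{(3)}R_{ab}=\tfrac12\lambda^{-1}\,{}^{(3)}\nabla_a{}^{(3)}\nabla_b\lambda-\tfrac14\lambda^{-2}({}^{(3)}\nabla_a\lambda)\,{}^{(3)}\nabla_b\lambda+8\pi G\,({}^{(3)}\nabla_a\phi)\,{}^{(3)}\nabla_b\phi, $$ $$ {}^{(3)}\square\phi=-\tfrac12\lambda^{-1}\,{}^{(3)}g^{ab}({}^{(3)}\nabla_a\phi)\,{}^{(3)}\nabla_b\lambda,\qquad {}^{(3)}\square\lambda=\tfrac12\lambda^{-1}\,{}^{(3)}g^{ab}({}^{(3)}\nabla_a\lambda)\,{}^{(3)}\nabla_b\lambda. $$ 3. (on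 $M$, with $g_{ab}$) $$ R_{ab}=\tfrac12(\nabla_a\log\lambda)\nabla_b\log\lambda+8\pi G\,(\nabla_a\phi)\nabla_b\phi,\qquad \square\phi=0,\quad \square\log\lambda=0. $$ 4. (3-dimensional gravity, on $M$ with $g_{ab}$, coupled to the two uncoupled massless scalars $\phi_1=\log\lambda$, $\phi_2=\sqrt{16\pi G}\,\phi$) $$ R_{ab}=\tfrac12\sum_{i=1}^2(\nabla_a\phi_i)\nabla_b\phi_i,\qquad \square\phi_1=\square\phi_2=0. $$ -/

import Mathlib

open scoped Manifold ContDiff Topology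
open Bundle

noncomputable section

namespace Spacetime

/-- The model space `ℝⁿ`. -/
abbrev Rn (n : ℕ) : Type := EuclideanSpace ℝ (Fin n)

section Fields

variable (n : ℕ) (M : Type*) [TopologicalSpace M] [ChartedSpace (Rn n) M]

/-- Vector fields `v^a` on an `n`-dimensional manifold (no regularity included). -/
abbrev VField : Type _ := (x : M) → TangentSpace (𝓡 n) x

/-- Tensor fields `T_{ab}` on an `n`-dimensional manifold (no regularity included). -/
abbrev Tensor2 : Type _ :=
  (x : M) → TangentSpace (𝓡 n) x →L[ℝ] TangentSpace (𝓡 n) x →L[ℝ] ℝ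

end Fields

section Pointwise

variable {n : ℕ} {M : Type*} [TopologicalSpace M] [ChartedSpace (Rn n) M]

/-- Smooth vector fields. -/
def IsSmoothVField [IsManifold (𝓡 n) ∞ M] (X : VField n M) : Prop :=
  ContMDiff (𝓡 n) (𝓡 n).tangent ∞ (fun x ↦ (⟨x, X x⟩ : TangentBundle (𝓡 n) M))

/-- Vector fields that are differentiable at the point `x`. -/
def VFieldDiffAt [IsManifold (𝓡 n) ∞ M] (X : VField n M) (x : M) : Prop :=
  MDifferentiableAt (𝓡 n) (𝓡 n).tangent (fun y ↦ (⟨y, X y⟩ : TangentBundle (𝓡 n) M)) x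

/-- The differential `(df)_a` of a scalar field, evaluated on a tangent vector. -/
def dif (f : M → ℝ) (x : M) (v : TangentSpace (𝓡 n) x) : ℝ :=
  mfderiv (𝓡 n) 𝓘(ℝ, ℝ) f x v

/-- Smooth scalar fields. -/
def IsSmoothScalar (f : M → ℝ) : Prop := ContMDiff (𝓡 n) 𝓘(ℝ, ℝ) ∞ f

/-- A smooth Lorentzian metric of signature `(-,+,…,+)`: a smooth symmetric tensor field `g_{ab}`
that at each point is negative on some vector and positive definite on its orthogonal
complement. -/
structure IsLorentzMetric [IsManifold (𝓡 n) ∞ M] (g : Tensor2 n M) : Prop where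
  symm : ∀ (x : M) (v w : TangentSpace (𝓡 n) x), g x v w = g x w v
  signature : ∀ x : M, ∃ t : TangentSpace (𝓡 n) x, g x t t < 0 ∧
    ∀ v : TangentSpace (𝓡 n) x, g x t v = 0 → v ≠ 0 → 0 < g x v v
  smooth : ContMDiff (𝓡 n) ((𝓡 n).prod 𝓘(ℝ, Rn n →L[ℝ] Rn n →L[ℝ] ℝ)) ∞
    (fun x ↦ TotalSpace.mk' (Rn n →L[ℝ] Rn n →L[ℝ] ℝ)
      (E := fun x : M ↦ TangentSpace (𝓡 n) x →L[ℝ] TangentSpace (𝓡 n) x →L[ℝ] ℝ) x (g x))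

/-! ### Levi-Civita connection and Ricci tensor in a chart -/

/-- Partial derivative `∂_i F` of a function on `ℝⁿ`. -/
def pd (i : Fin n) (F : Rn n → ℝ) (y : Rn n) : ℝ :=
  fderiv ℝ F y (EuclideanSpace.single i (1 : ℝ))

/-- The coordinate vector `∂_i` of the chart `e` at the point with coordinates `y`. -/
def coordVec (e : OpenPartialHomeomorph M (Rn n)) (y : Rn n) (i : Fin n) :
    TangentSpace (𝓡 n) (e.symm y) :=
  mfderiv (𝓡 n) (𝓡 n) e.symm y (EuclideanSpace.single i (1 : ℝ) : Rn n)

/-- The component `v^i = dx^i(v)` of a tangent vector `v` at `x` in the chart `e`. -/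
def coordComp (e : OpenPartialHomeomorph M (Rn n)) (x : M) (v : TangentSpace (𝓡 n) x)
    (i : Fin n) : ℝ :=
  dif (fun y ↦ e y i) x v

/-- The matrix `g_{ij}(y)` of a metric in the chart `e`. -/
def metricMatrix (g : Tensor2 n M) (e : OpenPartialHomeomorph M (Rn n)) (y : Rn n) :
    Matrix (Fin n) (Fin n) ℝ :=
  Matrix.of fun i j ↦ g (e.symm y) (coordVec e y i) (coordVec e y j)

/-- The inverse metric `g^{ij}(y)` in the chart `e`. -/
def invMetric (g : Tensor2 n M) (e : OpenPartialHomeomorph M (Rn n)) (y : Rn n) :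
    Matrix (Fin n) (Fin n) ℝ :=
  (metricMatrix g e y)⁻¹

/-- The Christoffel symbols
`Γ^k_{ij} = ½ ∑_l g^{kl} (∂_i g_{jl} + ∂_j g_{il} - ∂_l g_{ij})` in the chart `e`. -/
def christoffel (g : Tensor2 n M) (e : OpenPartialHomeomorph M (Rn n)) (k i j : Fin n)
    (y : Rn n) : ℝ :=
  (1 / 2) * ∑ l, invMetric g e y k l *
    (pd i (fun z ↦ metricMatrix g e z j l) y + pd j (fun z ↦ metricMatrix g e z i l) y
      - pd l (fun z ↦ metricMatrix g e z i j) y)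

/-- The components `R_{ij} = ∂_k Γ^k_{ij} - ∂_i Γ^k_{kj} + Γ^l_{ij} Γ^k_{lk} - Γ^l_{kj} Γ^k_{li}`
of the Ricci tensor in the chart `e`. -/
def ricciComp (g : Tensor2 n M) (e : OpenPartialHomeomorph M (Rn n)) (i j : Fin n)
    (y : Rn n) : ℝ :=
  ∑ k, (pd k (christoffel g e k i j) y - pd i (christoffel g e k k j) y)
    + ∑ k, ∑ l, (christoffel g e l i j y * christoffel g e k l k y
        - christoffel g e l k j y * christoffel g e k l i y)

/-- The components `∇_i ∇_j f = ∂_i ∂_j f - Γ^k_{ij} ∂_k f` of the second covariant derivative of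
a scalar field in the chart `e`. -/
def hessComp (g : Tensor2 n M) (f : M → ℝ) (e : OpenPartialHomeomorph M (Rn n)) (i j : Fin n)
    (y : Rn n) : ℝ :=
  pd i (pd j (f ∘ e.symm)) y - ∑ k, christoffel g e k i j y * pd k (f ∘ e.symm) y

/-! ### The tensors at a point, read in the preferred chart there -/

/-- The Ricci tensor `R_{ab}` of the metric `g`. -/
def ricci (g : Tensor2 n M) (x : M) (v w : TangentSpace (𝓡 n) x) : ℝ :=
  ∑ i, ∑ j, ricciComp g (chartAt (Rn n) x) i j (chartAt (Rn n) x x)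
    * coordComp (chartAt (Rn n) x) x v i * coordComp (chartAt (Rn n) x) x w j

/-- The second covariant derivative `∇_a ∇_b f` for the Levi-Civita connection of `g`. -/
def hess (g : Tensor2 n M) (f : M → ℝ) (x : M) (v w : TangentSpace (𝓡 n) x) : ℝ :=
  ∑ i, ∑ j, hessComp g f (chartAt (Rn n) x) i j (chartAt (Rn n) x x)
    * coordComp (chartAt (Rn n) x) x v i * coordComp (chartAt (Rn n) x) x w j

/-- The d'Alembert operator `□ f = g^{ab} ∇_a ∇_b f`. -/
def box (g : Tensor2 n M) (f : M → ℝ) (x : M) : ℝ :=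
  ∑ i, ∑ j, invMetric g (chartAt (Rn n) x) (chartAt (Rn n) x x) i j
    * hessComp g f (chartAt (Rn n) x) i j (chartAt (Rn n) x x)

/-- The scalar product `g^{ab} (∇_a f)(∇_b h)` of two gradients. -/
def gradProd (g : Tensor2 n M) (f h : M → ℝ) (x : M) : ℝ :=
  ∑ i, ∑ j, invMetric g (chartAt (Rn n) x) (chartAt (Rn n) x x) i j
    * pd i (f ∘ (chartAt (Rn n) x).symm) (chartAt (Rn n) x x)
    * pd j (h ∘ (chartAt (Rn n) x).symm) (chartAt (Rn n) x x)

/-! ### Killing fields and their orbits -/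

/-- The squared norm `λ = g_{ab} ξ^a ξ^b`. -/
def normSq (g : Tensor2 n M) (ξ : VField n M) (x : M) : ℝ := g x (ξ x) (ξ x)

/-- `ξ` is a Killing field of `g`: it is smooth and `𝓛_ξ g = 0`, that is,
`ξ(g(X,Y)) = g([ξ,X],Y) + g(X,[ξ,Y])` at every point at which `X` and `Y` are differentiable. -/
structure IsKilling [IsManifold (𝓡 n) ∞ M] (g : Tensor2 n M) (ξ : VField n M) : Prop where
  smooth : IsSmoothVField ξ
  lie_eq_zero : ∀ (X Y : VField n M) (x : M), VFieldDiffAt X x → VFieldDiffAt Y x →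
    dif (n := n) (fun y ↦ g y (X y) (Y y)) x (ξ x) =
      g x (VectorField.mlieBracket (𝓡 n) ξ X x) (Y x)
        + g x (X x) (VectorField.mlieBracket (𝓡 n) ξ Y x)

/-- `ξ` is hypersurface orthogonal: near every point it is orthogonal to the level hypersurfaces
of some smooth function `f`, that is, `ξ_a = h ∇_a f`. -/
def IsHypersurfaceOrthogonal (g : Tensor2 n M) (ξ : VField n M) : Prop :=
  ∀ p : M, ∃ U : Set M, IsOpen U ∧ p ∈ U ∧ ∃ h f : M → ℝ,
    ContMDiffOn (𝓡 n) 𝓘(ℝ, ℝ) ∞ h U ∧ ContMDiffOn (𝓡 n) 𝓘(ℝ, ℝ) ∞ f U ∧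
    ∀ q ∈ U, ∀ v : TangentSpace (𝓡 n) q, g q (ξ q) v = h q * dif f q v

/-- The orbit of `ξ` through `p`: all points joined to `p` by an integral curve of `ξ`. -/
def orbit (ξ : VField n M) (p : M) : Set M :=
  {q | ∃ (γ : ℝ → M) (a b : ℝ), IsMIntegralCurveOn (I := 𝓡 n) γ ξ (Set.Ioo a b) ∧
    ∃ s ∈ Set.Ioo a b, ∃ t ∈ Set.Ioo a b, γ s = p ∧ γ t = q}

end Pointwise

/-! ### The reduction -/

section Reduction

variable {N : Type*} [TopologicalSpace N] [ChartedSpace (Rn 4) N]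
  {M : Type*} [TopologicalSpace M] [ChartedSpace (Rn 3) M]

/-- The 3-manifold `M`, through the embedding `ι`, is a hypersurface everywhere orthogonal to `ξ`
which meets every orbit of `ξ` in exactly one point; it is thereby identified with the space of
orbits of `ξ`. -/
structure IsOrbitHypersurface (g : Tensor2 4 N) (ξ : VField 4 N) (ι : M → N) : Prop where
  embedding : Manifold.IsSmoothEmbedding (𝓡 3) (𝓡 4) ∞ ι
  orthogonal : ∀ (m : M) (v : TangentSpace (𝓡 3) m),
    g (ι m) (ξ (ι m)) (mfderiv (𝓡 3) (𝓡 4) ι m v) = 0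
  existsUnique : ∀ p : N, ∃! m : M, ι m ∈ orbit ξ p

/-- The tensor `⁴g_{ab} - λ⁻¹ ξ_a ξ_b` on the 4-dimensional manifold. -/
def orthogonalPart (g : Tensor2 4 N) (ξ : VField 4 N) : Tensor2 4 N := fun x ↦
  g x - (normSq g ξ x)⁻¹ • (g x (ξ x)).smulRight (g x (ξ x))

/-- The metric `³g_{ab} = ⁴g_{ab} - λ⁻¹ ξ_a ξ_b` induced on `M`, as a pullback by `ι`. -/
def inducedMetric (g : Tensor2 4 N) (ξ : VField 4 N) (ι : M → N) : Tensor2 3 M := fun m ↦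
  (ContinuousLinearMap.precomp ℝ (mfderiv (𝓡 3) (𝓡 4) ι m)).comp
    ((orthogonalPart g ξ (ι m)).comp (mfderiv (𝓡 3) (𝓡 4) ι m))

/-- The conformally rescaled metric `g_{ab} = λ ³g_{ab}` on `M`. -/
def rescaledMetric (g : Tensor2 4 N) (ξ : VField 4 N) (ι : M → N) : Tensor2 3 M := fun m ↦
  normSq g ξ (ι m) • inducedMetric g ξ ι m

end Reduction

/-! ### Field equations -/

section Equations

/-- The 4-dimensional Einstein–Klein–Gordon equations
`R_{ab} = 8πG ∇_aφ ∇_bφ`, `□φ = 0` (`G` is Newton's constant). -/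
def EKG4 {N : Type*} [TopologicalSpace N] [ChartedSpace (Rn 4) N]
    (G : ℝ) (g : Tensor2 4 N) (φ : N → ℝ) : Prop :=
  (∀ (x : N) (v w : TangentSpace (𝓡 4) x),
    ricci g x v w = 8 * Real.pi * G * (dif φ x v * dif φ x w)) ∧
  ∀ x : N, box g φ x = 0

variable {M : Type*} [TopologicalSpace M] [ChartedSpace (Rn 3) M]

/-- The reduced equations for a 3-metric `h` (before the rescaling) and scalars `lam`, `φ`:
`R_{ab} = ½ λ⁻¹ ∇_a∇_bλ - ¼ λ⁻² ∇_aλ ∇_bλ + 8πG ∇_aφ ∇_bφ`,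
`□φ = -½ λ⁻¹ h^{ab} ∇_aφ ∇_bλ`, `□λ = ½ λ⁻¹ h^{ab} ∇_aλ ∇_bλ`. -/
def ReducedEquations (G : ℝ) (h : Tensor2 3 M) (lam φ : M → ℝ) : Prop :=
  (∀ (x : M) (v w : TangentSpace (𝓡 3) x),
    ricci h x v w = (1 / 2) * (lam x)⁻¹ * hess h lam x v w
      - (1 / 4) * (lam x)⁻¹ ^ 2 * (dif lam x v * dif lam x w)
      + 8 * Real.pi * G * (dif φ x v * dif φ x w)) ∧
  (∀ x : M, box h φ x = -((1 / 2) * (lam x)⁻¹ * gradProd h φ lam x)) ∧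
  ∀ x : M, box h lam x = (1 / 2) * (lam x)⁻¹ * gradProd h lam lam x

/-- The rescaled reduced equations for a 3-metric `h` and scalars `lam > 0`, `φ`:
`R_{ab} = ½ ∇_a log λ ∇_b log λ + 8πG ∇_aφ ∇_bφ`, `□φ = 0`, `□ log λ = 0`. -/
def RescaledEquations (G : ℝ) (h : Tensor2 3 M) (lam φ : M → ℝ) : Prop :=
  (∀ (x : M) (v w : TangentSpace (𝓡 3) x),
    ricci h x v w =
      (1 / 2) * (dif (fun y ↦ Real.log (lam y)) x v * dif (fun y ↦ Real.log (lam y)) x w)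
      + 8 * Real.pi * G * (dif φ x v * dif φ x w)) ∧
  (∀ x : M, box h φ x = 0) ∧
  ∀ x : M, box h (fun y ↦ Real.log (lam y)) x = 0

/-- 3-dimensional gravity coupled to two uncoupled massless scalars `φ₁`, `φ₂`:
`R_{ab} = ½ (∇_aφ₁ ∇_bφ₁ + ∇_aφ₂ ∇_bφ₂)`, `□φ₁ = □φ₂ = 0`. -/
def TwoScalarEKG3 (h : Tensor2 3 M) (φ₁ φ₂ : M → ℝ) : Prop :=
  (∀ (x : M) (v w : TangentSpace (𝓡 3) x),
    ricci h x v w = (1 / 2) * (dif φ₁ x v * dif φ₁ x w + dif φ₂ x v * dif φ₂ x w)) ∧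
  (∀ x : M, box h φ₁ x = 0) ∧
  ∀ x : M, box h φ₂ x = 0

end Equations

end Spacetime

end

/-! The flow of `ξ` started on the hypersurface gives coordinates `(t, x)` near each point of `M` in
which the 4-metric is `λ(x) dt² + h(x)`. The coefficients do not depend on `t` because `ξ` is
Killing, the mixed terms vanish because `M` is orthogonal to `ξ`, and `h` is the induced metric
(`IsAdapted.pullMatrix_eq_stat`). For such a metric, with `R_ij[h]`, `∇` and `□_h` belonging to `h`,
`R_00 = -½ □_h λ + ¼ λ⁻¹ |dλ|²`, `R_0i = 0`, `R_ij = R_ij[h] - ½ λ⁻¹ ∇_i∇_j λ + ¼ λ⁻² ∂_iλ ∂_jλ`,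
and `□φ = □_h φ + ½ λ⁻¹ ⟨dφ, dλ⟩` when `φ` is independent of `t` (`ric_stat`, `box_stat`). So at a
point of `M` the 4-dimensional equations are the reduced ones; the `00` component is the equation
for `λ`. Away from `M`, translation in `t` preserves metric and scalar, so validity of the equations
is constant along integral curves of `ξ` (`scalarGravityAt_integralCurve`), and every orbit reaches
`M`.

The passage to the rescaled metric is the conformal transformation law (`MetricAt.ric_smul`,
`MetricAt.box_smul`). In dimension three with factor `λ` the Hessian of `λ` drops out of the Ricci
equation, the term proportional to the metric vanishes by the equation for `λ`, and `¾ - ¼ = ½`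
remains in front of `λ⁻² dλ dλ`. The two-scalar form only rescales `φ` by a constant.

Two foundations carry this. The tensors are defined through components in the preferred chart at
each point, so using other coordinates requires the transformation laws under local diffeomorphisms
(`IsPull.ric_eq`, `IsPull.hes_eq`, then `IsMetric.ricci_push` and its companions). The formulas for
Christoffel symbols of pulled-back, static and rescaled metrics are all obtained by guessing the
answer and applying the uniqueness of the Levi-Civita connection (`MetricAt.Gam_unique`). The flow
coordinates require a flow depending smoothly on its initial point (`exists_smooth_flow`), which
comes from the inverse function theorem in a Banach space of paths. -/

noncomputable section

namespace Spacetime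

/-! ### Calculus of partial derivatives of locally smooth functions. -/

section PartialDerivatives

variable {n : ℕ} {F H : Rn n → ℝ} {y : Rn n}

/-- `f` is smooth in a neighborhood of `x`. -/
def CInf {E E' : Type*} [NormedAddCommGroup E] [NormedSpace ℝ E] [NormedAddCommGroup E']
    [NormedSpace ℝ E'] (f : E → E') (x : E) : Prop :=
  ∀ᶠ z in 𝓝 x, ContDiffAt ℝ ∞ f z

namespace CInf

variable {E E' E'' : Type*} [NormedAddCommGroup E] [NormedSpace ℝ E] [NormedAddCommGroup E']
  [NormedSpace ℝ E'] [NormedAddCommGroup E''] [NormedSpace ℝ E''] {f g : E → E'} {x : E}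

lemma contDiffAt (h : CInf f x) : ContDiffAt ℝ ∞ f x := h.self_of_nhds

lemma differentiableAt (h : CInf f x) : DifferentiableAt ℝ f x :=
  h.contDiffAt.differentiableAt (by simp)

lemma continuousAt (h : CInf f x) : ContinuousAt f x := h.contDiffAt.continuousAt

/-- `ContDiffAt ℝ ∞` at a point provides a neighborhood for each finite order separately and so need
not hold at nearby points. `CInf` is open by construction, which is what allows identities to be
differentiated. -/
lemma eventually (h : CInf f x) : ∀ᶠ z in 𝓝 x, CInf f z := eventually_eventually_nhds.2 h

lemma congr (h : CInf f x) (hg : g =ᶠ[𝓝 x] f) : CInf g x := by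
  filter_upwards [h, hg.eventuallyEq_nhds] with z h1 h2
  exact h1.congr_of_eventuallyEq h2

lemma const (c : E') : CInf (fun _ : E ↦ c) x := Filter.Eventually.of_forall fun _ ↦
  contDiffAt_const

lemma _root_.ContDiff.cInf (h : ContDiff ℝ ∞ f) : CInf f x :=
  Filter.Eventually.of_forall fun _ ↦ h.contDiffAt

lemma _root_.ContDiffOn.cInf {s : Set E} (h : ContDiffOn ℝ ∞ f s) (hs : s ∈ 𝓝 x) : CInf f x := by
  filter_upwards [eventually_mem_nhds_iff.2 hs] with z hz using h.contDiffAt hz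

lemma add (hf : CInf f x) (hg : CInf g x) : CInf (fun z ↦ f z + g z) x := by
  filter_upwards [hf, hg] with z h1 h2 using h1.add h2

lemma sub (hf : CInf f x) (hg : CInf g x) : CInf (fun z ↦ f z - g z) x := by
  filter_upwards [hf, hg] with z h1 h2 using h1.sub h2

lemma mul {f g : E → ℝ} (hf : CInf f x) (hg : CInf g x) : CInf (fun z ↦ f z * g z) x := by
  filter_upwards [hf, hg] with z h1 h2 using h1.mul h2

lemma inv {f : E → ℝ} (hf : CInf f x) (h0 : f x ≠ 0) : CInf (fun z ↦ (f z)⁻¹) x := by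
  filter_upwards [hf, hf.continuousAt.eventually_ne h0] with z h1 h2 using h1.inv h2

lemma sum {ι : Type*} {s : Finset ι} {f : ι → E → E'} (hf : ∀ k ∈ s, CInf (f k) x) :
    CInf (fun z ↦ ∑ k ∈ s, f k z) x := by
  filter_upwards [(Filter.eventually_all_finset s).2 hf] with z hz
  exact ContDiffAt.sum hz

lemma comp {g : E' → E''} (hg : CInf g (f x)) (hf : CInf f x) : CInf (fun z ↦ g (f z)) x := by
  filter_upwards [hf, hf.continuousAt.eventually hg] with z h1 h2
  exact h2.comp z h1

end CInf

lemma pd_congr {i : Fin n} (h : F =ᶠ[𝓝 y] H) : pd i F y = pd i H y := by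
  rw [pd, pd, h.fderiv_eq]

lemma pd_eventuallyEq {i : Fin n} (h : F =ᶠ[𝓝 y] H) : pd i F =ᶠ[𝓝 y] pd i H :=
  h.eventuallyEq_nhds.mono fun _ hz ↦ pd_congr hz

@[simp] lemma pd_const (i : Fin n) (c : ℝ) : pd i (fun _ ↦ c) y = 0 := by
  simp [pd]

lemma pd_add (i : Fin n) (hF : DifferentiableAt ℝ F y) (hH : DifferentiableAt ℝ H y) :
    pd i (fun z ↦ F z + H z) y = pd i F y + pd i H y := by
  simp [pd, fderiv_fun_add hF hH]

lemma pd_sub (i : Fin n) (hF : DifferentiableAt ℝ F y) (hH : DifferentiableAt ℝ H y) :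
    pd i (fun z ↦ F z - H z) y = pd i F y - pd i H y := by
  simp [pd, fderiv_fun_sub hF hH]

lemma pd_mul (i : Fin n) (hF : DifferentiableAt ℝ F y) (hH : DifferentiableAt ℝ H y) :
    pd i (fun z ↦ F z * H z) y = pd i F y * H y + F y * pd i H y := by
  simp [pd, fderiv_fun_mul hF hH]; ring

lemma pd_const_mul (i : Fin n) (c : ℝ) (hF : DifferentiableAt ℝ F y) :
    pd i (fun z ↦ c * F z) y = c * pd i F y := by
  rw [pd_mul i (by fun_prop) hF]; simp

lemma pd_sum {ι : Type*} (s : Finset ι) (i : Fin n) {F : ι → Rn n → ℝ}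
    (hF : ∀ k ∈ s, DifferentiableAt ℝ (F k) y) :
    pd i (fun z ↦ ∑ k ∈ s, F k z) y = ∑ k ∈ s, pd i (F k) y := by
  simp [pd, fderiv_fun_sum hF]

lemma pd_comp_real (i : Fin n) {u : ℝ → ℝ} {u' : ℝ} (hu : HasDerivAt u u' (F y))
    (hF : DifferentiableAt ℝ F y) : pd i (fun z ↦ u (F z)) y = u' * pd i F y := by
  have := (hu.comp_hasFDerivAt y hF.hasFDerivAt).fderiv
  simp only [Function.comp_def] at this
  simp [pd, this]

lemma CInf.pd {n : ℕ} {F : Rn n → ℝ} {y : Rn n} (hF : CInf F y) (i : Fin n) :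
    CInf (pd i F) y := by
  filter_upwards [hF] with z hz
  exact (hz.fderiv_right (m := ∞) (by simp)).clm_apply contDiffAt_const

lemma fderiv_eq_sum_pd {n : ℕ} (F : Rn n → ℝ) (y v : Rn n) :
    fderiv ℝ F y v = ∑ i, v i * pd i F y := by
  conv_lhs => rw [← (EuclideanSpace.basisFun (Fin n) ℝ).sum_repr v]
  simp [pd, map_sum]

/-- Both sides are values of the second Fréchet derivative on a pair of basis vectors, and that
derivative is symmetric. -/
lemma pd_comm {n : ℕ} {F : Rn n → ℝ} {y : Rn n} (i j : Fin n) (hF : CInf F y) :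
    pd i (pd j F) y = pd j (pd i F) y := by
  have hd : DifferentiableAt ℝ (fderiv ℝ F) y :=
    (hF.contDiffAt.fderiv_right (m := ∞) (by simp)).differentiableAt (by simp)
  have key : ∀ a b : Fin n, pd a (pd b F) y
      = fderiv ℝ (fderiv ℝ F) y (EuclideanSpace.single a 1) (EuclideanSpace.single b 1) := by
    intro a b
    change fderiv ℝ (fun z ↦ fderiv ℝ F z (EuclideanSpace.single b 1)) y _ = _
    rw [fderiv_clm_apply hd (by fun_prop)]
    simp
  rw [key, key]
  exact (hF.contDiffAt.isSymmSndFDerivAt (by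
    simpa using (WithTop.coe_le_coe.2 le_top : ((2 : ℕ∞) : WithTop ℕ∞) ≤ ∞))) _ _

lemma pd_comp {n m : ℕ} {F : Rn m → ℝ} {Ψ : Rn n → Rn m} {y : Rn n} (i : Fin n)
    (hF : DifferentiableAt ℝ F (Ψ y)) (hΨ : DifferentiableAt ℝ Ψ y) :
    pd i (fun z ↦ F (Ψ z)) y = ∑ b, pd i (fun z ↦ Ψ z b) y * pd b F (Ψ y) := by
  have h := fderiv_comp y hF hΨ
  simp only [Function.comp_def] at h
  have h2 : ∀ b, pd i (fun z ↦ Ψ z b) y = fderiv ℝ Ψ y (EuclideanSpace.single i 1) b := by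
    intro b
    have := ((EuclideanSpace.proj (𝕜 := ℝ) b).hasFDerivAt.comp y hΨ.hasFDerivAt).fderiv
    change fderiv ℝ (fun z ↦ Ψ z b) y = _ at this
    simp only [pd, this]
    rfl
  rw [pd, h, ContinuousLinearMap.comp_apply, fderiv_eq_sum_pd]
  simp [h2]

end PartialDerivatives

/-! ### Entrywise calculus of matrix-valued functions. -/

section MatrixFields

variable {n : ℕ} {ι κ τ : Type*}

/-- A matrix-valued function on `ℝⁿ` whose entries are smooth at `y`. -/
def MSm (A : Rn n → Matrix ι κ ℝ) (y : Rn n) : Prop :=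
  ∀ a b, CInf (fun z ↦ A z a b) y

/-- The entrywise partial derivative of a matrix-valued function. -/
def mpd (i : Fin n) (A : Rn n → Matrix ι κ ℝ) (y : Rn n) : Matrix ι κ ℝ :=
  Matrix.of fun a b ↦ pd i (fun z ↦ A z a b) y

@[simp] lemma mpd_apply (i : Fin n) (A : Rn n → Matrix ι κ ℝ) (y : Rn n) (a : ι) (b : κ) :
    mpd i A y a b = pd i (fun z ↦ A z a b) y := rfl

lemma MSm.diff {A : Rn n → Matrix ι κ ℝ} {y : Rn n} (h : MSm A y) (a : ι) (b : κ) :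
    DifferentiableAt ℝ (fun z ↦ A z a b) y := (h a b).differentiableAt

lemma MSm.congr {A B : Rn n → Matrix ι κ ℝ} {y : Rn n} (h : MSm A y) (hAB : B =ᶠ[𝓝 y] A) :
    MSm B y := fun a b ↦ (h a b).congr (hAB.mono fun z hz ↦ by simp [hz])

lemma MSm.eventually [Finite ι] [Finite κ] {A : Rn n → Matrix ι κ ℝ} {y : Rn n} (h : MSm A y) :
    ∀ᶠ z in 𝓝 y, MSm A z := by
  simp only [MSm, Filter.eventually_all]
  exact fun a b ↦ (h a b).eventually

lemma MSm.transpose {A : Rn n → Matrix ι κ ℝ} {y : Rn n} (h : MSm A y) :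
    MSm (fun z ↦ (A z).transpose) y := fun a b ↦ h b a

lemma MSm.smul {f : Rn n → ℝ} {A : Rn n → Matrix ι κ ℝ} {y : Rn n} (hf : CInf f y)
    (hA : MSm A y) : MSm (fun z ↦ f z • A z) y := fun a b ↦ hf.mul (hA a b)

lemma MSm.sum {σ : Type*} (s : Finset σ) {A : σ → Rn n → Matrix ι κ ℝ} {y : Rn n}
    (hA : ∀ k ∈ s, MSm (A k) y) : MSm (fun z ↦ ∑ k ∈ s, A k z) y := fun a b ↦ by
  simp only [Matrix.sum_apply]
  exact CInf.sum fun k hk ↦ hA k hk a b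

lemma MSm.mul [Fintype κ] {A : Rn n → Matrix ι κ ℝ} {B : Rn n → Matrix κ τ ℝ} {y : Rn n}
    (hA : MSm A y) (hB : MSm B y) : MSm (fun z ↦ A z * B z) y := fun a b ↦ by
  simp only [Matrix.mul_apply]
  exact CInf.sum fun k _ ↦ (hA a k).mul (hB k b)

lemma MSm.comp {m : ℕ} {A : Rn m → Matrix ι κ ℝ} {Ψ : Rn n → Rn m} {y : Rn n}
    (hA : MSm A (Ψ y)) (hΨ : CInf Ψ y) : MSm (fun z ↦ A (Ψ z)) y :=
  fun a b ↦ CInf.comp (hA a b) hΨ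

lemma MSm.mpd {A : Rn n → Matrix ι κ ℝ} {y : Rn n} (hA : MSm A y) (i : Fin n) :
    MSm (mpd i A) y := fun a b ↦ (hA a b).pd i

lemma MSm.det [Fintype ι] [DecidableEq ι] {A : Rn n → Matrix ι ι ℝ} {y : Rn n} (hA : MSm A y) :
    CInf (fun z ↦ (A z).det) y := by
  simp only [Matrix.det_apply, Units.smul_def, zsmul_eq_mul]
  refine CInf.sum fun σ _ ↦ (CInf.const _).mul ?_
  filter_upwards [Filter.eventually_all.2 fun i ↦ hA (σ i) i] with z hz
  exact contDiffAt_prod fun i _ ↦ hz i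

/-- Cramer's rule: an entry of the inverse is a cofactor divided by the determinant, and the
cofactor is itself the determinant of a smooth matrix with one row made constant. -/
lemma MSm.inv [Fintype ι] [DecidableEq ι] {A : Rn n → Matrix ι ι ℝ} {y : Rn n} (hA : MSm A y)
    (hdet : (A y).det ≠ 0) : MSm (fun z ↦ (A z)⁻¹) y := fun a b ↦ by
  simp only [Matrix.inv_def, Matrix.smul_apply, Ring.inverse_eq_inv, smul_eq_mul,
    Matrix.adjugate_apply]
  refine (hA.det.inv hdet).mul (MSm.det fun c d ↦ ?_)
  by_cases hc : c = b
  · subst hc; simpa [Matrix.updateRow_self] using (CInf.const _)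
  · simpa [Matrix.updateRow_ne hc] using hA c d

lemma mpd_congr {A B : Rn n → Matrix ι κ ℝ} {y : Rn n} (i : Fin n) (h : A =ᶠ[𝓝 y] B) :
    mpd i A y = mpd i B y := by
  ext a b; exact pd_congr (h.mono fun z hz ↦ by simp [hz])

lemma mpd_add {A B : Rn n → Matrix ι κ ℝ} {y : Rn n} (i : Fin n) (hA : MSm A y) (hB : MSm B y) :
    mpd i (fun z ↦ A z + B z) y = mpd i A y + mpd i B y := by
  ext a b; exact pd_add i (hA.diff a b) (hB.diff a b)

lemma mpd_transpose {A : Rn n → Matrix ι κ ℝ} {y : Rn n} (i : Fin n) :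
    mpd i (fun z ↦ (A z).transpose) y = (mpd i A y).transpose := rfl

lemma mpd_mul [Fintype κ] {A : Rn n → Matrix ι κ ℝ} {B : Rn n → Matrix κ τ ℝ} {y : Rn n}
    (i : Fin n) (hA : MSm A y) (hB : MSm B y) :
    mpd i (fun z ↦ A z * B z) y = mpd i A y * B y + A y * mpd i B y := by
  ext a b
  simp only [mpd_apply, Matrix.mul_apply, Matrix.add_apply]
  rw [← Finset.sum_add_distrib]
  refine (pd_sum _ _ fun k _ ↦ (hA.diff a k).fun_mul (hB.diff k b)).trans ?_
  exact Finset.sum_congr rfl fun k _ ↦ pd_mul i (hA.diff a k) (hB.diff k b)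

lemma mpd_sum {σ : Type*} (s : Finset σ) {A : σ → Rn n → Matrix ι κ ℝ} {y : Rn n} (i : Fin n)
    (hA : ∀ k ∈ s, MSm (A k) y) :
    mpd i (fun z ↦ ∑ k ∈ s, A k z) y = ∑ k ∈ s, mpd i (A k) y := by
  ext a b
  simp only [mpd_apply, Matrix.sum_apply]
  exact pd_sum _ _ fun k hk ↦ (hA k hk).diff a b

lemma mpd_smul {f : Rn n → ℝ} {A : Rn n → Matrix ι κ ℝ} {y : Rn n} (i : Fin n)
    (hf : CInf f y) (hA : MSm A y) :
    mpd i (fun z ↦ f z • A z) y = pd i f y • A y + f y • mpd i A y := by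
  ext a b
  simpa using! pd_mul i hf.differentiableAt (hA.diff a b)

lemma mpd_comp {m : ℕ} {A : Rn m → Matrix ι κ ℝ} {Ψ : Rn n → Rn m} {y : Rn n} (i : Fin n)
    (hA : MSm A (Ψ y)) (hΨ : CInf Ψ y) :
    mpd i (fun z ↦ A (Ψ z)) y = ∑ b, pd i (fun z ↦ Ψ z b) y • mpd b A (Ψ y) := by
  ext a b
  simpa [Matrix.sum_apply] using! pd_comp i (hA.diff a b) hΨ.differentiableAt

end MatrixFields

/-! ### Levi-Civita connection and curvature on open sets of `ℝⁿ`, in matrix form. -/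

section LocalGeometry

variable {n : ℕ}

/-- The Christoffel symbols of a matrix-valued function on `ℝⁿ`. -/
def chr (A : Rn n → Matrix (Fin n) (Fin n) ℝ) (k i j : Fin n) (y : Rn n) : ℝ :=
  (1 / 2) * ∑ l, (A y)⁻¹ k l *
    (pd i (fun z ↦ A z j l) y + pd j (fun z ↦ A z i l) y - pd l (fun z ↦ A z i j) y)

/-- The Ricci tensor of a matrix-valued function on `ℝⁿ`. -/
def ric (A : Rn n → Matrix (Fin n) (Fin n) ℝ) (y : Rn n) : Matrix (Fin n) (Fin n) ℝ :=
  Matrix.of fun i j ↦ ∑ k, (pd k (chr A k i j) y - pd i (chr A k k j) y)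
    + ∑ k, ∑ l, (chr A l i j y * chr A k l k y - chr A l k j y * chr A k l i y)

/-- The covariant Hessian of a function on `ℝⁿ`. -/
def hes (A : Rn n → Matrix (Fin n) (Fin n) ℝ) (f : Rn n → ℝ) (y : Rn n) :
    Matrix (Fin n) (Fin n) ℝ :=
  Matrix.of fun i j ↦ pd i (pd j f) y - ∑ k, chr A k i j y * pd k f y

/-- The matrix `∂_i f ∂_j h`. -/
def grd (f h : Rn n → ℝ) (y : Rn n) : Matrix (Fin n) (Fin n) ℝ :=
  Matrix.of fun i j ↦ pd i f y * pd j h y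

/-- The trace of a covariant 2-tensor. -/
def mtr (A S : Matrix (Fin n) (Fin n) ℝ) : ℝ := ∑ i, ∑ j, A⁻¹ i j * S i j

lemma mtr_eq_trace (A S : Matrix (Fin n) (Fin n) ℝ) : mtr A S = (A⁻¹ * S.transpose).trace := by
  simp [mtr, Matrix.trace, Matrix.mul_apply]

/-- The Christoffel symbols as a family of matrices. -/
def Gam (A : Rn n → Matrix (Fin n) (Fin n) ℝ) (i : Fin n) (y : Rn n) :
    Matrix (Fin n) (Fin n) ℝ :=
  Matrix.of fun k j ↦ chr A k i j y

@[simp] lemma Gam_apply (A : Rn n → Matrix (Fin n) (Fin n) ℝ) (i : Fin n) (y : Rn n)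
    (k j : Fin n) : Gam A i y k j = chr A k i j y := rfl

/-- A smooth field of nondegenerate symmetric matrices near `y`. -/
structure MetricAt (A : Rn n → Matrix (Fin n) (Fin n) ℝ) (y : Rn n) : Prop where
  smooth : MSm A y
  symm : ∀ᶠ z in 𝓝 y, (A z).IsSymm
  det : (A y).det ≠ 0

variable {A B : Rn n → Matrix (Fin n) (Fin n) ℝ} {y : Rn n}

lemma MetricAt.eventually (h : MetricAt A y) : ∀ᶠ z in 𝓝 y, MetricAt A z := by
  filter_upwards [h.smooth.eventually, h.symm.eventually_nhds,
    h.smooth.det.continuousAt.eventually_ne h.det] with z h1 h2 h3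
  exact ⟨h1, h2, h3⟩

lemma MetricAt.congr (h : MetricAt A y) (hAB : B =ᶠ[𝓝 y] A) : MetricAt B y where
  smooth := h.smooth.congr hAB
  symm := by filter_upwards [h.symm, hAB] with z h1 h2; rwa [h2]
  det := by rw [hAB.self_of_nhds]; exact h.det

lemma MetricAt.mul_inv (h : MetricAt A y) : A y * (A y)⁻¹ = 1 :=
  Matrix.mul_nonsing_inv _ (isUnit_iff_ne_zero.2 h.det)

lemma MetricAt.inv_mul (h : MetricAt A y) : (A y)⁻¹ * A y = 1 :=
  Matrix.nonsing_inv_mul _ (isUnit_iff_ne_zero.2 h.det)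

lemma MetricAt.mpd_symm (h : MetricAt A y) (i : Fin n) : (mpd i A y).IsSymm := by
  change (mpd i A y).transpose = _
  rw [← mpd_transpose]
  exact mpd_congr i h.symm

lemma MetricAt.pd_swap (h : MetricAt A y) (i a b : Fin n) :
    pd i (fun z ↦ A z a b) y = pd i (fun z ↦ A z b a) y :=
  (h.mpd_symm i).apply b a

lemma MetricAt.cInf_chr (h : MetricAt A y) (k i j : Fin n) :
    CInf (chr A k i j) y := by
  have hi := h.smooth.inv h.det
  unfold chr
  refine (CInf.const _).mul (CInf.sum fun l _ ↦ (hi k l).mul ?_)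
  exact ((CInf.pd (h.smooth _ _) _).add (CInf.pd (h.smooth _ _) _)).sub
    (CInf.pd (h.smooth _ _) _)

lemma MetricAt.smooth_Gam (h : MetricAt A y) (i : Fin n) : MSm (Gam A i) y :=
  fun k j ↦ h.cInf_chr k i j

lemma MetricAt.chr_symm (h : MetricAt A y) (k i j : Fin n) : chr A k i j y = chr A k j i y := by
  unfold chr
  congr 1
  refine Finset.sum_congr rfl fun l _ ↦ ?_
  rw [h.pd_swap l i j]; ring

/-- Lowering the upper index cancels the inverse metric and leaves the Christoffel symbols of the
first kind, which are linear in the derivatives of `A`. -/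
lemma MetricAt.mul_Gam (h : MetricAt A y) (i l j : Fin n) :
    (A y * Gam A i y) l j = (1 / 2) * (pd i (fun z ↦ A z j l) y + pd j (fun z ↦ A z i l) y
      - pd l (fun z ↦ A z i j) y) := by
  have : (fun k ↦ Gam A i y k j) = (A y)⁻¹.mulVec fun l ↦ (1 / 2) *
      (pd i (fun z ↦ A z j l) y + pd j (fun z ↦ A z i l) y - pd l (fun z ↦ A z i j) y) := by
    ext k
    simp only [Gam_apply, chr, Matrix.mulVec, dotProduct, Finset.mul_sum]
    exact Finset.sum_congr rfl fun _ _ ↦ by ring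
  change (A y).mulVec (fun k ↦ Gam A i y k j) l = _
  rw [this, Matrix.mulVec_mulVec, h.mul_inv, Matrix.one_mulVec]

/-- The Levi-Civita connection is metric. -/
lemma MetricAt.mpd_eq (h : MetricAt A y) (i : Fin n) :
    mpd i A y = (Gam A i y).transpose * A y + A y * Gam A i y := by
  have hs : (A y).transpose = A y := h.symm.self_of_nhds
  have : (Gam A i y).transpose * A y = (A y * Gam A i y).transpose := by
    rw [Matrix.transpose_mul, hs]
  ext a b
  rw [this, Matrix.add_apply, Matrix.transpose_apply, h.mul_Gam, h.mul_Gam, mpd_apply,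
    h.pd_swap i b a]
  linarith [h.pd_swap a b i, h.pd_swap b a i]

/-- The Levi-Civita connection is the unique symmetric metric connection. -/
lemma MetricAt.Gam_unique (h : MetricAt A y) {C : Fin n → Matrix (Fin n) (Fin n) ℝ}
    (hsymm : ∀ i j k, C i k j = C j k i)
    (hC : ∀ i, mpd i A y = (C i).transpose * A y + A y * C i) (i : Fin n) : Gam A i y = C i := by
  have hs : (A y).transpose = A y := h.symm.self_of_nhds
  have e : ∀ i a b, pd i (fun z ↦ A z a b) y = (A y * C i) b a + (A y * C i) a b := by
    intro i a b
    have h1 := congrFun (congrFun (hC i) a) b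
    rw [mpd_apply] at h1
    rw [h1, Matrix.add_apply]
    congr 1
    rw [← Matrix.transpose_apply (A y * C i), Matrix.transpose_mul, hs]
  have es : ∀ i j l, (A y * C i) l j = (A y * C j) l i := by
    intro i j l
    simp only [Matrix.mul_apply, hsymm i j]
  -- Koszul's argument: metricity turns the three derivatives into six terms; by the symmetry `es`
  -- four of them cancel in pairs and the other two coincide.
  have key : A y * Gam A i y = A y * C i := by
    ext l j
    rw [h.mul_Gam, e, e, e, es j i l, es i l j, es j l i]
    ring
  calc Gam A i y = (A y)⁻¹ * (A y * Gam A i y) := by rw [← Matrix.mul_assoc, h.inv_mul, one_mul]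
    _ = C i := by rw [key, ← Matrix.mul_assoc, h.inv_mul, one_mul]

/-- The curvature matrices of the Levi-Civita connection. -/
def curv (A : Rn n → Matrix (Fin n) (Fin n) ℝ) (i l : Fin n) (y : Rn n) :
    Matrix (Fin n) (Fin n) ℝ :=
  mpd i (Gam A l) y - mpd l (Gam A i) y + (Gam A i y * Gam A l y - Gam A l y * Gam A i y)

/-- Ricci is the contraction of the curvature matrices on the upper index and the first form index.
The symmetry of the lower indices matches the index order of `ric` with that of matrix products. -/
lemma MetricAt.ric_apply (h : MetricAt A y) (i j : Fin n) :
    ric A y i j = ∑ k, curv A k i y k j := by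
  simp only [ric, curv, Matrix.of_apply, Matrix.add_apply, Matrix.sub_apply, mpd_apply, Gam_apply,
    Matrix.mul_apply]
  rw [Finset.sum_add_distrib]
  congr 1
  refine Finset.sum_congr rfl fun k _ ↦ ?_
  rw [← Finset.sum_sub_distrib]
  refine Finset.sum_congr rfl fun l _ ↦ ?_
  rw [h.chr_symm k l k, h.chr_symm k l i]
  ring

lemma chr_eventuallyEq (h : A =ᶠ[𝓝 y] B) (k i j : Fin n) : chr A k i j =ᶠ[𝓝 y] chr B k i j := by
  filter_upwards [h.eventuallyEq_nhds] with z hz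
  have e : ∀ a b, (fun w ↦ A w a b) =ᶠ[𝓝 z] fun w ↦ B w a b := fun a b ↦
    hz.mono fun w hw ↦ by simp [hw]
  simp only [chr, hz.self_of_nhds, pd_congr (e _ _)]

lemma ric_congr (h : A =ᶠ[𝓝 y] B) : ric A y = ric B y := by
  ext i j
  simp only [ric, Matrix.of_apply, pd_congr (chr_eventuallyEq h _ _ _),
    (chr_eventuallyEq h _ _ _).self_of_nhds]

lemma hes_congr (h : A =ᶠ[𝓝 y] B) {f g : Rn n → ℝ} (hf : f =ᶠ[𝓝 y] g) :
    hes A f y = hes B g y := by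
  ext i j
  simp only [hes, Matrix.of_apply, pd_congr (pd_eventuallyEq hf), pd_congr hf,
    (chr_eventuallyEq h _ _ _).self_of_nhds]

lemma grd_congr {f g f' g' : Rn n → ℝ} (hf : f =ᶠ[𝓝 y] f') (hg : g =ᶠ[𝓝 y] g') :
    grd f g y = grd f' g' y := by
  ext i j
  simp only [grd, Matrix.of_apply, pd_congr hf, pd_congr hg]

end LocalGeometry

/-! ### Transformation laws under local diffeomorphisms. -/

section Pullback

variable {n : ℕ}

/-- The Jacobian matrix of a map. -/
def jac {m : ℕ} (Ψ : Rn n → Rn m) (y : Rn n) : Matrix (Fin m) (Fin n) ℝ :=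
  Matrix.of fun a i ↦ pd i (fun z ↦ Ψ z a) y

@[simp] lemma jac_apply {m : ℕ} (Ψ : Rn n → Rn m) (y : Rn n) (a : Fin m) (i : Fin n) :
    jac Ψ y a i = pd i (fun z ↦ Ψ z a) y := rfl

lemma CInf.coord {m : ℕ} {Ψ : Rn n → Rn m} {y : Rn n} (h : CInf Ψ y) (a : Fin m) :
    CInf (fun z ↦ Ψ z a) y := by
  filter_upwards [h] with z hz using (contDiffAt_euclidean.1 hz) a

lemma CInf.jac {m : ℕ} {Ψ : Rn n → Rn m} {y : Rn n} (h : CInf Ψ y) : MSm (jac Ψ) y :=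
  fun a i ↦ (h.coord a).pd i

variable {A B : Rn n → Matrix (Fin n) (Fin n) ℝ} {Ψ : Rn n → Rn n} {y : Rn n}

/-- The pullback of a matrix-valued connection form. -/
def pullGam (A : Rn n → Matrix (Fin n) (Fin n) ℝ) (Ψ : Rn n → Rn n) (i : Fin n) (z : Rn n) :
    Matrix (Fin n) (Fin n) ℝ :=
  ∑ b, jac Ψ z b i • Gam A b (Ψ z)

/-- `B` is the pullback of the metric `A` by the local diffeomorphism `Ψ`, near `y`. -/
structure IsPull (A B : Rn n → Matrix (Fin n) (Fin n) ℝ) (Ψ : Rn n → Rn n) (y : Rn n) : Prop where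
  smooth : CInf Ψ y
  det : (jac Ψ y).det ≠ 0
  metric : MetricAt A (Ψ y)
  eq : ∀ᶠ z in 𝓝 y, B z = (jac Ψ z).transpose * A (Ψ z) * jac Ψ z

lemma IsPull.eventually (h : IsPull A B Ψ y) : ∀ᶠ z in 𝓝 y, IsPull A B Ψ z := by
  filter_upwards [h.smooth.eventually, h.smooth.jac.det.continuousAt.eventually_ne h.det,
    h.smooth.continuousAt.eventually h.metric.eventually, h.eq.eventually_nhds] with z h1 h2 h3 h4
  exact ⟨h1, h2, h3, h4⟩

lemma IsPull.metricAt (h : IsPull A B Ψ y) : MetricAt B y where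
  smooth := ((h.smooth.jac.transpose.mul (h.metric.smooth.comp h.smooth)).mul h.smooth.jac).congr
    h.eq
  symm := by
    filter_upwards [h.eq, h.smooth.continuousAt.eventually h.metric.symm] with z h1 h2
    rw [h1, Matrix.IsSymm, Matrix.transpose_mul, Matrix.transpose_mul, Matrix.transpose_transpose,
      h2, Matrix.mul_assoc]
  det := by
    rw [h.eq.self_of_nhds, Matrix.det_mul, Matrix.det_mul, Matrix.det_transpose]
    exact mul_ne_zero (mul_ne_zero h.det h.metric.det) h.det

lemma IsPull.mul_inv (h : IsPull A B Ψ y) : jac Ψ y * (jac Ψ y)⁻¹ = 1 :=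
  Matrix.mul_nonsing_inv _ (isUnit_iff_ne_zero.2 h.det)

lemma IsPull.inv_mul (h : IsPull A B Ψ y) : (jac Ψ y)⁻¹ * jac Ψ y = 1 :=
  Matrix.nonsing_inv_mul _ (isUnit_iff_ne_zero.2 h.det)

lemma IsPull.smooth_pullGam (h : IsPull A B Ψ y) (i : Fin n) : MSm (pullGam A Ψ i) y :=
  MSm.sum _ fun b _ ↦ MSm.smul (h.smooth.jac b i) ((h.metric.smooth_Gam b).comp h.smooth)

lemma mpd_jac_symm {m : ℕ} {Ψ : Rn n → Rn m} {y : Rn n} (h : CInf Ψ y) (i j : Fin n)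
    (a : Fin m) : mpd i (jac Ψ) y a j = mpd j (jac Ψ) y a i :=
  pd_comm i j (h.coord a)

/-- The transformation law of the Christoffel symbols. -/
lemma IsPull.jac_mul_Gam (h : IsPull A B Ψ y) (i : Fin n) :
    jac Ψ y * Gam B i y = pullGam A Ψ i y * jac Ψ y + mpd i (jac Ψ) y := by
  -- The candidate is the gauge transform of the pulled-back connection by the Jacobian; it suffices
  -- to see that it is symmetric and metric for `B`.
  have key : Gam B i y = (jac Ψ y)⁻¹ * (pullGam A Ψ i y * jac Ψ y + mpd i (jac Ψ) y) := by
    refine h.metricAt.Gam_unique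
      (C := fun i ↦ (jac Ψ y)⁻¹ * (pullGam A Ψ i y * jac Ψ y + mpd i (jac Ψ) y)) ?_ ?_ i
    · intro i j k
      simp only [Matrix.mul_apply, Matrix.add_apply, mpd_jac_symm h.smooth i j]
      refine Finset.sum_congr rfl fun a _ ↦ ?_
      congr 2
      simp only [pullGam, Matrix.sum_apply, Matrix.smul_apply, smul_eq_mul, Finset.sum_mul]
      rw [Finset.sum_comm]
      refine Finset.sum_congr rfl fun b _ ↦ Finset.sum_congr rfl fun c _ ↦ ?_
      rw [Gam_apply, Gam_apply, h.metric.chr_symm a b c]; ring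
    · intro i
      have hJ := h.smooth.jac
      have hA := h.metric.smooth.comp h.smooth
      rw [mpd_congr i h.eq, mpd_mul i (hJ.transpose.mul hA) hJ, mpd_mul i hJ.transpose hA,
        mpd_transpose, mpd_comp i h.metric.smooth h.smooth, h.eq.self_of_nhds]
      -- Metricity of the connection of `A`, carried through the chain rule to the pulled-back
      -- connection.
      have e : ∑ b, pd i (fun z ↦ Ψ z b) y • mpd b A (Ψ y)
          = (pullGam A Ψ i y).transpose * A (Ψ y) + A (Ψ y) * pullGam A Ψ i y := by
        simp only [pullGam, h.metric.mpd_eq, Matrix.transpose_sum, Matrix.transpose_smul,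
          Finset.sum_mul, Finset.mul_sum, smul_add, Finset.sum_add_distrib, Matrix.smul_mul,
          Matrix.mul_smul, jac_apply]
      rw [e]
      have h1 : ∀ X : Matrix (Fin n) (Fin n) ℝ, jac Ψ y * ((jac Ψ y)⁻¹ * X) = X := fun X ↦ by
        rw [← Matrix.mul_assoc, h.mul_inv, one_mul]
      have h2 : ∀ X : Matrix (Fin n) (Fin n) ℝ,
          ((jac Ψ y)⁻¹ * X).transpose * (jac Ψ y).transpose = X.transpose := fun X ↦ by
        rw [← Matrix.transpose_mul, h1]
      have h3 : ∀ X : Matrix (Fin n) (Fin n) ℝ,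
          X.transpose * ((jac Ψ y).transpose * A (Ψ y) * jac Ψ y)
            + (jac Ψ y).transpose * A (Ψ y) * jac Ψ y * X
          = (jac Ψ y * X).transpose * A (Ψ y) * jac Ψ y
            + (jac Ψ y).transpose * A (Ψ y) * (jac Ψ y * X) := fun X ↦ by
        rw [Matrix.transpose_mul]; noncomm_ring
      rw [h3, h1]
      simp only [Matrix.transpose_add, Matrix.transpose_mul]
      noncomm_ring
  rw [key, ← Matrix.mul_assoc, h.mul_inv, one_mul]

/-- The transformation law of the curvature. -/
lemma IsPull.jac_mul_curv (h : IsPull A B Ψ y) (i l : Fin n) :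
    jac Ψ y * curv B i l y
      = (∑ b, ∑ c, (jac Ψ y b i * jac Ψ y c l) • curv A b c (Ψ y)) * jac Ψ y := by
  have hJ := h.smooth.jac
  have hd : ∀ i l, mpd i (jac Ψ) y * Gam B l y + jac Ψ y * mpd i (Gam B l) y
      = mpd i (pullGam A Ψ l) y * jac Ψ y + pullGam A Ψ l y * mpd i (jac Ψ) y
        + mpd i (mpd l (jac Ψ)) y := by
    intro i l
    rw [← mpd_mul i hJ (h.metricAt.smooth_Gam l),
      mpd_congr i (h.eventually.mono fun z hz ↦ hz.jac_mul_Gam l),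
      mpd_add i ((h.smooth_pullGam l).mul hJ) (hJ.mpd l), mpd_mul i (h.smooth_pullGam l) hJ]
  have hsym : mpd i (mpd l (jac Ψ)) y = mpd l (mpd i (jac Ψ)) y := by
    ext a b; exact pd_comm i l (hJ a b)
  have hG : ∀ i, mpd i (jac Ψ) y = jac Ψ y * Gam B i y - pullGam A Ψ i y * jac Ψ y := fun i ↦ by
    rw [h.jac_mul_Gam]; abel
  -- The transformation law of the connection is differentiated and antisymmetrized in `i` and `l`.
  -- The second derivative of the Jacobian, called `W`, is symmetric and drops out; its first
  -- derivative is eliminated through `hG`.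
  have hF : jac Ψ y * curv B i l y = (mpd i (pullGam A Ψ l) y - mpd l (pullGam A Ψ i) y
      + (pullGam A Ψ i y * pullGam A Ψ l y - pullGam A Ψ l y * pullGam A Ψ i y)) * jac Ψ y := by
    have h1 := hd i l
    have h2 := hd l i
    rw [hsym] at h1
    generalize mpd l (mpd i (jac Ψ)) y = W at h1 h2
    rw [hG] at h1 h2
    have e1 := eq_sub_of_add_eq' h1
    have e2 := eq_sub_of_add_eq' h2
    rw [curv, Matrix.mul_add, Matrix.mul_sub, e1, e2]
    noncomm_ring
  rw [hF]
  congr 1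
  -- The derivative of the pulled-back connection has a part with second derivatives of `Ψ`,
  -- symmetric in `i` and `l`, and a part with derivatives of the connection. Antisymmetrizing
  -- leaves the pulled-back curvature, up to the relabelings `c1` and `c2`.
  have hp : ∀ i l, mpd i (pullGam A Ψ l) y = ∑ b, (mpd i (jac Ψ) y b l • Gam A b (Ψ y)
      + jac Ψ y b l • ∑ c, jac Ψ y c i • mpd c (Gam A b) (Ψ y)) := by
    intro i l
    unfold pullGam
    rw [mpd_sum _ _ fun b _ ↦ MSm.smul (hJ b l) ((h.metric.smooth_Gam b).comp h.smooth)]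
    refine Finset.sum_congr rfl fun b _ ↦ ?_
    rw [mpd_smul i (hJ b l) ((h.metric.smooth_Gam b).comp h.smooth),
      mpd_comp i (h.metric.smooth_Gam b) h.smooth]
    rfl
  rw [hp, hp]
  simp only [mpd_jac_symm h.smooth l i, Finset.sum_add_distrib, pullGam, Finset.sum_mul,
    Finset.mul_sum, curv, smul_add, smul_sub, Finset.sum_sub_distrib, Finset.smul_sum,
    Matrix.smul_mul, Matrix.mul_smul, smul_smul]
  have c1 : ∑ b, ∑ c, (jac Ψ y b l * jac Ψ y c i) • mpd c (Gam A b) (Ψ y)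
      = ∑ b, ∑ c, (jac Ψ y b i * jac Ψ y c l) • mpd b (Gam A c) (Ψ y) := by
    rw [Finset.sum_comm]; simp only [mul_comm]
  have c2 : ∑ b, ∑ c, (jac Ψ y b l * jac Ψ y c i) • (Gam A c (Ψ y) * Gam A b (Ψ y))
      = ∑ b, ∑ c, (jac Ψ y b i * jac Ψ y c l) • (Gam A b (Ψ y) * Gam A c (Ψ y)) := by
    rw [Finset.sum_comm]; simp only [mul_comm]
  rw [c1, c2]
  abel

/-- The transformation law of the Ricci tensor. -/
lemma IsPull.ric_eq (h : IsPull A B Ψ y) :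
    ric B y = (jac Ψ y).transpose * ric A (Ψ y) * jac Ψ y := by
  have hc : ∀ k i, curv B k i y = ∑ b, ∑ c, (jac Ψ y b k * jac Ψ y c i) •
      ((jac Ψ y)⁻¹ * curv A b c (Ψ y) * jac Ψ y) := by
    intro k i
    have := h.jac_mul_curv k i
    calc curv B k i y = (jac Ψ y)⁻¹ * (jac Ψ y * curv B k i y) := by
          rw [← Matrix.mul_assoc, h.inv_mul, one_mul]
      _ = _ := by
        rw [this]
        simp only [Finset.sum_mul, Finset.mul_sum, Matrix.smul_mul, Matrix.mul_smul,
          Matrix.mul_assoc]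
  ext i j
  rw [h.metricAt.ric_apply]
  simp only [hc, Matrix.sum_apply, Matrix.smul_apply, smul_eq_mul]
  -- Contraction with the Jacobian over `k` absorbs the inverse Jacobian in the conjugated
  -- curvature.
  have e : ∀ b c, ∑ k, jac Ψ y b k * jac Ψ y c i *
      ((jac Ψ y)⁻¹ * curv A b c (Ψ y) * jac Ψ y) k j
      = jac Ψ y c i * (curv A b c (Ψ y) * jac Ψ y) b j := by
    intro b c
    have : jac Ψ y * ((jac Ψ y)⁻¹ * curv A b c (Ψ y) * jac Ψ y) = curv A b c (Ψ y) * jac Ψ y := by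
      rw [← Matrix.mul_assoc, ← Matrix.mul_assoc, h.mul_inv, one_mul]
    rw [← this, Matrix.mul_apply, Finset.mul_sum]
    exact Finset.sum_congr rfl fun _ _ ↦ by ring
  calc _ = ∑ b, ∑ c, jac Ψ y c i * (curv A b c (Ψ y) * jac Ψ y) b j := by
        rw [Finset.sum_comm]
        refine Finset.sum_congr rfl fun b _ ↦ ?_
        rw [Finset.sum_comm]
        exact Finset.sum_congr rfl fun c _ ↦ e b c
    _ = ∑ c, jac Ψ y c i * (ric A (Ψ y) * jac Ψ y) c j := by
        rw [Finset.sum_comm]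
        refine Finset.sum_congr rfl fun c _ ↦ ?_
        rw [← Finset.mul_sum]
        congr 1
        simp only [Matrix.mul_apply, h.metric.ric_apply, Finset.sum_mul]
        rw [Finset.sum_comm]
    _ = _ := by rw [Matrix.mul_assoc, Matrix.mul_apply]; rfl

lemma pd_comp_jac {m k : ℕ} {F : Rn m → ℝ} {Ψ : Rn k → Rn m} {y : Rn k} (i : Fin k)
    (hF : CInf F (Ψ y)) (hΨ : CInf Ψ y) :
    pd i (fun z ↦ F (Ψ z)) y = ∑ b, jac Ψ y b i * pd b F (Ψ y) :=
  pd_comp i hF.differentiableAt hΨ.differentiableAt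

/-- The transformation law of the covariant Hessian. -/
lemma IsPull.hes_eq (h : IsPull A B Ψ y) {f : Rn n → ℝ} (hf : CInf f (Ψ y)) :
    hes B (fun z ↦ f (Ψ z)) y = (jac Ψ y).transpose * hes A f (Ψ y) * jac Ψ y := by
  ext i j
  have hJ := h.smooth.jac
  have e1 : pd i (pd j fun z ↦ f (Ψ z)) y = ∑ a, (mpd i (jac Ψ) y a j * pd a f (Ψ y)
      + jac Ψ y a j * ∑ b, jac Ψ y b i * pd b (pd a f) (Ψ y)) := by
    have : pd j (fun z ↦ f (Ψ z)) =ᶠ[𝓝 y] fun z ↦ ∑ b, jac Ψ z b j * pd b f (Ψ z) := by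
      filter_upwards [h.smooth.eventually, h.smooth.continuousAt.eventually hf.eventually]
        with z h1 h2 using pd_comp_jac j h2 h1
    have hd : ∀ a, CInf (fun z ↦ pd a f (Ψ z)) y := fun a ↦ (hf.pd a).comp h.smooth
    rw [pd_congr this, pd_sum _ _ fun b _ ↦ ((hJ b j).mul (hd b)).differentiableAt]
    refine Finset.sum_congr rfl fun a _ ↦ ?_
    rw [pd_mul i (hJ.diff a j) (hd a).differentiableAt, pd_comp_jac i (hf.pd a) h.smooth]
    rfl
  have e2 : ∑ k, chr B k i j y * pd k (fun z ↦ f (Ψ z)) y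
      = ∑ a, (mpd i (jac Ψ) y a j * pd a f (Ψ y)
        + (pullGam A Ψ i y * jac Ψ y) a j * pd a f (Ψ y)) := by
    have hg : ∀ a, mpd i (jac Ψ) y a j * pd a f (Ψ y)
        + (pullGam A Ψ i y * jac Ψ y) a j * pd a f (Ψ y)
        = (jac Ψ y * Gam B i y) a j * pd a f (Ψ y) := fun a ↦ by
      rw [h.jac_mul_Gam, Matrix.add_apply]; ring
    rw [Finset.sum_congr rfl fun a _ ↦ hg a]
    simp only [pd_comp_jac _ hf h.smooth, Matrix.mul_apply, Finset.mul_sum, Finset.sum_mul,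
      Gam_apply]
    rw [Finset.sum_comm]
    exact Finset.sum_congr rfl fun _ _ ↦ Finset.sum_congr rfl fun _ _ ↦ by ring
  simp only [hes, Matrix.of_apply, e1, e2]
  rw [← Finset.sum_sub_distrib]
  -- The second derivatives of `Ψ`, present in both `e1` and `e2`, cancel here.
  simp only [add_sub_add_left_eq_sub]
  rw [Finset.sum_sub_distrib]
  simp only [Matrix.mul_apply, Matrix.transpose_apply, pullGam, Matrix.sum_apply,
    Matrix.smul_apply, Gam_apply, smul_eq_mul, Matrix.of_apply, mul_sub, sub_mul,
    Finset.sum_sub_distrib, Finset.mul_sum, Finset.sum_mul]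
  congr 1
  · refine Finset.sum_congr rfl fun a _ ↦ Finset.sum_congr rfl fun b _ ↦ ?_
    ring
  · rw [Finset.sum_comm]
    refine Finset.sum_congr rfl fun c _ ↦ ?_
    rw [Finset.sum_comm]
    refine Finset.sum_congr rfl fun b _ ↦ Finset.sum_congr rfl fun a _ ↦ ?_
    ring

lemma grd_comp {m k : ℕ} {Ψ : Rn k → Rn m} {y : Rn k} (hΨ : CInf Ψ y) {f g : Rn m → ℝ}
    (hf : CInf f (Ψ y)) (hg : CInf g (Ψ y)) :
    grd (fun z ↦ f (Ψ z)) (fun z ↦ g (Ψ z)) y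
      = (jac Ψ y).transpose * grd f g (Ψ y) * jac Ψ y := by
  ext i j
  simp only [grd, Matrix.of_apply, pd_comp_jac _ hf hΨ, pd_comp_jac _ hg hΨ, Matrix.mul_apply,
    Matrix.transpose_apply, Finset.sum_mul, Finset.mul_sum]
  refine Finset.sum_congr rfl fun a _ ↦ Finset.sum_congr rfl fun b _ ↦ ?_
  ring

/-- The trace of a covariant tensor is invariant. -/
lemma IsPull.mtr_eq (h : IsPull A B Ψ y) (S : Matrix (Fin n) (Fin n) ℝ) :
    mtr (B y) ((jac Ψ y).transpose * S * jac Ψ y) = mtr (A (Ψ y)) S := by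
  have ht : (jac Ψ y).transpose⁻¹ * (jac Ψ y).transpose = 1 :=
    Matrix.nonsing_inv_mul _ (by rw [Matrix.det_transpose]; exact isUnit_iff_ne_zero.2 h.det)
  rw [mtr_eq_trace, mtr_eq_trace, h.eq.self_of_nhds, Matrix.mul_inv_rev, Matrix.mul_inv_rev]
  simp only [Matrix.transpose_mul, Matrix.transpose_transpose]
  have e : (jac Ψ y)⁻¹ * ((A (Ψ y))⁻¹ * (jac Ψ y).transpose⁻¹) * ((jac Ψ y).transpose *
      (S.transpose * jac Ψ y)) = (jac Ψ y)⁻¹ * ((A (Ψ y))⁻¹ *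
        ((jac Ψ y).transpose⁻¹ * (jac Ψ y).transpose) * S.transpose) * jac Ψ y := by
    simp only [Matrix.mul_assoc]
  rw [e, ht, mul_one, Matrix.trace_mul_comm, ← Matrix.mul_assoc, h.mul_inv, one_mul]

end Pullback

/-! ### The inverse metric, gradients and the d'Alembertian as a divergence. -/

section Inverse

variable {n : ℕ} {A : Rn n → Matrix (Fin n) (Fin n) ℝ} {y : Rn n}

/-- The inverse metric is parallel. -/
lemma MetricAt.mpd_inv (h : MetricAt A y) (i : Fin n) :
    mpd i (fun z ↦ (A z)⁻¹) y = -(Gam A i y * (A y)⁻¹ + (A y)⁻¹ * (Gam A i y).transpose) := by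
  have h1 : mpd i (fun z ↦ (A z)⁻¹ * A z) y = 0 := by
    rw [mpd_congr (B := fun _ ↦ 1) i (h.eventually.mono fun z hz ↦ hz.inv_mul)]
    ext a b; exact pd_const i _
  rw [mpd_mul i (h.smooth.inv h.det) h.smooth, h.mpd_eq] at h1
  have h2 := eq_neg_of_add_eq_zero_left h1
  calc _ = (mpd i (fun z ↦ (A z)⁻¹) y * A y) * (A y)⁻¹ := by
        rw [Matrix.mul_assoc, h.mul_inv, mul_one]
    _ = -(((A y)⁻¹ * A y) * Gam A i y * (A y)⁻¹
          + (A y)⁻¹ * (Gam A i y).transpose * (A y * (A y)⁻¹)) := by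
        rw [h2]; noncomm_ring
    _ = _ := by rw [h.mul_inv, h.inv_mul, one_mul, mul_one]

lemma MetricAt.inv_symm (h : MetricAt A y) (i j : Fin n) : (A y)⁻¹ i j = (A y)⁻¹ j i := by
  have : (A y)⁻¹.transpose = (A y)⁻¹ := by
    rw [Matrix.transpose_nonsing_inv, h.symm.self_of_nhds]
  exact congrFun (congrFun this j) i

/-- The gradient vector `A^{km} ∂_m f`. -/
def gradVec (A : Rn n → Matrix (Fin n) (Fin n) ℝ) (f : Rn n → ℝ) (k : Fin n) (y : Rn n) : ℝ :=
  ∑ m, (A y)⁻¹ k m * pd m f y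

lemma MetricAt.cInf_gradVec (h : MetricAt A y) {f : Rn n → ℝ} (hf : CInf f y) (k : Fin n) :
    CInf (gradVec A f k) y :=
  CInf.sum fun m _ ↦ CInf.mul (h.smooth.inv h.det k m) (hf.pd m)

lemma MetricAt.sum_mul_gradVec (h : MetricAt A y) (f : Rn n → ℝ) (j : Fin n) :
    ∑ k, A y j k * gradVec A f k y = pd j f y := by
  change (A y).mulVec ((A y)⁻¹.mulVec fun m ↦ pd m f y) j = _
  rw [Matrix.mulVec_mulVec, h.mul_inv, Matrix.one_mulVec]

lemma mtr_grd (f g : Rn n → ℝ) : mtr (A y) (grd f g y) = ∑ k, pd k f y * gradVec A g k y := by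
  simp only [mtr, grd, gradVec, Matrix.of_apply, Finset.mul_sum]
  exact Finset.sum_congr rfl fun _ _ ↦ Finset.sum_congr rfl fun _ _ ↦ by ring

/-- The d'Alembertian is the divergence of the gradient. -/
lemma MetricAt.mtr_hes (h : MetricAt A y) {f : Rn n → ℝ} (hf : CInf f y) :
    mtr (A y) (hes A f y) = ∑ k, pd k (gradVec A f k) y
      + ∑ k, ∑ l, chr A k l k y * gradVec A f l y := by
  have e : ∀ k, pd k (gradVec A f k) y = ∑ m, (mpd k (fun z ↦ (A z)⁻¹) y k m * pd m f y
      + (A y)⁻¹ k m * pd k (pd m f) y) := fun k ↦ by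
    have hi := h.smooth.inv h.det
    unfold gradVec
    rw [pd_sum _ _ fun m _ ↦ (CInf.mul (hi k m) (hf.pd m)).differentiableAt]
    exact Finset.sum_congr rfl fun m _ ↦ pd_mul k (hi.diff k m) (hf.pd m).differentiableAt
  simp only [e, h.mpd_inv, mtr, hes, Matrix.of_apply, Matrix.neg_apply, Matrix.add_apply,
    Matrix.mul_apply, Matrix.transpose_apply, Gam_apply, gradVec, mul_sub, neg_add, add_mul,
    neg_mul, Finset.sum_add_distrib, Finset.sum_sub_distrib, Finset.sum_neg_distrib,
    Finset.mul_sum, Finset.sum_mul]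
  -- Differentiating the inverse metric gives two connection terms: one cancels the Christoffel part
  -- of the divergence (`h1`), the other is the connection term of the Hessian (`h2`).
  have h1 : ∑ k, ∑ l, ∑ m, chr A k k m y * (A y)⁻¹ m l * pd l f y
      = ∑ k, ∑ l, ∑ m, chr A k l k y * ((A y)⁻¹ l m * pd m f y) := by
    refine Finset.sum_congr rfl fun k _ ↦ ?_
    rw [Finset.sum_comm]
    refine Finset.sum_congr rfl fun l _ ↦ Finset.sum_congr rfl fun m _ ↦ ?_
    rw [h.chr_symm k l k]; ring
  have h2 : ∑ i, ∑ j, ∑ k, (A y)⁻¹ i j * (chr A k i j y * pd k f y)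
      = ∑ i, ∑ k, ∑ j, (A y)⁻¹ i j * chr A k i j y * pd k f y := by
    refine Finset.sum_congr rfl fun i _ ↦ ?_
    rw [Finset.sum_comm]
    exact Finset.sum_congr rfl fun k _ ↦ Finset.sum_congr rfl fun j _ ↦ by ring
  rw [h1, h2]
  ring

end Inverse

/-! ### Metrics `l dt² + h` with coefficients independent of `t`; `l` need only be nonzero. -/

section Static

variable {n : ℕ}

/-- Forgetting the first coordinate. -/
def tl : Rn (n + 1) →L[ℝ] Rn n :=
  LinearMap.toContinuousLinearMap
    { toFun := fun y ↦ WithLp.toLp 2 fun i ↦ y i.succ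
      map_add' := fun _ _ ↦ rfl
      map_smul' := fun _ _ ↦ rfl }

@[simp] lemma tl_apply (y : Rn (n + 1)) (i : Fin n) : tl y i = y i.succ := rfl

lemma tl_single_zero (c : ℝ) : tl (EuclideanSpace.single (0 : Fin (n + 1)) c) = 0 := by
  ext i; simp

lemma tl_single_succ (i : Fin n) (c : ℝ) :
    tl (EuclideanSpace.single i.succ c) = EuclideanSpace.single i c := by
  ext j; simp

lemma cInf_tl {y : Rn (n + 1)} : CInf (tl (n := n)) y := tl.contDiff.cInf

lemma fderiv_comp_tl {F : Rn n → ℝ} {y : Rn (n + 1)} (hF : CInf F (tl y)) :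
    fderiv ℝ (fun z ↦ F (tl z)) y = (fderiv ℝ F (tl y)).comp tl :=
  (hF.differentiableAt.hasFDerivAt.comp y tl.hasFDerivAt).fderiv

lemma pd_zero_comp_tl {F : Rn n → ℝ} {y : Rn (n + 1)} (hF : CInf F (tl y)) :
    pd 0 (fun z ↦ F (tl z)) y = 0 := by
  rw [pd, fderiv_comp_tl hF, ContinuousLinearMap.comp_apply, tl_single_zero, map_zero]

lemma pd_succ_comp_tl {F : Rn n → ℝ} {y : Rn (n + 1)} (i : Fin n) (hF : CInf F (tl y)) :
    pd i.succ (fun z ↦ F (tl z)) y = pd i F (tl y) := by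
  rw [pd, fderiv_comp_tl hF, ContinuousLinearMap.comp_apply, tl_single_succ, pd]

/-- A block matrix with first diagonal entry `a` and remaining blocks `v`, `w`, `B`. -/
def blk (a : ℝ) (v w : Fin n → ℝ) (B : Matrix (Fin n) (Fin n) ℝ) :
    Matrix (Fin (n + 1)) (Fin (n + 1)) ℝ :=
  Matrix.of fun i j ↦ Fin.cases (Fin.cases a v j) (fun i ↦ Fin.cases (w i) (B i) j) i

section blk
variable (a : ℝ) (v w : Fin n → ℝ) (B : Matrix (Fin n) (Fin n) ℝ) (i j : Fin n)
@[simp] lemma blk_zero_zero : blk a v w B 0 0 = a := rfl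
@[simp] lemma blk_zero_succ : blk a v w B 0 j.succ = v j := rfl
@[simp] lemma blk_succ_zero : blk a v w B i.succ 0 = w i := rfl
@[simp] lemma blk_succ_succ : blk a v w B i.succ j.succ = B i j := rfl
end blk

/-- The static metric `l dt² + h_{ij} dx^i dx^j`. -/
def stat (l : Rn n → ℝ) (h : Rn n → Matrix (Fin n) (Fin n) ℝ) (y : Rn (n + 1)) :
    Matrix (Fin (n + 1)) (Fin (n + 1)) ℝ :=
  blk (l (tl y)) 0 0 (h (tl y))

variable {l : Rn n → ℝ} {h : Rn n → Matrix (Fin n) (Fin n) ℝ} {y : Rn (n + 1)}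

lemma stat_mul_inv (hh : MetricAt h (tl y)) (h0 : l (tl y) ≠ 0) :
    stat l h y * blk (l (tl y))⁻¹ 0 0 (h (tl y))⁻¹ = 1 := by
  ext i j
  have := fun i j ↦ congrFun (congrFun hh.mul_inv i) j
  simp only [Matrix.mul_apply] at this
  refine Fin.cases ?_ (fun i ↦ ?_) i <;> refine Fin.cases ?_ (fun j ↦ ?_) j <;>
    simp [Matrix.mul_apply, Fin.sum_univ_succ, stat, h0, this, Matrix.one_apply,
      (Fin.succ_ne_zero _).symm]

lemma stat_inv (hh : MetricAt h (tl y)) (h0 : l (tl y) ≠ 0) :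
    (stat l h y)⁻¹ = blk (l (tl y))⁻¹ 0 0 (h (tl y))⁻¹ :=
  Matrix.inv_eq_right_inv (stat_mul_inv hh h0)

lemma metricAt_stat (hh : MetricAt h (tl y)) (hl : CInf l (tl y)) (h0 : l (tl y) ≠ 0) :
    MetricAt (stat l h) y where
  smooth i j := by
    refine Fin.cases ?_ (fun i ↦ ?_) i <;> refine Fin.cases ?_ (fun j ↦ ?_) j
    · exact hl.comp cInf_tl
    · exact CInf.const _
    · exact CInf.const _
    · exact CInf.comp (hh.smooth i j) cInf_tl
  symm := by
    filter_upwards [cInf_tl.continuousAt.eventually hh.symm] with z hz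
    ext i j
    refine Fin.cases ?_ (fun i ↦ ?_) i <;> refine Fin.cases ?_ (fun j ↦ ?_) j <;>
      simp [stat, hz.apply]
  det := by
    have := congrArg Matrix.det (stat_mul_inv hh h0)
    rw [Matrix.det_mul, Matrix.det_one] at this
    exact left_ne_zero_of_mul_eq_one this

/-- The Christoffel symbols of a static metric. -/
def statGam (l : Rn n → ℝ) (h : Rn n → Matrix (Fin n) (Fin n) ℝ) (y : Rn (n + 1))
    (i : Fin (n + 1)) : Matrix (Fin (n + 1)) (Fin (n + 1)) ℝ :=
  Fin.cases
    (blk 0 (fun j ↦ 2⁻¹ * ((l (tl y))⁻¹ * pd j l (tl y)))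
      (fun k ↦ (-1 / 2) * gradVec h l k (tl y)) 0)
    (fun i ↦ blk (2⁻¹ * ((l (tl y))⁻¹ * pd i l (tl y))) 0 0 (Gam h i (tl y))) i

lemma Gam_stat (hh : MetricAt h (tl y)) (hl : CInf l (tl y)) (h0 : l (tl y) ≠ 0)
    (i : Fin (n + 1)) : Gam (stat l h) i y = statGam l h y i := by
  refine (metricAt_stat hh hl h0).Gam_unique (C := statGam l h y) ?_ ?_ i
  · intro i j k
    refine Fin.cases ?_ (fun i ↦ ?_) i <;> refine Fin.cases ?_ (fun j ↦ ?_) j <;>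
      refine Fin.cases ?_ (fun k ↦ ?_) k <;> simp [statGam]
    exact hh.chr_symm _ _ _
  -- Metricity of the candidate, block by block. The blocks with one index `0` use that lowering the
  -- index of the gradient returns `dl`; the purely spatial block is metricity of the connection of
  -- `h`.
  · intro i
    have hg := hh.sum_mul_gradVec l
    have hg' : ∀ j, ∑ k, gradVec h l k (tl y) * h (tl y) k j = pd j l (tl y) := fun j ↦ by
      rw [← hg j]
      exact Finset.sum_congr rfl fun k _ ↦ by rw [hh.symm.self_of_nhds.apply j k, mul_comm]
    have hm : ∀ i a b, pd i (fun z ↦ h z a b) (tl y)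
        = ∑ k, chr h k i a (tl y) * h (tl y) k b + ∑ k, h (tl y) a k * chr h k i b (tl y) :=
      fun i a b ↦ by
        simpa [Matrix.mul_apply] using congrFun (congrFun (hh.mpd_eq i) a) b
    ext a b
    refine Fin.cases ?_ (fun i ↦ ?_) i <;> refine Fin.cases ?_ (fun a ↦ ?_) a <;>
      refine Fin.cases ?_ (fun b ↦ ?_) b <;>
      simp [statGam, stat, Matrix.mul_apply, Fin.sum_univ_succ, pd_zero_comp_tl hl,
        pd_succ_comp_tl _ hl, pd_zero_comp_tl (hh.smooth _ _), pd_succ_comp_tl _ (hh.smooth _ _)]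
    · have e : ∀ k, -1 / 2 * gradVec h l k (tl y) * h (tl y) k b
          = -1 / 2 * (gradVec h l k (tl y) * h (tl y) k b) := fun k ↦ by ring
      simp only [e]
      rw [← Finset.mul_sum, hg' b]
      field_simp; ring
    · have e : ∀ k, h (tl y) a k * (-1 / 2 * gradVec h l k (tl y))
          = -1 / 2 * (h (tl y) a k * gradVec h l k (tl y)) := fun k ↦ by ring
      simp only [e]
      rw [← Finset.mul_sum, hg a]
      field_simp; ring
    · field_simp; ring
    · exact hm _ _ _

lemma chr_stat (hh : MetricAt h (tl y)) (hl : CInf l (tl y)) (h0 : l (tl y) ≠ 0)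
    (k i j : Fin (n + 1)) : chr (stat l h) k i j =ᶠ[𝓝 y] fun z ↦ statGam l h z i k j := by
  filter_upwards [cInf_tl.continuousAt.eventually hh.eventually,
    cInf_tl.continuousAt.eventually hl.eventually,
    cInf_tl.continuousAt.eventually (hl.continuousAt.eventually_ne h0)] with z h1 h2 h3
  rw [← Gam_stat h1 h2 h3]; rfl

lemma hes_apply {A : Rn n → Matrix (Fin n) (Fin n) ℝ} {f : Rn n → ℝ} {y : Rn n} (i j : Fin n) :
    hes A f y i j = pd i (pd j f) y - ∑ k, chr A k i j y * pd k f y := rfl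

lemma grd_apply {f g : Rn n → ℝ} {y : Rn n} (i j : Fin n) :
    grd f g y i j = pd i f y * pd j g y := rfl

lemma pd_inv_mul {f g : Rn n → ℝ} {y : Rn n} (i : Fin n) (hf : CInf f y) (hg : CInf g y)
    (h0 : f y ≠ 0) : pd i (fun z ↦ (f z)⁻¹ * g z) y
      = -((f y)⁻¹ ^ 2 * pd i f y * g y) + (f y)⁻¹ * pd i g y := by
  rw [pd_mul i (hf.inv h0).differentiableAt hg.differentiableAt,
    pd_comp_real i (hasDerivAt_inv h0) hf.differentiableAt]
  field_simp

/-- The Ricci tensor of a static metric. -/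
lemma ric_stat (hh : MetricAt h (tl y)) (hl : CInf l (tl y)) (h0 : l (tl y) ≠ 0) :
    ric (stat l h) y = blk
      (-(1 / 2) * mtr (h (tl y)) (hes h l (tl y))
        + (1 / 4) * (l (tl y))⁻¹ * mtr (h (tl y)) (grd l l (tl y))) 0 0
      (ric h (tl y) - ((1 / 2) * (l (tl y))⁻¹) • hes h l (tl y)
        + ((1 / 4) * (l (tl y))⁻¹ ^ 2) • grd l l (tl y)) := by
  have hc := fun k i j ↦ (chr_stat hh hl h0 k i j).self_of_nhds
  -- The symbols are going to be differentiated, so their formula is needed on a neighborhood and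
  -- not only at `y`.
  have hp := fun m k i j ↦ pd_congr (i := m) (chr_stat hh hl h0 k i j)
  have hw : ∀ j, CInf (fun z ↦ (l z)⁻¹ * pd j l z) (tl y) := fun j ↦ (hl.inv h0).mul (hl.pd j)
  have w0 : ∀ j : Fin n, pd 0 (fun z ↦ 2⁻¹ * ((l (tl z))⁻¹ * pd j l (tl z))) y = 0 := fun j ↦
    pd_zero_comp_tl ((CInf.const 2⁻¹).mul (hw j))
  have w1 : ∀ i j : Fin n, pd i.succ (fun z ↦ 2⁻¹ * ((l (tl z))⁻¹ * pd j l (tl z))) y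
      = 2⁻¹ * (-((l (tl y))⁻¹ ^ 2 * pd i l (tl y) * pd j l (tl y))
        + (l (tl y))⁻¹ * pd i (pd j l) (tl y)) := fun i j ↦ by
    rw [pd_succ_comp_tl i ((CInf.const 2⁻¹).mul (hw j)),
      pd_const_mul i _ (hw j).differentiableAt, pd_inv_mul i hl (hl.pd j) h0]
  have w2 : ∀ k : Fin n, pd k.succ (fun z ↦ -1 / 2 * gradVec h l k (tl z)) y
      = -1 / 2 * pd k (gradVec h l k) (tl y) := fun k ↦ by
    rw [pd_succ_comp_tl k ((CInf.const (-1 / 2)).mul (hh.cInf_gradVec hl k)),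
      pd_const_mul k _ (hh.cInf_gradVec hl k).differentiableAt]
  have w2' : ∀ k : Fin n, pd 0 (fun z ↦ -1 / 2 * gradVec h l k (tl z)) y = 0 := fun k ↦
    pd_zero_comp_tl ((CInf.const (-1 / 2)).mul (hh.cInf_gradVec hl k))
  have w3 : ∀ m k i j : Fin n, pd m.succ (fun z ↦ chr h k i j (tl z)) y
      = pd m (chr h k i j) (tl y) := fun m k i j ↦ pd_succ_comp_tl m (hh.cInf_chr k i j)
  have w3' : ∀ k i j : Fin n, pd 0 (fun z ↦ chr h k i j (tl z)) y = 0 :=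
    fun k i j ↦ pd_zero_comp_tl (hh.cInf_chr k i j)
  ext i j
  simp only [ric, Matrix.of_apply]
  rw [Finset.sum_congr rfl fun k _ ↦ by rw [hp k k i j, hp i k k j],
    Finset.sum_congr rfl fun k _ ↦ Finset.sum_congr rfl fun m _ ↦ by
      rw [hc m i j, hc k m k, hc m k j, hc k m i]]
  refine Fin.cases ?_ (fun i ↦ ?_) i <;> refine Fin.cases ?_ (fun j ↦ ?_) j
  -- The `00` component is `-½` times the divergence of the gradient of `l` plus quadratic terms;
  -- `mtr_hes` recognizes the d'Alembertian.
  · rw [blk_zero_zero, hh.mtr_hes hl, mtr_grd]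
    simp [Fin.sum_univ_succ, statGam, w2]
    have s1 : ∑ i, ∑ m, -1 / 2 * gradVec h l m (tl y) * chr h i m i (tl y)
        = -1 / 2 * ∑ k, ∑ m, chr h k m k (tl y) * gradVec h l m (tl y) := by
      simp only [Finset.mul_sum]
      exact Finset.sum_congr rfl fun _ _ ↦ Finset.sum_congr rfl fun _ _ ↦ by ring
    have s2 : ∑ i, 2⁻¹ * ((l (tl y))⁻¹ * pd i l (tl y)) * (-1 / 2 * gradVec h l i (tl y))
        = -4⁻¹ * (l (tl y))⁻¹ * ∑ k, pd k l (tl y) * gradVec h l k (tl y) := by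
      rw [Finset.mul_sum]
      exact Finset.sum_congr rfl fun _ _ ↦ by ring
    rw [s1, s2, ← Finset.mul_sum]
    ring
  · simp [Fin.sum_univ_succ, statGam, w3']
  · simp [Fin.sum_univ_succ, statGam, w0]
  · simp [Fin.sum_univ_succ, statGam, w1, w3, hes_apply, grd_apply]
    have s1 : ∑ k, chr h k i j (tl y) * (2⁻¹ * ((l (tl y))⁻¹ * pd k l (tl y)))
        = 2⁻¹ * (l (tl y))⁻¹ * ∑ k, chr h k i j (tl y) * pd k l (tl y) := by
      rw [Finset.mul_sum]
      exact Finset.sum_congr rfl fun _ _ ↦ by ring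
    rw [s1]
    ring

/-- The d'Alembertian of a static metric. -/
lemma box_stat (hh : MetricAt h (tl y)) (hl : CInf l (tl y)) (h0 : l (tl y) ≠ 0)
    {f : Rn n → ℝ} (hf : CInf f (tl y)) :
    mtr (stat l h y) (hes (stat l h) (fun z ↦ f (tl z)) y)
      = mtr (h (tl y)) (hes h f (tl y))
        + (1 / 2) * (l (tl y))⁻¹ * mtr (h (tl y)) (grd f l (tl y)) := by
  have hc := fun k i j ↦ (chr_stat hh hl h0 k i j).self_of_nhds
  have p0 : pd 0 (pd 0 fun z ↦ f (tl z)) y = 0 := by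
    rw [pd_congr (H := fun _ ↦ 0), pd_const]
    filter_upwards [cInf_tl.continuousAt.eventually hf.eventually] with z hz
      using pd_zero_comp_tl hz
  have p1 : ∀ i j : Fin n, pd i.succ (pd j.succ fun z ↦ f (tl z)) y = pd i (pd j f) (tl y) :=
      fun i j ↦ by
    rw [← pd_succ_comp_tl i (hf.pd j)]
    refine pd_congr ?_
    filter_upwards [cInf_tl.continuousAt.eventually hf.eventually] with z hz
      using pd_succ_comp_tl j hz
  rw [mtr_grd]
  simp only [mtr, stat_inv hh h0, hes_apply]
  simp [Fin.sum_univ_succ, hc, p0, p1, statGam, pd_zero_comp_tl hf, pd_succ_comp_tl _ hf]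
  -- The only new contribution is `-g^{00} Γ^k_{00} ∂_k f`, with `g^{00} = l⁻¹` and `Γ^k_{00}` equal
  -- to `-½` times the gradient of `l`.
  have s1 : ∑ k, -1 / 2 * gradVec h l k (tl y) * pd k f (tl y)
      = -1 / 2 * ∑ k, pd k f (tl y) * gradVec h l k (tl y) := by
    rw [Finset.mul_sum]
    exact Finset.sum_congr rfl fun _ _ ↦ by ring
  rw [s1]
  ring

end Static

/-! ### Coordinates in which the Christoffel symbols vanish at a point. -/

section NormalCoordinates

variable {n : ℕ} {A : Rn n → Matrix (Fin n) (Fin n) ℝ} {y : Rn n}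

/-- The quadratic change of coordinates to normal coordinates at `y`. -/
def normalMap (A : Rn n → Matrix (Fin n) (Fin n) ℝ) (y z : Rn n) : Rn n :=
  WithLp.toLp 2 fun a ↦
    z a - (1 / 2) * ∑ i, ∑ j, chr A a i j y * ((z i - y i) * (z j - y j))

lemma normalMap_self : normalMap A y y = y := by
  ext a; simp [normalMap]

lemma contDiff_normalMap : ContDiff ℝ ∞ (normalMap A y) := by
  rw [contDiff_euclidean]
  intro a
  unfold normalMap
  fun_prop

lemma pd_coord {z : Rn n} (i a : Fin n) : pd i (fun w : Rn n ↦ w a) z = if a = i then 1 else 0 := by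
  have : fderiv ℝ (fun w : Rn n ↦ w a) z = EuclideanSpace.proj a :=
    (EuclideanSpace.proj (𝕜 := ℝ) a : Rn n →L[ℝ] ℝ).fderiv
  simp [pd, this]

lemma jac_normalMap (hsymm : ∀ a i j, chr A a i j y = chr A a j i y) (z : Rn n) (a i : Fin n) :
    jac (normalMap A y) z a i = (if a = i then 1 else 0) - ∑ j, chr A a i j y * (z j - y j) := by
  have hc : ∀ i, CInf (fun w : Rn n ↦ w i - y i) z := fun i ↦
    ContDiff.cInf (by fun_prop)
  have hd : ∀ m i, pd m (fun w : Rn n ↦ w i - y i) z = if i = m then 1 else 0 := fun m i ↦ by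
    rw [pd_sub m (by fun_prop) (by fun_prop), pd_coord, pd_const, sub_zero]
  have hq : ∀ j k, CInf (fun w : Rn n ↦ chr A a j k y * ((w j - y j) * (w k - y k))) z :=
    fun j k ↦ (CInf.const _).mul ((hc j).mul (hc k))
  change pd i (fun w : Rn n ↦ w a - (1 / 2) * ∑ i, ∑ j, chr A a i j y *
    ((w i - y i) * (w j - y j))) z = _
  rw [pd_sub i (by fun_prop) (by fun_prop), pd_coord, pd_const_mul i _ (by fun_prop),
    pd_sum _ _ fun j _ ↦ (CInf.sum fun k _ ↦ hq j k).differentiableAt]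
  congr 1
  have e : ∀ j, pd i (fun w : Rn n ↦ ∑ k, chr A a j k y * ((w j - y j) * (w k - y k))) z
      = ∑ k, chr A a j k y * ((if j = i then 1 else 0) * (z k - y k)
        + (z j - y j) * (if k = i then 1 else 0)) := fun j ↦ by
    rw [pd_sum _ _ fun k _ ↦ (hq j k).differentiableAt]
    refine Finset.sum_congr rfl fun k _ ↦ ?_
    rw [pd_const_mul i _ ((hc j).mul (hc k)).differentiableAt,
      pd_mul i (hc j).differentiableAt (hc k).differentiableAt, hd, hd]
  simp only [e, mul_add, Finset.sum_add_distrib, ite_mul, mul_ite, one_mul, mul_one, zero_mul,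
    mul_zero, Finset.sum_ite_eq', Finset.sum_ite_irrel, Finset.sum_const_zero, Finset.mem_univ,
    if_true]
  simp only [hsymm a _ i]
  ring

/-- At any point there are coordinates in which the Christoffel symbols vanish. -/
lemma MetricAt.exists_normal (h : MetricAt A y) : ∃ (Ψ : Rn n → Rn n)
    (B : Rn n → Matrix (Fin n) (Fin n) ℝ), Ψ y = y ∧ jac Ψ y = 1 ∧ IsPull A B Ψ y ∧
      ∀ i, Gam B i y = 0 := by
  have hs := fun a i j ↦ h.chr_symm a i j
  have hj : jac (normalMap A y) y = 1 := by
    ext a i; simp [-jac_apply, jac_normalMap hs, Matrix.one_apply]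
  have hp : IsPull A (fun z ↦ (jac (normalMap A y) z).transpose * A (normalMap A y z)
      * jac (normalMap A y) z) (normalMap A y) y :=
    ⟨contDiff_normalMap.cInf, by simp [hj], by rwa [normalMap_self],
      Filter.Eventually.of_forall fun _ ↦ rfl⟩
  refine ⟨normalMap A y, _, normalMap_self, hj, hp, fun i ↦ ?_⟩
  have := hp.jac_mul_Gam i
  rw [hj, one_mul, mul_one] at this
  rw [this]
  ext a j
  -- With Jacobian `1` at the center, the new symbols are the old ones plus the derivative of the
  -- Jacobian; the coefficient of the quadratic term of `normalMap` makes the two cancel.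
  have e : mpd i (jac (normalMap A y)) y a j = -chr A a j i y := by
    rw [mpd_apply, pd_congr (Filter.Eventually.of_forall fun z ↦ jac_normalMap hs z a j)]
    rw [pd_sub i (by fun_prop) (by fun_prop), pd_const,
      pd_sum _ _ fun k _ ↦ by fun_prop]
    have : ∀ k, pd i (fun z : Rn n ↦ chr A a j k y * (z k - y k)) y
        = if k = i then chr A a j k y else 0 := fun k ↦ by
      rw [pd_const_mul i _ (by fun_prop), pd_sub i (by fun_prop) (by fun_prop), pd_coord, pd_const]
      simp
    simp [this]
  rw [Matrix.add_apply, e]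
  simp [-jac_apply, pullGam, hj, normalMap_self, Matrix.one_apply, hs a j i]

end NormalCoordinates

/-! ### Curvature, Hessian and d'Alembertian under conformal rescaling. -/

section Conformal

variable {n : ℕ} {A : Rn n → Matrix (Fin n) (Fin n) ℝ} {l : Rn n → ℝ} {y : Rn n}

lemma MetricAt.smul (h : MetricAt A y) (hl : CInf l y) (h0 : l y ≠ 0) :
    MetricAt (fun z ↦ l z • A z) y where
  smooth := MSm.smul hl h.smooth
  symm := by
    filter_upwards [h.symm] with z hz
    exact hz.smul _
  det := by
    rw [Matrix.det_smul]
    exact mul_ne_zero (pow_ne_zero _ h0) h.det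

/-- Half the logarithmic derivative. -/
def hld (l : Rn n → ℝ) (i : Fin n) (y : Rn n) : ℝ := 2⁻¹ * ((l y)⁻¹ * pd i l y)

/-- The change of the Christoffel symbols under a conformal rescaling by `l`. -/
def confGam (A : Rn n → Matrix (Fin n) (Fin n) ℝ) (l : Rn n → ℝ) (k i j : Fin n) (y : Rn n) : ℝ :=
  (if k = i then hld l j y else 0) + (if k = j then hld l i y else 0)
    - A y i j * (2⁻¹ * ((l y)⁻¹ * gradVec A l k y))

lemma MetricAt.chr_smul (h : MetricAt A y) (hl : CInf l y) (h0 : l y ≠ 0) (k i j : Fin n) :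
    chr (fun z ↦ l z • A z) k i j y = chr A k i j y + confGam A l k i j y := by
  have := (h.smul hl h0).Gam_unique
    (C := fun i ↦ Matrix.of fun k j ↦ chr A k i j y + confGam A l k i j y) ?_ ?_ i
  · exact congrFun (congrFun this k) j
  · intro i j k
    simp only [Matrix.of_apply, confGam, h.chr_symm k i j, h.symm.self_of_nhds.apply i j]
    ring
  · intro i
    rw [mpd_smul i hl h.smooth, h.mpd_eq]
    have hg : ∀ j, ∑ k, A y j k * (2⁻¹ * ((l y)⁻¹ * gradVec A l k y)) = hld l j y := fun j ↦ by
      rw [hld, ← h.sum_mul_gradVec l j, Finset.mul_sum, Finset.mul_sum]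
      exact Finset.sum_congr rfl fun _ _ ↦ by ring
    have hA : ∀ a j, (A y * Matrix.of fun k j ↦ confGam A l k i j y) a j
        = A y a i * hld l j y + A y a j * hld l i y - A y i j * hld l a y := fun a j ↦ by
      simp only [Matrix.mul_apply, Matrix.of_apply, confGam, mul_sub, mul_add,
        Finset.sum_add_distrib, Finset.sum_sub_distrib, mul_ite, mul_zero, Finset.sum_ite_eq',
        Finset.mem_univ, if_true, ← hg a, Finset.mul_sum]
      congr 1
      exact Finset.sum_congr rfl fun _ _ ↦ by ring
    have hT : ((Matrix.of fun k j ↦ confGam A l k i j y).transpose * A y)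
        = (A y * Matrix.of fun k j ↦ confGam A l k i j y).transpose := by
      rw [Matrix.transpose_mul, h.symm.self_of_nhds]
    have hsum : (Matrix.of fun k j ↦ chr A k i j y + confGam A l k i j y)
        = Gam A i y + Matrix.of fun k j ↦ confGam A l k i j y := rfl
    -- The correction contributes `d log l` times `A`, which accounts exactly for the derivative of
    -- the conformal factor in `l • A`.
    have hW : (Matrix.of fun k j ↦ confGam A l k i j y).transpose * A y
        + A y * (Matrix.of fun k j ↦ confGam A l k i j y) = ((l y)⁻¹ * pd i l y) • A y := by
      rw [hT]
      ext a j
      simp only [Matrix.add_apply, Matrix.transpose_apply, hA, Matrix.smul_apply, smul_eq_mul,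
        h.symm.self_of_nhds.apply j a, h.symm.self_of_nhds.apply j i,
        h.symm.self_of_nhds.apply a i, hld]
      ring
    rw [hsum, Matrix.transpose_add, add_mul, mul_add]
    simp only [Matrix.mul_smul, Matrix.smul_mul]
    rw [add_add_add_comm, ← smul_add _ ((Matrix.of _).transpose * A y), hW, ← smul_add, smul_smul,
      mul_inv_cancel_left₀ h0, add_comm]

/-- This is the logarithmic derivative of `l ^ (n / 2)`, the factor by which the volume density
changes. The trace of the first Kronecker symbol gives `n`; the second one cancels against the
metric term. -/
lemma MetricAt.sum_confGam (h : MetricAt A y) (j : Fin n) :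
    ∑ k, confGam A l k k j y = n * hld l j y := by
  have hg : ∑ k, A y k j * (2⁻¹ * ((l y)⁻¹ * gradVec A l k y)) = hld l j y := by
    rw [hld, ← h.sum_mul_gradVec l j, Finset.mul_sum, Finset.mul_sum]
    exact Finset.sum_congr rfl fun k _ ↦ by rw [h.symm.self_of_nhds.apply j k]; ring
  simp [confGam, Finset.sum_sub_distrib, Finset.sum_add_distrib, hg]

lemma cInf_hld (hl : CInf l y) (h0 : l y ≠ 0) (j : Fin n) : CInf (hld l j) y :=
  (CInf.const _).mul ((hl.inv h0).mul (hl.pd j))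

/-- The part of the Ricci tensor of a conformally rescaled metric that is quadratic in the
logarithmic derivative of the conformal factor. -/
lemma MetricAt.sum_confGam_mul (h : MetricAt A y) (i j : Fin n) :
    ∑ k, ∑ m, (confGam A l m i j y * confGam A l k m k y
      - confGam A l m k j y * confGam A l k m i y)
    = (n - 2) * (hld l i y * hld l j y)
      - (n - 2) * A y i j * ∑ k, hld l k y * (2⁻¹ * ((l y)⁻¹ * gradVec A l k y)) := by
  have hA := h.symm.self_of_nhds
  have hg : ∀ j, ∑ k, A y k j * (2⁻¹ * ((l y)⁻¹ * gradVec A l k y)) = hld l j y := fun j ↦ by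
    rw [hld, ← h.sum_mul_gradVec l j, Finset.mul_sum, Finset.mul_sum]
    exact Finset.sum_congr rfl fun k _ ↦ by rw [hA.apply j k]; ring
  have hsym : ∀ k m, confGam A l k m k y = confGam A l k k m y := fun k m ↦ by
    simp only [confGam, hA.apply k m]; ring
  have h1 : ∑ k, ∑ m, confGam A l m i j y * confGam A l k m k y
      = 2 * n * (hld l i y * hld l j y) - n * A y i j *
        ∑ k, hld l k y * (2⁻¹ * ((l y)⁻¹ * gradVec A l k y)) := by
    rw [Finset.sum_comm]
    have e : ∀ m, ∑ k, confGam A l m i j y * confGam A l k m k y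
        = confGam A l m i j y * (n * hld l m y) := fun m ↦ by
      rw [← Finset.mul_sum, Finset.sum_congr rfl fun k _ ↦ hsym k m, h.sum_confGam]
    rw [Finset.sum_congr rfl fun m _ ↦ e m]
    simp only [confGam, sub_mul, add_mul, Finset.sum_add_distrib, Finset.sum_sub_distrib,
      ite_mul, zero_mul, Finset.sum_ite_eq', Finset.mem_univ, if_true]
    have s1 : ∑ k, A y i j * (2⁻¹ * ((l y)⁻¹ * gradVec A l k y)) * (n * hld l k y)
        = n * A y i j * ∑ k, hld l k y * (2⁻¹ * ((l y)⁻¹ * gradVec A l k y)) := by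
      rw [Finset.mul_sum]
      exact Finset.sum_congr rfl fun _ _ ↦ by ring
    rw [s1]
    ring
  have h2 : ∑ k, ∑ m, confGam A l m k j y * confGam A l k m i y
      = (n + 2) * (hld l i y * hld l j y) - 2 * A y i j *
        ∑ k, hld l k y * (2⁻¹ * ((l y)⁻¹ * gradVec A l k y)) := by
    unfold confGam
    generalize hu : (fun k ↦ 2⁻¹ * ((l y)⁻¹ * gradVec A l k y)) = u at *
    have hu' : ∀ k, 2⁻¹ * ((l y)⁻¹ * gradVec A l k y) = u k := fun k ↦ congrFun hu k
    simp only [hu'] at *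
    simp only [sub_mul, mul_sub, add_mul, mul_add, Finset.sum_add_distrib, Finset.sum_sub_distrib,
      ite_mul, mul_ite, zero_mul, mul_zero, Finset.sum_ite_eq, Finset.sum_ite_eq',
      Finset.mem_univ, if_true, Finset.sum_ite_irrel, Finset.sum_const_zero, Finset.sum_const,
      Finset.card_univ, Fintype.card_fin, nsmul_eq_mul]
    have s1 : ∀ j, ∑ x, hld l j y * (A y x i * u x) = hld l j y * hld l i y := fun j ↦ by
      rw [← Finset.mul_sum, hg]
    have s2 : ∀ a b, ∑ x, A y a b * u x * hld l x y = A y a b * ∑ x, hld l x y * u x :=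
      fun a b ↦ by
        rw [Finset.mul_sum]
        exact Finset.sum_congr rfl fun _ _ ↦ by ring
    have s3 : ∑ x, hld l x y * (A y j i * u x) = A y i j * ∑ x, hld l x y * u x := by
      rw [Finset.mul_sum, hA.apply i j]
      exact Finset.sum_congr rfl fun _ _ ↦ by ring
    have s4 : ∑ x, ∑ z, A y x j * u z * (A y z i * u x) = hld l j y * hld l i y := by
      rw [← hg j, ← hg i, Finset.sum_mul_sum]
      exact Finset.sum_congr rfl fun _ _ ↦ Finset.sum_congr rfl fun _ _ ↦ by ring
    rw [← Finset.sum_mul, hg, s1, s2, s3, s4]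
    ring
  simp only [Finset.sum_sub_distrib, h1, h2]
  ring

/-- The Ricci tensor of a conformally rescaled metric, at the center of normal coordinates. -/
lemma MetricAt.ric_smul_normal (h : MetricAt A y) (hl : CInf l y) (h0 : l y ≠ 0)
    (hG : ∀ i, Gam A i y = 0) :
    ric (fun z ↦ l z • A z) y = ric A y
      - ((n - 2) * (1 / 2) * (l y)⁻¹ : ℝ) • hes A l y
      + ((n - 2) * (3 / 4) * (l y)⁻¹ ^ 2 : ℝ) • grd l l y
      - ((1 / 2) * (l y)⁻¹ * mtr (A y) (hes A l y)
        + ((n - 4) / 4) * (l y)⁻¹ ^ 2 * mtr (A y) (grd l l y) : ℝ) • A y := by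
  -- The symbols of `A` vanish at `y` alone. Products of them with `confGam` disappear, while their
  -- derivatives survive and make up `ric A y`.
  have hc0 : ∀ k i j, chr A k i j y = 0 := fun k i j ↦ congrFun (congrFun (hG i) k) j
  have hc : ∀ k i j, chr (fun z ↦ l z • A z) k i j y = confGam A l k i j y := fun k i j ↦ by
    rw [h.chr_smul hl h0, hc0, zero_add]
  have hu : ∀ k, CInf (fun z ↦ 2⁻¹ * ((l z)⁻¹ * gradVec A l k z)) y := fun k ↦
    (CInf.const _).mul ((hl.inv h0).mul (h.cInf_gradVec hl k))
  have hconf : ∀ k i j, CInf (confGam A l k i j) y := fun k i j ↦ by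
    have hw := cInf_hld hl h0
    unfold confGam
    refine (CInf.add ?_ ?_).sub (CInf.mul (h.smooth i j) (hu k))
    · split_ifs
      exacts [hw _, CInf.const _]
    · split_ifs
      exacts [hw _, CInf.const _]
  have hp : ∀ m k i j, pd m (chr (fun z ↦ l z • A z) k i j) y
      = pd m (chr A k i j) y + pd m (confGam A l k i j) y := fun m k i j ↦ by
    rw [← pd_add m (h.cInf_chr k i j).differentiableAt (hconf k i j).differentiableAt]
    refine pd_congr ?_
    filter_upwards [h.eventually, hl.eventually, hl.continuousAt.eventually_ne h0]
      with z h1 h2 h3 using h1.chr_smul h2 h3 k i j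
  -- By metricity the first derivatives of the metric vanish at the center too, so in `hd1` the
  -- derivative only reaches the gradient factor of the last term of `confGam`.
  have hA0 : ∀ m i j, pd m (fun z ↦ A z i j) y = 0 := fun m i j ↦ by
    have := congrFun (congrFun (h.mpd_eq m) i) j
    simpa [hG] using this
  have hv : ∀ i j, pd i (hld l j) y = 2⁻¹ * (-((l y)⁻¹ ^ 2 * pd i l y * pd j l y)
      + (l y)⁻¹ * hes A l y i j) := fun i j ↦ by
    rw [hes_apply]
    simp only [hc0, zero_mul, Finset.sum_const_zero, sub_zero]
    rw [← pd_inv_mul i hl (hl.pd j) h0,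
      ← pd_const_mul i _ ((hl.inv h0).mul (hl.pd j)).differentiableAt]
    rfl
  have hT : ∑ k, pd k (fun z ↦ 2⁻¹ * ((l z)⁻¹ * gradVec A l k z)) y
      = 2⁻¹ * (-((l y)⁻¹ ^ 2 * mtr (A y) (grd l l y)) + (l y)⁻¹ * mtr (A y) (hes A l y)) := by
    have e : ∀ k, pd k (fun z ↦ 2⁻¹ * ((l z)⁻¹ * gradVec A l k z)) y
        = 2⁻¹ * (-((l y)⁻¹ ^ 2 * (pd k l y * gradVec A l k y))
          + (l y)⁻¹ * pd k (gradVec A l k) y) := fun k ↦ by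
      rw [pd_const_mul k _ ((hl.inv h0).mul (h.cInf_gradVec hl k)).differentiableAt,
        pd_inv_mul k hl (h.cInf_gradVec hl k) h0]
      ring
    simp only [e, ← Finset.mul_sum, Finset.sum_add_distrib, Finset.sum_neg_distrib, mtr_grd,
      h.mtr_hes hl, hc0, zero_mul, Finset.sum_const_zero, add_zero]
  have hd1 : ∀ i j, ∑ k, pd k (confGam A l k i j) y
      = pd i (hld l j) y + pd j (hld l i) y
        - A y i j * ∑ k, pd k (fun z ↦ 2⁻¹ * ((l z)⁻¹ * gradVec A l k z)) y := fun i j ↦ by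
    have e : ∀ k, pd k (confGam A l k i j) y = (if k = i then pd k (hld l j) y else 0)
        + (if k = j then pd k (hld l i) y else 0)
        - A y i j * pd k (fun z ↦ 2⁻¹ * ((l z)⁻¹ * gradVec A l k z)) y := fun k ↦ by
      have hw := cInf_hld hl h0
      have hi : ∀ i j, CInf (fun z ↦ if k = i then hld l j z else 0) y := fun i j ↦ by
        split_ifs
        exacts [hw _, CInf.const _]
      have hpi : ∀ i j, pd k (fun z ↦ if k = i then hld l j z else 0) y
          = if k = i then pd k (hld l j) y else 0 := fun i j ↦ by
        split_ifs
        exacts [rfl, pd_const _ _]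
      unfold confGam
      rw [pd_sub k ((hi _ _).add (hi _ _)).differentiableAt
        (CInf.mul (h.smooth i j) (hu k)).differentiableAt,
        pd_add k (hi _ _).differentiableAt (hi _ _).differentiableAt,
        pd_mul k (h.smooth.diff i j) (hu k).differentiableAt, hA0, hpi, hpi, zero_mul, zero_add]
    simp only [e, Finset.sum_sub_distrib, Finset.sum_add_distrib, Finset.sum_ite_eq',
      Finset.mem_univ, if_true, Finset.mul_sum]
  have hd2 : ∀ i j, ∑ k, pd i (confGam A l k k j) y = n * pd i (hld l j) y := fun i j ↦ by
    rw [← pd_sum _ _ fun k _ ↦ (hconf k k j).differentiableAt,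
      ← pd_const_mul i _ (cInf_hld hl h0 j).differentiableAt]
    exact pd_congr (h.eventually.mono fun z hz ↦ hz.sum_confGam j)
  ext i j
  have hsw : hes A l y j i = hes A l y i j := by
    rw [hes_apply, hes_apply, pd_comm j i hl]
    simp only [hc0]
  have hW : ∑ k, hld l k y * (2⁻¹ * ((l y)⁻¹ * gradVec A l k y))
      = 4⁻¹ * (l y)⁻¹ ^ 2 * mtr (A y) (grd l l y) := by
    rw [mtr_grd, Finset.mul_sum]
    exact Finset.sum_congr rfl fun k _ ↦ by rw [hld]; ring
  have hR : ric A y i j = ∑ k, pd k (chr A k i j) y - ∑ k, pd i (chr A k k j) y := by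
    simp [ric, hc0]
  have : ric (fun z ↦ l z • A z) y i j = (∑ k, pd k (chr A k i j) y + ∑ k, pd k (confGam A l k i j) y
      - (∑ k, pd i (chr A k k j) y + ∑ k, pd i (confGam A l k k j) y))
      + ∑ k, ∑ m, (confGam A l m i j y * confGam A l k m k y
      - confGam A l m k j y * confGam A l k m i y) := by
    simp only [ric, Matrix.of_apply, hp, hc, Finset.sum_sub_distrib, Finset.sum_add_distrib]
  rw [this, h.sum_confGam_mul, hd1, hd2, hT, hv, hv, hsw, hW]
  simp only [Matrix.sub_apply, Matrix.add_apply, Matrix.smul_apply, smul_eq_mul, hR, grd_apply, hld]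
  ring

/-- The Ricci tensor of a conformally rescaled metric. -/
lemma MetricAt.ric_smul (h : MetricAt A y) (hl : CInf l y) (h0 : l y ≠ 0) :
    ric (fun z ↦ l z • A z) y = ric A y
      - ((n - 2) * (1 / 2) * (l y)⁻¹ : ℝ) • hes A l y
      + ((n - 2) * (3 / 4) * (l y)⁻¹ ^ 2 : ℝ) • grd l l y
      - ((1 / 2) * (l y)⁻¹ * mtr (A y) (hes A l y)
        + ((n - 4) / 4) * (l y)⁻¹ ^ 2 * mtr (A y) (grd l l y) : ℝ) • A y := by
  obtain ⟨Ψ, B, hΨ, hj, hp, hG⟩ := h.exists_normal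
  have hl' : CInf l (Ψ y) := by rwa [hΨ]
  -- Rescaling commutes with pullback, and every term of the formula is a tensor. Since `Ψ` fixes
  -- `y` with Jacobian `1` there, the identity in normal coordinates is the identity at `y`.
  have hq : IsPull (fun z ↦ l z • A z) (fun z ↦ l (Ψ z) • B z) Ψ y := by
    refine ⟨hp.smooth, hp.det, by rw [hΨ]; exact h.smul hl h0, ?_⟩
    filter_upwards [hp.eq] with z hz
    rw [hz, Matrix.mul_smul, Matrix.smul_mul]
  have key := hp.metricAt.ric_smul_normal (hl'.comp hp.smooth) (by rwa [hΨ]) hG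
  have e1 := hq.ric_eq
  have e2 := hp.ric_eq
  have e3 := hp.hes_eq hl'
  have e4 := grd_comp hp.smooth hl' hl'
  have e5 := hp.eq.self_of_nhds
  simp only [hj, hΨ, Matrix.transpose_one, one_mul, mul_one] at e1 e2 e3 e4 e5 key
  rwa [e1, e2, e3, e4, e5] at key

/-- The partial derivatives of `f` do not see the metric, so the change is `confGam` contracted with
`df`. -/
lemma MetricAt.hes_smul (h : MetricAt A y) (hl : CInf l y) (h0 : l y ≠ 0) (f : Rn n → ℝ) :
    hes (fun z ↦ l z • A z) f y = hes A f y - (1 / 2 * (l y)⁻¹) • (grd f l y + grd l f y)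
      + ((1 / 2) * (l y)⁻¹ * mtr (A y) (grd f l y)) • A y := by
  ext i j
  simp only [hes_apply, h.chr_smul hl h0, Matrix.sub_apply, Matrix.add_apply, Matrix.smul_apply,
    smul_eq_mul, grd_apply, mtr_grd]
  have : ∑ k, confGam A l k i j y * pd k f y = hld l j y * pd i f y + hld l i y * pd j f y
      - (1 / 2) * (l y)⁻¹ * (∑ k, pd k f y * gradVec A l k y) * A y i j := by
    simp only [confGam, sub_mul, add_mul, Finset.sum_sub_distrib, Finset.sum_add_distrib, ite_mul,
      zero_mul, Finset.sum_ite_eq', Finset.mem_univ, if_true]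
    congr 1
    rw [Finset.mul_sum, Finset.sum_mul]
    exact Finset.sum_congr rfl fun _ _ ↦ by ring
  simp only [add_mul, Finset.sum_add_distrib, this, hld]
  ring

lemma mtr_add (A S T : Matrix (Fin n) (Fin n) ℝ) : mtr A (S + T) = mtr A S + mtr A T := by
  simp [mtr, mul_add, Finset.sum_add_distrib]

lemma mtr_sub (A S T : Matrix (Fin n) (Fin n) ℝ) : mtr A (S - T) = mtr A S - mtr A T := by
  simp [mtr, mul_sub, Finset.sum_sub_distrib]

lemma mtr_smul (A : Matrix (Fin n) (Fin n) ℝ) (c : ℝ) (S : Matrix (Fin n) (Fin n) ℝ) :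
    mtr A (c • S) = c * mtr A S := by
  simp only [mtr, Matrix.smul_apply, smul_eq_mul, Finset.mul_sum]
  exact Finset.sum_congr rfl fun _ _ ↦ Finset.sum_congr rfl fun _ _ ↦ by ring

lemma mtr_smul_left (A : Matrix (Fin n) (Fin n) ℝ) (hA : A.det ≠ 0) {c : ℝ} (hc : c ≠ 0)
    (S : Matrix (Fin n) (Fin n) ℝ) : mtr (c • A) S = c⁻¹ * mtr A S := by
  have : (c • A)⁻¹ = c⁻¹ • A⁻¹ := by
    refine Matrix.inv_eq_right_inv ?_
    rw [Matrix.smul_mul, Matrix.mul_smul, smul_smul, mul_inv_cancel₀ hc, one_smul,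
      Matrix.mul_nonsing_inv _ (isUnit_iff_ne_zero.2 hA)]
  simp only [mtr, this, Matrix.smul_apply, smul_eq_mul, Finset.mul_sum, mul_assoc]

lemma MetricAt.mtr_self (h : MetricAt A y) : mtr (A y) (A y) = n := by
  rw [mtr_eq_trace, h.symm.self_of_nhds, h.inv_mul, Matrix.trace_one, Fintype.card_fin]

lemma MetricAt.mtr_grd_comm (h : MetricAt A y) (f g : Rn n → ℝ) :
    mtr (A y) (grd f g y) = mtr (A y) (grd g f y) := by
  simp only [mtr, grd_apply]
  rw [Finset.sum_comm]
  exact Finset.sum_congr rfl fun i _ ↦ Finset.sum_congr rfl fun j _ ↦ by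
    rw [h.inv_symm]; ring

/-- The d'Alembertian of a conformally rescaled metric. -/
lemma MetricAt.box_smul (h : MetricAt A y) (hl : CInf l y) (h0 : l y ≠ 0) (f : Rn n → ℝ) :
    mtr (l y • A y) (hes (fun z ↦ l z • A z) f y) = (l y)⁻¹ * (mtr (A y) (hes A f y)
      + (n - 2) * (1 / 2) * (l y)⁻¹ * mtr (A y) (grd f l y)) := by
  rw [mtr_smul_left _ h.det h0, h.hes_smul hl h0, mtr_add, mtr_sub, mtr_smul, mtr_smul, mtr_add,
    h.mtr_self, h.mtr_grd_comm l f]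
  ring

lemma pd_log (hl : CInf l y) (h0 : l y ≠ 0) (i : Fin n) :
    pd i (fun z ↦ Real.log (l z)) y = (l y)⁻¹ * pd i l y :=
  pd_comp_real i (Real.hasDerivAt_log h0) hl.differentiableAt

lemma grd_log (hl : CInf l y) (h0 : l y ≠ 0) :
    grd (fun z ↦ Real.log (l z)) (fun z ↦ Real.log (l z)) y = (l y)⁻¹ ^ 2 • grd l l y := by
  ext i j
  simp only [grd_apply, pd_log hl h0, Matrix.smul_apply, smul_eq_mul]
  ring

lemma grd_log_left (hl : CInf l y) (h0 : l y ≠ 0) :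
    grd (fun z ↦ Real.log (l z)) l y = (l y)⁻¹ • grd l l y := by
  ext i j
  simp only [grd_apply, pd_log hl h0, Matrix.smul_apply, smul_eq_mul]
  ring

lemma hes_log (hl : CInf l y) (h0 : l y ≠ 0) :
    hes A (fun z ↦ Real.log (l z)) y = (l y)⁻¹ • hes A l y - (l y)⁻¹ ^ 2 • grd l l y := by
  ext i j
  have e : pd i (pd j fun z ↦ Real.log (l z)) y = pd i (fun z ↦ (l z)⁻¹ * pd j l z) y := by
    refine pd_congr ?_
    filter_upwards [hl.eventually, hl.continuousAt.eventually_ne h0] with z h1 h2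
      using pd_log h1 h2 j
  have e2 : ∑ k, chr A k i j y * ((l y)⁻¹ * pd k l y)
      = (l y)⁻¹ * ∑ k, chr A k i j y * pd k l y := by
    rw [Finset.mul_sum]
    exact Finset.sum_congr rfl fun _ _ ↦ by ring
  simp only [hes_apply, grd_apply, Matrix.sub_apply, Matrix.smul_apply, smul_eq_mul, e,
    pd_log hl h0, e2, pd_inv_mul i hl (hl.pd j) h0]
  ring

end Conformal

/-! ### Pointwise equivalence of the systems, in components. -/

section Equivalences

/-- At a point, the field equations of a static metric in four dimensions are equivalent to the
reduced equations. -/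
lemma static_equations_iff {n : ℕ} {l f : Rn n → ℝ} {h : Rn n → Matrix (Fin n) (Fin n) ℝ}
    {y : Rn (n + 1)} (hh : MetricAt h (tl y)) (hl : CInf l (tl y)) (h0 : l (tl y) ≠ 0)
    (hf : CInf f (tl y)) (κ : ℝ) :
    (ric (stat l h) y = κ • grd (fun z ↦ f (tl z)) (fun z ↦ f (tl z)) y ∧
      mtr (stat l h y) (hes (stat l h) (fun z ↦ f (tl z)) y) = 0) ↔
    (ric h (tl y) = ((1 / 2) * (l (tl y))⁻¹) • hes h l (tl y)
        - ((1 / 4) * (l (tl y))⁻¹ ^ 2) • grd l l (tl y) + κ • grd f f (tl y)) ∧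
      mtr (h (tl y)) (hes h f (tl y)) = -((1 / 2) * (l (tl y))⁻¹ * mtr (h (tl y)) (grd f l (tl y))) ∧
      mtr (h (tl y)) (hes h l (tl y)) = (1 / 2) * (l (tl y))⁻¹ * mtr (h (tl y)) (grd l l (tl y)) := by
  have hg : κ • grd (fun z ↦ f (tl z)) (fun z ↦ f (tl z)) y = blk 0 0 0 (κ • grd f f (tl y)) := by
    ext i j
    refine Fin.cases ?_ (fun i ↦ ?_) i <;> refine Fin.cases ?_ (fun j ↦ ?_) j <;>
      simp [grd_apply, pd_zero_comp_tl hf, pd_succ_comp_tl _ hf]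
  have hb : ∀ (a b : ℝ) (B C : Matrix (Fin n) (Fin n) ℝ),
      blk a 0 0 B = blk b 0 0 C ↔ a = b ∧ B = C := by
    refine fun a b B C ↦ ⟨fun e ↦ ⟨congrFun (congrFun e 0) 0, ?_⟩, ?_⟩
    · ext i j; exact congrFun (congrFun e i.succ) j.succ
    · rintro ⟨rfl, rfl⟩; rfl
  rw [ric_stat hh hl h0, hg, hb, box_stat hh hl h0 hf]
  -- The right side of the Ricci equation has no `00` component because `f` does not depend on the
  -- first variable, so this component alone is the equation for `l`.
  have e1 : -(1 / 2) * mtr (h (tl y)) (hes h l (tl y))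
        + (1 / 4) * (l (tl y))⁻¹ * mtr (h (tl y)) (grd l l (tl y)) = 0 ↔
      mtr (h (tl y)) (hes h l (tl y)) = (1 / 2) * (l (tl y))⁻¹ * mtr (h (tl y)) (grd l l (tl y)) := by
    constructor <;> intro e <;> linarith
  have e2 : ric h (tl y) - ((1 / 2) * (l (tl y))⁻¹) • hes h l (tl y)
        + ((1 / 4) * (l (tl y))⁻¹ ^ 2) • grd l l (tl y) = κ • grd f f (tl y) ↔
      ric h (tl y) = ((1 / 2) * (l (tl y))⁻¹) • hes h l (tl y)
        - ((1 / 4) * (l (tl y))⁻¹ ^ 2) • grd l l (tl y) + κ • grd f f (tl y) := by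
    rw [← sub_eq_zero, ← sub_eq_zero (b := _ + _)]
    refine Eq.congr_left ?_
    module
  rw [e1, e2, add_eq_zero_iff_eq_neg]
  tauto

lemma rescaled_equations_iff {l f : Rn 3 → ℝ} {h : Rn 3 → Matrix (Fin 3) (Fin 3) ℝ} {y : Rn 3}
    (hh : MetricAt h y) (hl : CInf l y) (h0 : l y ≠ 0) (κ : ℝ) :
    ((ric h y = ((1 / 2) * (l y)⁻¹) • hes h l y
        - ((1 / 4) * (l y)⁻¹ ^ 2) • grd l l y + κ • grd f f y) ∧
      mtr (h y) (hes h f y) = -((1 / 2) * (l y)⁻¹ * mtr (h y) (grd f l y)) ∧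
      mtr (h y) (hes h l y) = (1 / 2) * (l y)⁻¹ * mtr (h y) (grd l l y)) ↔
    (ric (fun z ↦ l z • h z) y = (1 / 2 : ℝ) • grd (fun z ↦ Real.log (l z))
        (fun z ↦ Real.log (l z)) y + κ • grd f f y) ∧
      mtr (l y • h y) (hes (fun z ↦ l z • h z) f y) = 0 ∧
      mtr (l y • h y) (hes (fun z ↦ l z • h z) (fun z ↦ Real.log (l z)) y) = 0 := by
  have e3 : mtr (l y • h y) (hes (fun z ↦ l z • h z) (fun z ↦ Real.log (l z)) y) = 0 ↔
      mtr (h y) (hes h l y) = (1 / 2) * (l y)⁻¹ * mtr (h y) (grd l l y) := by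
    -- The second derivative of the logarithm contributes `-1` to the coefficient of the gradient
    -- square and the conformal change in dimension three contributes `½`; the sum is the `-½` of
    -- the equation for `l`.
    rw [hh.box_smul hl h0, hes_log hl h0, grd_log_left hl h0, mtr_sub, mtr_smul, mtr_smul,
      mtr_smul]
    have : (l y)⁻¹ * ((l y)⁻¹ * mtr (h y) (hes h l y) - (l y)⁻¹ ^ 2 * mtr (h y) (grd l l y)
        + ((3 : ℕ) - 2) * (1 / 2) * (l y)⁻¹ * ((l y)⁻¹ * mtr (h y) (grd l l y)))
        = (l y)⁻¹ ^ 2 * (mtr (h y) (hes h l y) - (1 / 2) * (l y)⁻¹ * mtr (h y) (grd l l y)) := by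
      push_cast; ring
    rw [this, mul_eq_zero, or_iff_right (pow_ne_zero _ (inv_ne_zero h0)), sub_eq_zero]
  have e2 : mtr (l y • h y) (hes (fun z ↦ l z • h z) f y) = 0 ↔
      mtr (h y) (hes h f y) = -((1 / 2) * (l y)⁻¹ * mtr (h y) (grd f l y)) := by
    rw [hh.box_smul hl h0, mul_eq_zero, or_iff_right (inv_ne_zero h0), ← sub_eq_zero (b := -_)]
    norm_num
  rw [e2, e3]
  -- The Ricci equations are compared only under the scalar equations: inserting the one for `l`,
  -- the coefficient of the metric in `ric_smul` becomes `½ · ½ + (3 - 4) / 4 = 0`.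
  refine and_congr_left fun hb ↦ ?_
  rw [hh.ric_smul hl h0, grd_log hl h0, hb.2]
  have : (1 / 2) * (l y)⁻¹ * ((1 / 2) * (l y)⁻¹ * mtr (h y) (grd l l y))
      + (((3 : ℕ) - 4) / 4) * (l y)⁻¹ ^ 2 * mtr (h y) (grd l l y) = 0 := by
    push_cast; ring
  rw [this, zero_smul, sub_zero, ← sub_eq_zero, ← sub_eq_zero (b := _ • _ + _)]
  refine Eq.congr_left ?_
  push_cast
  module

end Equivalences

/-! ### The inverse function theorem with smoothness on whole neighborhoods. -/

section LocalInverse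

/-- The inverse function theorem, on neighborhoods where the map and its inverse are smooth. -/
lemma CInf.exists_openPartialHomeomorph {E F : Type*} [NormedAddCommGroup E] [NormedSpace ℝ E]
    [NormedAddCommGroup F] [NormedSpace ℝ F] [CompleteSpace E] {H : E → F} {a : E}
    (hH : CInf H a) {H' : E ≃L[ℝ] F} (hd : HasFDerivAt H (H' : E →L[ℝ] F) a) :
    ∃ e : OpenPartialHomeomorph E F, ⇑e = H ∧ a ∈ e.source ∧
      ContDiffOn ℝ ∞ e e.source ∧ ContDiffOn ℝ ∞ e.symm e.target := by
  -- Invertibility of the derivative is an open condition. Shrinking the source to points where it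
  -- holds and `H` is smooth makes the inverse smooth on its whole target.
  have hop : ∀ᶠ z in 𝓝 a, fderiv ℝ H z ∈ Set.range ((↑) : (E ≃L[ℝ] F) → E →L[ℝ] F) := by
    have hc : ContinuousAt (fderiv ℝ H) a :=
      (hH.contDiffAt.fderiv_right (m := ∞) (by simp)).continuousAt
    have := ContinuousLinearEquiv.nhds H'
    rw [← hd.fderiv] at this
    exact hc.eventually this
  obtain ⟨U, hU, hUo, haU⟩ := eventually_nhds_iff.1 (hH.and hop)
  let e := (hH.contDiffAt.toOpenPartialHomeomorph H hd (by simp)).restrOpen U hUo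
  have he : ⇑e = H := rfl
  refine ⟨e, he, ⟨hH.contDiffAt.mem_toOpenPartialHomeomorph_source hd (by simp), haU⟩, ?_, ?_⟩
  · exact fun z hz ↦ (hU z hz.2).1.contDiffWithinAt
  · intro z hz
    have h1 := (e.map_target hz).2
    obtain ⟨Hz, hHz⟩ := (hU _ h1).2
    refine (e.contDiffAt_symm hz (f₀' := Hz) ?_ (hU _ h1).1).contDiffWithinAt
    rw [hHz]
    exact ((hU _ h1).1.differentiableAt (by simp)).hasFDerivAt

end LocalInverse

/-! ### Smoothness of composition on spaces of continuous maps. -/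

section Superposition

/-- The superposition operator `α ↦ w ∘ α`. -/
def superpose {K E F : Type*} [TopologicalSpace K] [TopologicalSpace E]
    [TopologicalSpace F] (w : E → F) (hw : Continuous w) (α : C(K, E)) : C(K, F) :=
  (⟨w, hw⟩ : C(E, F)).comp α

@[simp] lemma superpose_apply {K E F : Type*} [TopologicalSpace K] [TopologicalSpace E]
    [TopologicalSpace F] (w : E → F) (hw : Continuous w) (α : C(K, E)) (s : K) :
    superpose w hw α s = w (α s) := rfl

universe u

variable {K : Type*} [TopologicalSpace K] [CompactSpace K]
  {E F : Type u} [NormedAddCommGroup E] [NormedSpace ℝ E] [NormedAddCommGroup F] [NormedSpace ℝ F]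

set_option synthInstance.maxHeartbeats 200000 in
/-- Pointwise application of a continuous family of operators. -/
def pointwiseApply : C(K, E →L[ℝ] F) →L[ℝ] C(K, E) →L[ℝ] C(K, F) :=
  LinearMap.mkContinuous₂
    (LinearMap.mk₂ ℝ (fun (A : C(K, E →L[ℝ] F)) (β : C(K, E)) ↦
        (⟨fun s ↦ A s (β s), by fun_prop⟩ : C(K, F)))
      (fun _ _ _ ↦ by ext; simp) (fun _ _ _ ↦ by ext; simp) (fun _ _ _ ↦ by ext; simp)
      (fun _ _ _ ↦ by ext; simp)) 1 fun A β ↦ by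
    rw [one_mul]
    refine (ContinuousMap.norm_le _ (by positivity)).2 fun s ↦ ?_
    exact (A s).le_of_opNorm_le_of_le (A.norm_coe_le_norm s) (β.norm_coe_le_norm s)

@[simp] lemma pointwiseApply_apply (A : C(K, E →L[ℝ] F)) (β : C(K, E)) (s : K) :
    pointwiseApply A β s = A s (β s) := rfl

/-- The range of `α` is compact, so the derivative of `w` varies by at most `c` on balls of one
radius `δ` about all its points. The mean value inequality on these balls bounds the remainder in
the sup norm. -/
lemma hasFDerivAt_superpose {w : E → F} (hw : ContDiff ℝ 1 w) (α : C(K, E)) :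
    HasFDerivAt (superpose w hw.continuous)
      (pointwiseApply (superpose (fderiv ℝ w) (hw.continuous_fderiv (by simp)) α)) α := by
  rw [hasFDerivAt_iff_isLittleO_nhds_zero, Asymptotics.isLittleO_iff]
  intro c hc
  have hK : IsCompact (Set.range α) := isCompact_range α.continuous
  obtain ⟨δ, hδ, h⟩ := Metric.mem_uniformity_dist.1 (hK.uniformContinuousAt_of_continuousAt
    (fderiv ℝ w) (fun a _ ↦ (hw.continuous_fderiv (by simp)).continuousAt)
    (Metric.dist_mem_uniformity hc))
  filter_upwards [Metric.ball_mem_nhds (0 : C(K, E)) hδ] with β hβ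
  rw [mem_ball_zero_iff] at hβ
  refine (ContinuousMap.norm_le _ (by positivity)).2 fun s ↦ ?_
  have hs : ‖β s‖ ≤ ‖β‖ := β.norm_coe_le_norm s
  have key := (convex_ball (α s) δ).norm_image_sub_le_of_norm_fderiv_le' (𝕜 := ℝ) (f := w)
    (φ := fderiv ℝ w (α s)) (C := c) (x := α s) (y := α s + β s)
    (fun x _ ↦ (hw.differentiable (by simp)) x) (fun x hx ↦ ?_) (Metric.mem_ball_self hδ) ?_
  · rw [add_sub_cancel_left] at key
    exact key.trans (mul_le_mul_of_nonneg_left hs hc.le)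
  · rw [← dist_eq_norm, dist_comm]
    exact (h (a := α s) (b := x) (by rwa [dist_comm]) ⟨s, rfl⟩).le
  · rw [Metric.mem_ball, dist_eq_norm, add_sub_cancel_left]
    exact hs.trans_lt hβ

-- Induction on the order: the derivative is the superposition operator of `fderiv ℝ w` followed by
-- a fixed continuous linear map. The target `F` must vary, since it becomes `E →L[ℝ] F`; a common
-- universe for `E` and `F` keeps this space within the scope of the induction.
set_option synthInstance.maxHeartbeats 200000 in
set_option maxHeartbeats 1000000 in
lemma contDiff_superpose_nat (m : ℕ) : ∀ {F : Type u} [NormedAddCommGroup F] [NormedSpace ℝ F]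
    {w : E → F} (hw : ContDiff ℝ ∞ w),
    ContDiff ℝ m (superpose (K := K) w hw.continuous) := by
  induction m with
  | zero =>
    intro F _ _ w hw
    exact contDiff_zero.2 (ContinuousMap.continuous_postcomp _)
  | succ m ih =>
    intro F _ _ w hw
    have hd := fun α ↦ hasFDerivAt_superpose (K := K) (hw.of_le (by simp)) α
    push_cast
    rw [contDiff_succ_iff_fderiv]
    refine ⟨fun α ↦ (hd α).differentiableAt, by simp, ?_⟩
    have hw' : ContDiff ℝ ∞ (fderiv ℝ w) := hw.fderiv_right (by simp)
    have : fderiv ℝ (superpose (K := K) w hw.continuous)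
        = fun α ↦ pointwiseApply (superpose (fderiv ℝ w) hw'.continuous α) :=
      funext fun α ↦ (hd α).fderiv
    rw [this]
    have h1 : ContDiff ℝ m (superpose (K := K) (fderiv ℝ w) hw'.continuous) := ih hw'
    exact ContDiff.continuousLinearMap_comp pointwiseApply h1

/-- Superposition with a smooth map is smooth on spaces of continuous maps. -/
lemma contDiff_superpose {w : E → F} (hw : ContDiff ℝ ∞ w) :
    ContDiff ℝ ∞ (superpose (K := K) w hw.continuous) :=
  contDiff_infty.2 fun m ↦ contDiff_superpose_nat m hw

end Superposition

/-! ### The local flow of a smooth vector field, smooth in time and initial point. -/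

section Flow

variable {E : Type*} [NormedAddCommGroup E]

/-- The interval `[-1, 1]`. -/
abbrev UI : Type := Set.Icc (-1 : ℝ) 1

/-- Extension of a path on `[-1, 1]` to the line. -/
def extPath (α : C(UI, E)) : ℝ → E := Set.IccExtend (by norm_num) α

lemma continuous_extPath (α : C(UI, E)) : Continuous (extPath α) := α.continuous.Icc_extend'

lemma extPath_of_mem (α : C(UI, E)) (s : UI) : extPath α s = α s := Set.IccExtend_val _ _ _

lemma norm_extPath_le (α : C(UI, E)) (r : ℝ) : ‖extPath α r‖ ≤ ‖α‖ := α.norm_coe_le_norm _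

variable [NormedSpace ℝ E]

/-- The primitive of a path that vanishes at `0`. -/
def primitive : C(UI, E) →L[ℝ] C(UI, E) :=
  LinearMap.mkContinuous
    { toFun := fun α ↦ ⟨fun s ↦ ∫ r in (0 : ℝ)..s, extPath α r,
        (intervalIntegral.continuous_primitive
          (fun a b ↦ (continuous_extPath α).intervalIntegrable a b) 0).comp continuous_subtype_val⟩
      map_add' := fun α β ↦ by
        ext s
        exact intervalIntegral.integral_add ((continuous_extPath α).intervalIntegrable _ _)
          ((continuous_extPath β).intervalIntegrable _ _)
      map_smul' := fun c α ↦ by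
        ext s
        exact intervalIntegral.integral_smul c (extPath α) } 1 fun α ↦ by
    rw [one_mul]
    refine (ContinuousMap.norm_le _ (by positivity)).2 fun s ↦ ?_
    refine (intervalIntegral.norm_integral_le_of_norm_le_const
      fun r _ ↦ norm_extPath_le α r).trans ?_
    rw [sub_zero]
    exact mul_le_of_le_one_right (norm_nonneg _) (abs_le.2 s.2)

@[simp] lemma primitive_apply (α : C(UI, E)) (s : UI) :
    primitive α s = ∫ r in (0 : ℝ)..s, extPath α r := rfl

lemma norm_primitive_le (α : C(UI, E)) : ‖primitive α‖ ≤ ‖α‖ := by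
  refine (ContinuousLinearMap.le_of_opNorm_le _ (LinearMap.mkContinuous_norm_le _ zero_le_one _)
    α).trans (one_mul _).le

/-- The equation `α(s) = x + t ∫₀ˢ w(α)` for rescaled integral curves. -/
def IsScaledCurve (w : E → E) (hw : Continuous w) (t : ℝ) (x : E) (α : C(UI, E)) : Prop :=
  α = ContinuousMap.const _ x + t • primitive (superpose w hw α)

/-- Because `|s| ≤ 1`, taking primitives does not increase the sup norm, so the integral operator is
a contraction with constant `|t| * C`. -/
lemma IsScaledCurve.unique {w : E → E} {C : NNReal} (hw : LipschitzWith C w) {t : ℝ} {x : E}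
    (ht : |t| * C < 1) {α β : C(UI, E)} (hα : IsScaledCurve w hw.continuous t x α)
    (hβ : IsScaledCurve w hw.continuous t x β) : α = β := by
  have h1 : α - β = t • primitive (superpose w hw.continuous α - superpose w hw.continuous β) := by
    conv_lhs => rw [hα, hβ]
    rw [map_sub, smul_sub]; abel
  have h2 : ‖superpose w hw.continuous α - superpose w hw.continuous β‖ ≤ C * ‖α - β‖ := by
    refine (ContinuousMap.norm_le _ (by positivity)).2 fun s ↦ ?_
    have := hw.dist_le_mul (α s) (β s)
    rw [dist_eq_norm, dist_eq_norm] at this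
    exact this.trans (by gcongr; exact (α - β).norm_coe_le_norm s)
  have h3 : ‖α - β‖ ≤ (|t| * C) * ‖α - β‖ := by
    conv_lhs => rw [h1]
    rw [norm_smul, Real.norm_eq_abs, mul_assoc]
    gcongr
    exact (norm_primitive_le _).trans h2
  have h4 : ‖α - β‖ = 0 := by nlinarith [norm_nonneg (α - β)]
  exact sub_eq_zero.1 (norm_eq_zero.1 h4)

lemma IsScaledCurve.hasDerivAt [CompleteSpace E] {w : E → E} {hw : Continuous w} {t : ℝ} {x : E}
    {α : C(UI, E)} (hα : IsScaledCurve w hw t x α) {s : ℝ} (hs : s ∈ Set.Ioo (-1 : ℝ) 1) :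
    HasDerivAt (extPath α) (t • w (extPath α s)) s := by
  have h1 : HasDerivAt (fun s ↦ x + t • ∫ r in (0 : ℝ)..s, extPath (superpose w hw α) r)
      (t • extPath (superpose w hw α) s) s :=
    ((intervalIntegral.integral_hasDerivAt_right
      ((continuous_extPath _).intervalIntegrable _ _)
      ((continuous_extPath _).stronglyMeasurableAtFilter _ _)
      (continuous_extPath _).continuousAt).const_smul t).const_add x
  refine h1.congr_of_eventuallyEq ?_
  filter_upwards [Ioo_mem_nhds hs.1 hs.2] with r hr
  have := extPath_of_mem α ⟨r, hr.1.le, hr.2.le⟩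
  simp only at this
  rw [this]
  exact congrArg (fun f : C(UI, E) ↦ f ⟨r, hr.1.le, hr.2.le⟩) hα

/-- A curve with parameter `T` is an integral curve traversed at speed `T`; slowing it down by `c`
gives one with parameter `c * T`, by a substitution in the integral. -/
lemma IsScaledCurve.rescale {w : E → E} {hw : Continuous w} {T : ℝ} {x : E}
    {α : C(UI, E)} (hα : IsScaledCurve w hw T x α) {c : ℝ} (hc : |c| ≤ 1) :
    IsScaledCurve w hw (c * T) x ⟨fun s ↦ extPath α (c * s),
      (continuous_extPath α).comp (by fun_prop)⟩ := by
  have hmem : ∀ s : UI, c * s ∈ Set.Icc (-1 : ℝ) 1 := fun s ↦ by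
    rw [Set.mem_Icc, ← abs_le, abs_mul]
    exact mul_le_one₀ hc (abs_nonneg _) (abs_le.2 s.2)
  ext s
  have h1 := congrArg (fun f : C(UI, E) ↦ f ⟨c * s, hmem s⟩) hα
  have h2 := extPath_of_mem α ⟨c * s, hmem s⟩
  simp only at h1 h2
  simp only [ContinuousMap.coe_mk, h2, h1, ContinuousMap.add_apply, ContinuousMap.const_apply,
    ContinuousMap.smul_apply, primitive_apply]
  rw [mul_comm c T, mul_smul]
  congr 2
  have h3 : ∀ r ∈ Set.uIcc (0 : ℝ) s, extPath (superpose w hw ⟨fun s : UI ↦ extPath α (c * s),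
      (continuous_extPath α).comp (by fun_prop)⟩) r = extPath (superpose w hw α) (c * r) := by
    intro r hr
    have hr' : r ∈ Set.Icc (-1 : ℝ) 1 :=
      Set.uIcc_subset_Icc (by norm_num) s.2 hr
    exact extPath_of_mem _ ⟨r, hr'⟩
  rw [intervalIntegral.integral_congr h3, intervalIntegral.smul_integral_comp_mul_left, mul_zero]

/-- Constant paths, as a linear map. -/
def constPath : E →L[ℝ] C(UI, E) :=
  LinearMap.mkContinuous
    { toFun := fun x ↦ ContinuousMap.const _ x
      map_add' := fun _ _ ↦ rfl
      map_smul' := fun _ _ ↦ rfl } 1 fun x ↦ by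
    rw [one_mul]
    exact (ContinuousMap.norm_le _ (norm_nonneg _)).2 fun _ ↦ le_rfl

@[simp] lemma constPath_apply (x : E) : constPath x = ContinuousMap.const UI x := rfl

/-- The cutoff makes the field smooth everywhere, as superposition requires, and globally Lipschitz,
as uniqueness requires. -/
lemma CInf.exists_compactSupport [FiniteDimensional ℝ E] {v : E → E} {x₀ : E} (hv : CInf v x₀) :
    ∃ w : E → E, ContDiff ℝ ∞ w ∧ HasCompactSupport w ∧ w =ᶠ[𝓝 x₀] v := by
  obtain ⟨r, hr, hball⟩ := Metric.eventually_nhds_iff_ball.1 hv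
  let f : ContDiffBump x₀ := ⟨r / 4, r / 2, by positivity, by linarith⟩
  refine ⟨fun x ↦ f x • v x, ?_, f.hasCompactSupport.smul_right, ?_⟩
  · rw [contDiff_iff_contDiffAt]
    intro x
    by_cases hx : x ∈ Metric.ball x₀ r
    · exact f.contDiffAt.smul (hball x hx)
    · have h0 : (fun x ↦ f x • v x) =ᶠ[𝓝 x] fun _ ↦ 0 := by
        have : (tsupport f)ᶜ ∈ 𝓝 x := by
          refine (isClosed_tsupport _).isOpen_compl.mem_nhds fun h ↦ hx ?_
          rw [f.tsupport_eq] at h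
          exact Metric.closedBall_subset_ball (by change r / 2 < r; linarith) h
        filter_upwards [this] with z hz
        rw [image_eq_zero_of_notMem_tsupport hz, zero_smul]
      exact contDiffAt_const.congr_of_eventuallyEq h0
  · filter_upwards [f.eventuallyEq_one] with x hx
    simp [hx]

/-- Existence and smooth dependence on parameters of the rescaled integral curves. -/
lemma exists_smooth_scaledCurve [CompleteSpace E] {w : E → E} (hw : ContDiff ℝ ∞ w) (x₀ : E) :
    ∃ Θ : ℝ × E → C(UI, E), CInf Θ (0, x₀) ∧
      ∀ᶠ p in 𝓝 ((0 : ℝ), x₀), IsScaledCurve w hw.continuous p.1 p.2 (Θ p) := by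
  let S : C(UI, E) → C(UI, E) := superpose w hw.continuous
  have hS : ContDiff ℝ ∞ S := contDiff_superpose hw
  -- A zero of the second component of `H` is a rescaled integral curve, with the parameters `(t,
  -- x)` carried along. Inverting `H` and evaluating at `(p, 0)` solves for the curve smoothly in
  -- `p`.
  let H : (ℝ × E) × C(UI, E) → (ℝ × E) × C(UI, E) :=
    fun q ↦ (q.1, q.2 - constPath q.1.2 - q.1.1 • primitive (S q.2))
  have hH : ContDiff ℝ ∞ H :=
    contDiff_fst.prodMk ((contDiff_snd.sub
      (constPath.contDiff.comp (contDiff_snd.comp contDiff_fst))).sub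
      ((contDiff_fst.comp contDiff_fst).smul
        (primitive.contDiff.comp (hS.comp contDiff_snd))))
  let q₀ : (ℝ × E) × C(UI, E) := ((0, x₀), constPath x₀)
  -- At `t = 0` the nonlinear term enters only through its `t`-derivative, so the differential is
  -- block triangular with identities on the diagonal, whatever `w` is.
  let H' : ((ℝ × E) × C(UI, E)) ≃L[ℝ] ((ℝ × E) × C(UI, E)) :=
    (ContinuousLinearEquiv.refl ℝ (ℝ × E)).skewProd (ContinuousLinearEquiv.refl ℝ C(UI, E))
      (-(constPath.comp (ContinuousLinearMap.snd ℝ ℝ E))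
        - (ContinuousLinearMap.fst ℝ ℝ E).smulRight (primitive (S (constPath x₀))))
  have hd : HasFDerivAt H (H' : _ →L[ℝ] _) q₀ := by
    have h1 : HasFDerivAt (fun q : (ℝ × E) × C(UI, E) ↦ q.1)
        (ContinuousLinearMap.fst ℝ (ℝ × E) C(UI, E)) q₀ := hasFDerivAt_fst
    have h2 : HasFDerivAt (fun q : (ℝ × E) × C(UI, E) ↦ q.2)
        (ContinuousLinearMap.snd ℝ (ℝ × E) C(UI, E)) q₀ := hasFDerivAt_snd
    have h3 := (hasFDerivAt_fst (𝕜 := ℝ) (p := q₀.1)).comp q₀ h1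
    have h4 := (hasFDerivAt_snd (𝕜 := ℝ) (p := q₀.1)).comp q₀ h1
    have h5 := constPath.hasFDerivAt.comp q₀ h4
    have h6 := primitive.hasFDerivAt.comp q₀
      ((hS.differentiable (by simp) (constPath x₀)).hasFDerivAt.comp q₀ h2)
    have h7 := h1.prodMk ((h2.sub h5).sub (h3.smul h6))
    refine h7.congr_fderiv ?_
    ext q <;> simp [H', q₀]
  obtain ⟨e, he, hmem, -, hsymm⟩ := hH.cInf.exists_openPartialHomeomorph hd
  have hq : H q₀ = ((0, x₀), 0) := by simp [H, q₀]
  have ht : ((0, x₀), 0) ∈ e.target := by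
    rw [← hq, ← he]; exact e.map_source hmem
  have hev : ∀ᶠ p in 𝓝 ((0 : ℝ), x₀), (p, (0 : C(UI, E))) ∈ e.target :=
    (Continuous.prodMk_left (0 : C(UI, E))).continuousAt.eventually (e.open_target.mem_nhds ht)
  refine ⟨fun p ↦ (e.symm (p, 0)).2, ?_, ?_⟩
  · have h1 : CInf e.symm ((0, x₀), 0) := hsymm.cInf (e.open_target.mem_nhds ht)
    have h2 : CInf (fun p : ℝ × E ↦ (p, (0 : C(UI, E)))) (0, x₀) :=
      (contDiff_id.prodMk contDiff_const).cInf
    exact CInf.comp (g := Prod.snd) contDiff_snd.cInf (CInf.comp h1 h2)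
  · filter_upwards [hev] with p hp
    have h1 : H (e.symm (p, 0)) = (p, 0) := by rw [← he]; exact e.right_inv hp
    have h2 : (e.symm (p, 0)).1 = p := congrArg Prod.fst h1
    have h3 := congrArg Prod.snd h1
    simp only [H, h2] at h3
    rw [sub_sub, sub_eq_zero] at h3
    exact h3

/-- **Smooth dependence on initial conditions**: the local flow of a smooth vector field. -/
theorem exists_smooth_flow [FiniteDimensional ℝ E] {v : E → E} {x₀ : E}
    (hv : CInf v x₀) : ∃ Φ : ℝ × E → E, CInf Φ (0, x₀) ∧ (∀ᶠ x in 𝓝 x₀, Φ (0, x) = x) ∧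
      ∀ᶠ p in 𝓝 ((0 : ℝ), x₀), HasDerivAt (fun t ↦ Φ (t, p.2)) (v (Φ p)) p.1 := by
  have : CompleteSpace E := FiniteDimensional.complete ℝ E
  obtain ⟨w, hw, hws, hwv⟩ := hv.exists_compactSupport
  obtain ⟨C, hC⟩ := hw.lipschitzWith_of_hasCompactSupport hws (by simp)
  obtain ⟨Θ, hΘ, hev⟩ := exists_smooth_scaledCurve hw x₀
  let o : UI := ⟨1, by norm_num⟩
  have ho : ContDiff ℝ ∞ (fun α : C(UI, E) ↦ α o) :=
    (ContinuousMap.evalCLM ℝ o : C(UI, E) →L[ℝ] E).contDiff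
  have hΦ : CInf (fun p ↦ Θ p o) (0, x₀) := CInf.comp (g := fun α : C(UI, E) ↦ α o) ho.cInf hΘ
  have h0 : ∀ {x}, IsScaledCurve w hw.continuous 0 x (Θ (0, x)) → Θ (0, x) o = x := by
    intro x hx
    have := congrArg (fun α : C(UI, E) ↦ α o) hx
    simpa using this
  refine ⟨fun p ↦ Θ p o, hΦ, ?_, ?_⟩
  · filter_upwards [(Continuous.prodMk_right (0 : ℝ)).continuousAt.eventually hev] with x hx
      using h0 hx
  have hx0 : Θ (0, x₀) o = x₀ := h0 hev.self_of_nhds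
  have hwv' : ∀ᶠ p in 𝓝 ((0 : ℝ), x₀), w (Θ p o) = v (Θ p o) := by
    have := hΦ.continuousAt
    rw [ContinuousAt, hx0] at this
    exact this.eventually hwv
  obtain ⟨ε, hε, hball⟩ := Metric.eventually_nhds_iff_ball.1 hev
  -- The first bound keeps `(T, x)` where the rescaled curves exist; the second makes `T * C < 1`,
  -- so that they are unique.
  let T := min (ε / 2) (1 / (2 * (C + 1)))
  have hT : 0 < T := lt_min (by positivity) (by positivity)
  have hTC : T * C < 1 := by
    have h1 : T ≤ 1 / (2 * (C + 1)) := min_le_right _ _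
    have h2 : (1 / (2 * (C + 1)) : ℝ) * C < 1 := by
      rw [div_mul_eq_mul_div, one_mul, div_lt_one (by positivity)]
      linarith [C.2]
    exact (mul_le_mul_of_nonneg_right h1 C.2).trans_lt h2
  have hTε : T < ε := (min_le_left _ _).trans_lt (by linarith)
  have hgood : ∀ {t x}, |t| ≤ T → dist x x₀ < ε → IsScaledCurve w hw.continuous t x (Θ (t, x)) := by
    intro t x ht hx
    refine hball _ ?_
    rw [Metric.mem_ball, Prod.dist_eq, max_lt_iff]
    exact ⟨by simpa using ht.trans_lt hTε, hx⟩
  have hnear : ∀ᶠ p in 𝓝 ((0 : ℝ), x₀), |p.1| < T ∧ dist p.2 x₀ < ε := by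
    have h1 : ∀ᶠ t in 𝓝 (0 : ℝ), |t| < T :=
      continuous_abs.continuousAt.eventually (gt_mem_nhds (by simpa using hT))
    exact h1.prod_nhds (Metric.ball_mem_nhds x₀ hε)
  filter_upwards [hwv', hnear] with p hp hpn
  rw [← hp]
  have hTx := hgood (t := T) (x := p.2) (abs_of_pos hT).le hpn.2
  -- The flow is an endpoint value with varying parameter `t`, whereas the differential equation is
  -- known along a single path. Rescaling and uniqueness identify the endpoint at parameter `t` with
  -- the value at `t / T` of the path with parameter `T`.
  have hres : ∀ t, |t| < T → Θ (t, p.2) o = extPath (Θ (T, p.2)) (t / T) := by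
    intro t ht
    have hc : |t / T| ≤ 1 := by
      rw [abs_div, abs_of_pos hT]; exact (div_le_one hT).2 ht.le
    have h1 := hTx.rescale hc
    rw [div_mul_cancel₀ t hT.ne'] at h1
    have h2 := (hgood ht.le hpn.2).unique hC
      ((mul_le_mul_of_nonneg_right ht.le C.2).trans_lt hTC) h1
    rw [h2]
    simp [o]
  have hmem : p.1 / T ∈ Set.Ioo (-1 : ℝ) 1 := by
    rw [Set.mem_Ioo, ← abs_lt, abs_div, abs_of_pos hT]; exact (div_lt_one hT).2 hpn.1
  have h1 := HasDerivAt.scomp p.1 (hTx.hasDerivAt hmem) ((hasDerivAt_id p.1).div_const T)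
  have h2 : Θ p o = extPath (Θ (T, p.2)) (p.1 / T) := hres p.1 hpn.1
  rw [h2]
  rw [smul_smul, one_div, inv_mul_cancel₀ hT.ne', one_smul] at h1
  refine h1.congr_of_eventuallyEq ?_
  have : ∀ᶠ t in 𝓝 p.1, |t| < T := continuous_abs.continuousAt.eventually (gt_mem_nhds hpn.1)
  filter_upwards [this] with t ht using hres t ht

end Flow

/-! ### Matrices as bilinear forms. -/

section Forms

variable {n : ℕ}

/-- The bilinear form of a matrix. -/
def form {n : ℕ} (S : Matrix (Fin n) (Fin n) ℝ) (u w : Rn n) : ℝ :=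
  ∑ i, ∑ j, S i j * u i * w j

lemma form_eq_dotProduct (S : Matrix (Fin n) (Fin n) ℝ) (u w : Rn n) :
    form S u w = u.ofLp ⬝ᵥ S.mulVec w.ofLp := by
  simp only [form, dotProduct, Matrix.mulVec, Finset.mul_sum]
  exact Finset.sum_congr rfl fun i _ ↦ Finset.sum_congr rfl fun j _ ↦ by ring

lemma form_single (S : Matrix (Fin n) (Fin n) ℝ) (i j : Fin n) :
    form S (EuclideanSpace.single i 1) (EuclideanSpace.single j 1) = S i j := by
  simp [form_eq_dotProduct]

lemma form_grd (f h : Rn n → ℝ) (y u w : Rn n) :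
    form (grd f h y) u w = fderiv ℝ f y u * fderiv ℝ h y w := by
  rw [fderiv_eq_sum_pd, fderiv_eq_sum_pd, Finset.sum_mul_sum]
  exact Finset.sum_congr rfl fun i _ ↦ Finset.sum_congr rfl fun j _ ↦ by
    simp only [grd, Matrix.of_apply]; ring

lemma form_add (S T : Matrix (Fin n) (Fin n) ℝ) (u w : Rn n) :
    form (S + T) u w = form S u w + form T u w := by
  simp [form_eq_dotProduct, Matrix.add_mulVec]

lemma form_sub (S T : Matrix (Fin n) (Fin n) ℝ) (u w : Rn n) :
    form (S - T) u w = form S u w - form T u w := by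
  simp [form_eq_dotProduct, Matrix.sub_mulVec]

lemma form_smul (c : ℝ) (S : Matrix (Fin n) (Fin n) ℝ) (u w : Rn n) :
    form (c • S) u w = c * form S u w := by
  simp [form_eq_dotProduct, Matrix.smul_mulVec]

lemma form_injective {S T : Matrix (Fin n) (Fin n) ℝ} (h : ∀ u w, form S u w = form T u w) :
    S = T := by
  ext i j
  rw [← form_single S, h, form_single]

lemma ofLp_fderiv {m : ℕ} {τ : Rn m → Rn n} {y : Rn m} (h : DifferentiableAt ℝ τ y) (u : Rn m) :
    (fderiv ℝ τ y u).ofLp = (jac τ y).mulVec u.ofLp := by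
  ext a
  have h1 := (((EuclideanSpace.proj a : Rn n →L[ℝ] ℝ).hasFDerivAt).comp y h.hasFDerivAt).fderiv
  have h2 : fderiv ℝ (fun z ↦ τ z a) y u = fderiv ℝ τ y u a := by
    simp only [Function.comp_def] at h1
    exact congrArg (fun L ↦ L u) h1
  rw [← h2, fderiv_eq_sum_pd]
  exact Finset.sum_congr rfl fun i _ ↦ mul_comm _ _

lemma form_fderiv {m : ℕ} {τ : Rn m → Rn n} {y : Rn m} (h : DifferentiableAt ℝ τ y)
    (S : Matrix (Fin n) (Fin n) ℝ) (u w : Rn m) :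
    form S (fderiv ℝ τ y u) (fderiv ℝ τ y w) = form ((jac τ y).transpose * S * jac τ y) u w := by
  rw [form_eq_dotProduct, form_eq_dotProduct, ofLp_fderiv h, ofLp_fderiv h, ← Matrix.mulVec_mulVec,
    ← Matrix.mulVec_mulVec, Matrix.dotProduct_mulVec _ (jac τ y).transpose, Matrix.vecMul_transpose]

lemma bilin_eq_form (B : Rn n →L[ℝ] Rn n →L[ℝ] ℝ) (u w : Rn n) :
    B u w = form (Matrix.of fun i j ↦ B (EuclideanSpace.single i 1) (EuclideanSpace.single j 1))
      u w := by
  have hb : ∀ v : Rn n, v = ∑ i, v i • EuclideanSpace.single i (1 : ℝ) := fun v ↦ by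
    ext j; simp [Finset.sum_apply, Pi.single_apply]
  conv_lhs => rw [hb u, hb w]
  simp only [map_sum, map_smul, sum_apply, smul_apply,
    smul_eq_mul, form, Matrix.of_apply, Finset.mul_sum]
  rw [Finset.sum_comm]
  exact Finset.sum_congr rfl fun i _ ↦ Finset.sum_congr rfl fun j _ ↦ by ring

lemma MSm.contDiffAt_sum_smul {A : Rn n → Matrix (Fin n) (Fin n) ℝ} {y : Rn n} (hA : MSm A y)
    {F : Type*} [NormedAddCommGroup F] [NormedSpace ℝ F] (B : Fin n → Fin n → F) :
    ContDiffAt ℝ ∞ (fun z ↦ ∑ a, ∑ b, A z a b • B a b) y :=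
  ContDiffAt.sum fun a _ ↦ ContDiffAt.sum fun b _ ↦ (hA a b).contDiffAt.smul contDiffAt_const

end Forms

/-! ### Maps from `ℝᵏ` to a manifold and components of pulled-back tensors. -/

section Parametrizations

variable {k n : ℕ} {N : Type*} [TopologicalSpace N] [ChartedSpace (Rn n) N]

/-- A map from `ℝᵏ` to a manifold that is smooth near a point. -/
def SmoothNear {k : ℕ} (n : ℕ) {N : Type*} [TopologicalSpace N] [ChartedSpace (Rn n) N]
    (Ψ : Rn k → N) (y : Rn k) : Prop :=
  ∀ᶠ z in 𝓝 y, ContMDiffAt (𝓡 k) (𝓡 n) ∞ Ψ z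

/-- The image of a vector under the differential of a map from `ℝᵏ`. -/
def push (Ψ : Rn k → N) (z u : Rn k) : TangentSpace (𝓡 n) (Ψ z) :=
  mfderiv (𝓡 k) (𝓡 n) Ψ z u

/-- The components of the pullback of a tensor field to `ℝᵏ`. -/
def pullMatrix (g : Tensor2 n N) (Ψ : Rn k → N) (z : Rn k) : Matrix (Fin k) (Fin k) ℝ :=
  Matrix.of fun i j ↦ g (Ψ z) (push Ψ z (EuclideanSpace.single i 1))
    (push Ψ z (EuclideanSpace.single j 1))

lemma metricMatrix_eq_pullMatrix (g : Tensor2 n N) (e : OpenPartialHomeomorph N (Rn n)) :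
    metricMatrix g e = pullMatrix g e.symm := rfl

/-- Tangent spaces at equal points are different types but all unfold to `Rn n`; stating the
equality for model vectors avoids casts. -/
lemma tensor_congr (g : Tensor2 n N) {x x' : N} (h : x = x') (v w : Rn n) :
    g x v w = g x' v w := by
  subst h; rfl

lemma form_pullMatrix (g : Tensor2 n N) (Ψ : Rn k → N) (z u w : Rn k) :
    form (pullMatrix g Ψ z) u w = g (Ψ z) (push Ψ z u) (push Ψ z w) := by
  let D : Rn k →L[ℝ] Rn n := mfderiv (𝓡 k) (𝓡 n) Ψ z
  let B : Rn n →L[ℝ] Rn n →L[ℝ] ℝ := g (Ψ z)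
  exact (bilin_eq_form ((ContinuousLinearMap.precomp ℝ D).comp (B.comp D)) u w).symm

lemma SmoothNear.mdifferentiableAt {Ψ : Rn k → N} {y : Rn k} (h : SmoothNear n Ψ y) :
    MDifferentiableAt (𝓡 k) (𝓡 n) Ψ y := h.self_of_nhds.mdifferentiableAt (by simp)

lemma SmoothNear.eventually {Ψ : Rn k → N} {y : Rn k} (h : SmoothNear n Ψ y) :
    ∀ᶠ z in 𝓝 y, SmoothNear n Ψ z := eventually_eventually_nhds.2 h

lemma SmoothNear.continuousAt {Ψ : Rn k → N} {y : Rn k} (h : SmoothNear n Ψ y) :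
    ContinuousAt Ψ y := h.self_of_nhds.continuousAt

lemma SmoothNear.cInf_comp {f : N → ℝ} (hf : IsSmoothScalar (n := n) f) {Ψ : Rn k → N} {y : Rn k}
    (h : SmoothNear n Ψ y) : CInf (fun z ↦ f (Ψ z)) y := by
  filter_upwards [h] with z hz
  exact ((hf (Ψ z)).comp z hz).contDiffAt

lemma dif_push {f : N → ℝ} {Ψ : Rn k → N} {y : Rn k}
    (hf : MDifferentiableAt (𝓡 n) 𝓘(ℝ, ℝ) f (Ψ y)) (h : SmoothNear n Ψ y) (u : Rn k) :
    dif f (Ψ y) (push (n := n) Ψ y u) = fderiv ℝ (fun z ↦ f (Ψ z)) y u := by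
  have := mfderiv_comp y hf h.mdifferentiableAt
  rw [← mfderiv_eq_fderiv]
  exact (congrArg (fun L : Rn k →L[ℝ] ℝ ↦ L u) this).symm

lemma IsSmoothScalar.mdifferentiableAt {f : N → ℝ} (hf : IsSmoothScalar (n := n) f) (x : N) :
    MDifferentiableAt (𝓡 n) 𝓘(ℝ, ℝ) f x := (hf x).mdifferentiableAt (by simp)

lemma SmoothNear.comp {m : ℕ} {τ : Rn m → Rn k} {Ψ : Rn k → N} {y : Rn m} (hτ : CInf τ y)
    (h : SmoothNear n Ψ (τ y)) : SmoothNear n (fun z ↦ Ψ (τ z)) y := by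
  filter_upwards [hτ, hτ.continuousAt.eventually h] with z h1 h2
  exact h2.comp z h1.contMDiffAt

lemma push_comp {m : ℕ} {τ : Rn m → Rn k} {Ψ : Rn k → N} {y : Rn m} (hτ : CInf τ y)
    (h : SmoothNear n Ψ (τ y)) (u : Rn m) :
    push (n := n) (fun z ↦ Ψ (τ z)) y u = push Ψ (τ y) (fderiv ℝ τ y u) := by
  have := mfderiv_comp y h.mdifferentiableAt hτ.differentiableAt.mdifferentiableAt
  rw [mfderiv_eq_fderiv] at this
  exact congrArg (fun L : Rn m →L[ℝ] Rn n ↦ L u) this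

lemma push_congr {Ψ Ψ' : Rn k → N} {y : Rn k} (h : Ψ =ᶠ[𝓝 y] Ψ') (u : Rn k) :
    (push Ψ y u : Rn n) = (push Ψ' y u : Rn n) := by
  have := h.mfderiv_eq (I := 𝓡 k) (I' := 𝓡 n)
  exact congrArg (fun L : Rn k →L[ℝ] Rn n ↦ L u) this

lemma pullMatrix_congr (g : Tensor2 n N) {Ψ Ψ' : Rn k → N} {y : Rn k} (h : Ψ =ᶠ[𝓝 y] Ψ') :
    pullMatrix g Ψ =ᶠ[𝓝 y] pullMatrix g Ψ' := by
  filter_upwards [h.eventually_nhds] with z hz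
  ext i j
  simp only [pullMatrix, Matrix.of_apply]
  refine (tensor_congr g hz.self_of_nhds _ _).trans ?_
  rw [push_congr hz, push_congr hz]

lemma pullMatrix_comp (g : Tensor2 n N) {m : ℕ} {τ : Rn m → Rn k} {Ψ : Rn k → N} {y : Rn m}
    (hτ : CInf τ y) (h : SmoothNear n Ψ (τ y)) :
    pullMatrix g (fun z ↦ Ψ (τ z)) y = (jac τ y).transpose * pullMatrix g Ψ (τ y) * jac τ y := by
  refine form_injective fun u w ↦ ?_
  rw [← form_fderiv hτ.differentiableAt, form_pullMatrix, form_pullMatrix, push_comp hτ h,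
    push_comp hτ h]

lemma SmoothNear.eventually_chart {Ψ : Rn k → N} {y : Rn k} (h : SmoothNear n Ψ y) {p : N}
    (hp : Ψ y ∈ (chartAt (Rn n) p).source) :
    Ψ =ᶠ[𝓝 y] fun z ↦ (chartAt (Rn n) p).symm (chartAt (Rn n) p (Ψ z)) := by
  filter_upwards [h.continuousAt.eventually ((chartAt (Rn n) p).open_source.mem_nhds hp)] with z hz
  exact ((chartAt (Rn n) p).left_inv hz).symm

variable [IsManifold (𝓡 n) ∞ N]

lemma smoothNear_chartAt_symm (p : N) {y : Rn n} (hy : y ∈ (chartAt (Rn n) p).target) :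
    SmoothNear n (chartAt (Rn n) p).symm y := by
  filter_upwards [(chartAt (Rn n) p).open_target.mem_nhds hy] with z hz
  exact contMDiffAt_symm_of_mem_maximalAtlas (IsManifold.chart_mem_maximalAtlas p) hz

/-- The coordinate expression of a smooth map is smooth. -/
lemma SmoothNear.cInf_chart {Ψ : Rn k → N} {y : Rn k} (h : SmoothNear n Ψ y) {p : N}
    (hp : Ψ y ∈ (chartAt (Rn n) p).source) : CInf (fun z ↦ chartAt (Rn n) p (Ψ z)) y := by
  filter_upwards [h, h.continuousAt.eventually ((chartAt (Rn n) p).open_source.mem_nhds hp)]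
    with z h1 h2
  exact ((contMDiffAt_of_mem_maximalAtlas (IsManifold.chart_mem_maximalAtlas p) h2).comp z
    h1).contDiffAt

lemma pullMatrix_eq_metricMatrix (g : Tensor2 n N) {Ψ : Rn k → N} {y : Rn k} (h : SmoothNear n Ψ y)
    {p : N} (hp : Ψ y ∈ (chartAt (Rn n) p).source) :
    ∀ᶠ z in 𝓝 y, pullMatrix g Ψ z = (jac (fun z ↦ chartAt (Rn n) p (Ψ z)) z).transpose *
      metricMatrix g (chartAt (Rn n) p) (chartAt (Rn n) p (Ψ z)) *
        jac (fun z ↦ chartAt (Rn n) p (Ψ z)) z := by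
  filter_upwards [pullMatrix_congr g (h.eventually_chart hp), (h.cInf_chart hp).eventually,
    h.continuousAt.eventually ((chartAt (Rn n) p).open_source.mem_nhds hp)] with z h1 h2 h3
  rw [h1]
  exact pullMatrix_comp g h2 (smoothNear_chartAt_symm p ((chartAt (Rn n) p).map_source h3))

lemma push_chartAt_symm_bijective (p : N) {y : Rn n} (hy : y ∈ (chartAt (Rn n) p).target) :
    Function.Bijective (push (n := n) (chartAt (Rn n) p).symm y) :=
  ((mdifferentiable_chart (I := 𝓡 n) p).symm).mfderiv_bijective hy

/-! ### Smoothness of tensor fields in components -/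

/-- The trivialization of the tangent bundle at `p` is the differential of the preferred chart
there, so the bundle's coordinate expression of a tensor is its component matrix. This links smooth
sections to smooth components. -/
lemma inCoordinates_tensor (h : Tensor2 n N) (p : N) {x : N}
    (hx : x ∈ (chartAt (Rn n) p).source) (u w : Rn n) :
    ContinuousLinearMap.inCoordinates (Rn n) (TangentSpace (𝓡 n) (M := N)) (Rn n →L[ℝ] ℝ)
      (fun x : N ↦ TangentSpace (𝓡 n) x →L[ℝ] ℝ) p x p x (h x) u w
      = form (metricMatrix h (chartAt (Rn n) p) (chartAt (Rn n) p x)) u w := by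
  have hx' : x ∈ (trivializationAt (Rn n) (TangentSpace (𝓡 n) (M := N)) p).baseSet := hx
  have hs : ∀ v : Rn n, (trivializationAt (Rn n) (TangentSpace (𝓡 n)) p).symm x v
      = (push (n := n) (chartAt (Rn n) p).symm (chartAt (Rn n) p x) v : Rn n) := by
    intro v
    have := TangentBundle.symmL_trivializationAt (I := 𝓡 n) (x₀ := p) (x := x) hx
    have h2 := congrArg (fun L : Rn n →L[ℝ] Rn n ↦ L v) this
    simp only [mfld_simps] at h2
    exact (Trivialization.symmL_apply _ hx' _).symm.trans h2
  rw [inCoordinates_apply_eq₂ hx' hx' (Set.mem_univ _), hs, hs, metricMatrix_eq_pullMatrix,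
    form_pullMatrix]
  simp only [Trivial.fiberBundle_trivializationAt', Trivial.linearMapAt_trivialization,
    LinearMap.id_coe, id_eq]
  exact tensor_congr h ((chartAt (Rn n) p).left_inv hx).symm _ _

/-- A tensor field that is smooth as a section of the bundle of bilinear forms. -/
def IsSmoothTensor (h : Tensor2 n N) : Prop :=
  ContMDiff (𝓡 n) ((𝓡 n).prod 𝓘(ℝ, Rn n →L[ℝ] Rn n →L[ℝ] ℝ)) ∞
    (fun x ↦ TotalSpace.mk' (Rn n →L[ℝ] Rn n →L[ℝ] ℝ)
      (E := fun x : N ↦ TangentSpace (𝓡 n) x →L[ℝ] TangentSpace (𝓡 n) x →L[ℝ] ℝ) x (h x))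

set_option synthInstance.maxHeartbeats 400000 in
set_option maxHeartbeats 1000000 in
lemma IsSmoothTensor.msm {h : Tensor2 n N} (hs : IsSmoothTensor h) (p : N) {y : Rn n}
    (hy : y ∈ (chartAt (Rn n) p).target) : MSm (metricMatrix h (chartAt (Rn n) p)) y := by
  intro a b
  filter_upwards [(chartAt (Rn n) p).open_target.mem_nhds hy] with z hz
  have hz' := (chartAt (Rn n) p).map_target hz
  have h1 := ((Trivialization.contMDiffAt_iff (e := trivializationAt (Rn n →L[ℝ] Rn n →L[ℝ] ℝ)
    (fun x : N ↦ TangentSpace (𝓡 n) x →L[ℝ] TangentSpace (𝓡 n) x →L[ℝ] ℝ) p)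
    (by simpa using hz')).1 (hs ((chartAt (Rn n) p).symm z))).2
  have h2 := h1.comp z (smoothNear_chartAt_symm p hz).self_of_nhds
  have h3 := h2.contDiffAt
  have h4 := (h3.clm_apply (contDiffAt_const (c := EuclideanSpace.single a (1 : ℝ)))).clm_apply
    (contDiffAt_const (c := EuclideanSpace.single b (1 : ℝ)))
  refine h4.congr_of_eventuallyEq ?_
  filter_upwards [(chartAt (Rn n) p).open_target.mem_nhds hz] with w hw
  have h5 := inCoordinates_tensor h p ((chartAt (Rn n) p).map_target hw)
    (EuclideanSpace.single a 1) (EuclideanSpace.single b 1)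
  rw [form_single, (chartAt (Rn n) p).right_inv hw] at h5
  exact h5.symm

-- In the trivialization the tensor is the sum of its components times the constant forms `dx^a ⊗
-- dx^b`, hence smooth as soon as the components are.
set_option synthInstance.maxHeartbeats 400000 in
set_option maxHeartbeats 1000000 in
lemma isSmoothTensor_of_msm {h : Tensor2 n N}
    (H : ∀ p, MSm (metricMatrix h (chartAt (Rn n) p)) (chartAt (Rn n) p p)) :
    IsSmoothTensor h := by
  intro p
  refine (contMDiffAt_hom_bundle _).2 ⟨contMDiffAt_id, ?_⟩
  have h1 := (H p).contDiffAt_sum_smul fun a b ↦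
    (EuclideanSpace.proj a : Rn n →L[ℝ] ℝ).smulRight (EuclideanSpace.proj b : Rn n →L[ℝ] ℝ)
  have h2 := h1.contMDiffAt.comp p (contMDiffAt_of_mem_maximalAtlas
    (IsManifold.chart_mem_maximalAtlas (I := 𝓡 n) (n := ∞) p) (mem_chart_source (Rn n) p))
  refine h2.congr_of_eventuallyEq ?_
  filter_upwards [(chartAt (Rn n) p).open_source.mem_nhds (mem_chart_source (Rn n) p)] with x hx
  refine ContinuousLinearMap.ext fun u ↦ ContinuousLinearMap.ext fun w ↦ ?_
  refine (inCoordinates_tensor h p hx u w).trans ?_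
  simp only [form, Function.comp_apply, sum_apply, smul_apply,
    ContinuousLinearMap.smulRight_apply, smul_eq_mul, mul_assoc]
  rfl

end Parametrizations

/-! ### Computing the tensors in an arbitrary local parametrization. -/

section ParametrizedTensors

variable {n : ℕ} {N : Type*} [TopologicalSpace N] [ChartedSpace (Rn n) N]

/-- A smooth nondegenerate symmetric tensor field. -/
structure IsMetric [IsManifold (𝓡 n) ∞ N] (g : Tensor2 n N) : Prop where
  symm : ∀ (x : N) (v w : TangentSpace (𝓡 n) x), g x v w = g x w v
  nondegenerate : ∀ (x : N) (v : TangentSpace (𝓡 n) x), (∀ w, g x w v = 0) → v = 0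
  smooth : IsSmoothTensor g

lemma IsLorentzMetric.isMetric [IsManifold (𝓡 n) ∞ N] {g : Tensor2 n N}
    (hg : IsLorentzMetric g) : IsMetric g where
  symm := hg.symm
  nondegenerate x v hv := by
    obtain ⟨t, -, ht⟩ := hg.signature x
    by_contra h0
    exact (ht v (hv t) h0).ne' (hv v)
  smooth := hg.smooth

/-- `Ψ` is a local parametrization of a manifold near the image of `y`. -/
structure IsParam (n : ℕ) {N : Type*} [TopologicalSpace N] [ChartedSpace (Rn n) N]
    (Ψ : Rn n → N) (y : Rn n) : Prop where
  smooth : SmoothNear n Ψ y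
  bijective : Function.Bijective (push (n := n) Ψ y)

lemma surjective_push_of_injective {Ψ : Rn n → N} {y : Rn n}
    (h : Function.Injective (push (n := n) Ψ y)) : Function.Surjective (push (n := n) Ψ y) := by
  let D : Rn n →L[ℝ] Rn n := mfderiv (𝓡 n) (𝓡 n) Ψ y
  exact (LinearMap.injective_iff_surjective (f := (D : Rn n →ₗ[ℝ] Rn n))).1 h

lemma SmoothNear.eventually_comp_chart {k : ℕ} {Ψ : Rn k → N} {y : Rn k} (h : SmoothNear n Ψ y)
    {p : N} (hp : Ψ y ∈ (chartAt (Rn n) p).source) (f : N → ℝ) :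
    (fun z ↦ f (Ψ z)) =ᶠ[𝓝 y] fun z ↦ f ((chartAt (Rn n) p).symm (chartAt (Rn n) p (Ψ z))) := by
  filter_upwards [h.eventually_chart hp] with z hz
  exact congrArg f hz

lemma dif_mul_dif_push {f f' : N → ℝ} {Ψ : Rn n → N} {y : Rn n} (h : IsParam n Ψ y) (hf : IsSmoothScalar (n := n) f)
    (hf' : IsSmoothScalar (n := n) f') (u w : Rn n) :
    dif f (Ψ y) (push (n := n) Ψ y u) * dif f' (Ψ y) (push (n := n) Ψ y w)
      = form (grd (fun z ↦ f (Ψ z)) (fun z ↦ f' (Ψ z)) y) u w := by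
  rw [form_grd, dif_push (hf.mdifferentiableAt _) h.smooth, dif_push (hf'.mdifferentiableAt _)
    h.smooth]

variable [IsManifold (𝓡 n) ∞ N] {g : Tensor2 n N} {Ψ : Rn n → N} {y : Rn n}

lemma isParam_chartAt_symm (p : N) {y : Rn n} (hy : y ∈ (chartAt (Rn n) p).target) :
    IsParam n (chartAt (Rn n) p).symm y :=
  ⟨smoothNear_chartAt_symm p hy, push_chartAt_symm_bijective p hy⟩

lemma IsMetric.metricAt (hg : IsMetric g) (p : N) {y : Rn n}
    (hy : y ∈ (chartAt (Rn n) p).target) : MetricAt (metricMatrix g (chartAt (Rn n) p)) y where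
  smooth := hg.smooth.msm p hy
  symm := Filter.Eventually.of_forall fun z ↦ by
    ext i j; exact hg.symm _ _ _
  det := by
    intro h0
    obtain ⟨v, hv, h⟩ := Matrix.exists_mulVec_eq_zero_iff.2 h0
    have hb := push_chartAt_symm_bijective p hy
    have h1 : push (n := n) (chartAt (Rn n) p).symm y (WithLp.toLp 2 v) = 0 := by
      refine hg.nondegenerate _ _ fun w ↦ ?_
      obtain ⟨u, rfl⟩ := hb.2 w
      rw [← form_pullMatrix, ← metricMatrix_eq_pullMatrix, form_eq_dotProduct, h, dotProduct_zero]
    have h2 : push (n := n) (chartAt (Rn n) p).symm y 0 = 0 := map_zero _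
    exact hv (congrArg WithLp.ofLp (hb.1 (h1.trans h2.symm)))

lemma push_eq_push_chart {k : ℕ} {Ψ : Rn k → N} {y : Rn k} (h : SmoothNear n Ψ y) {p : N}
    (hp : Ψ y ∈ (chartAt (Rn n) p).source) (u : Rn k) :
    (push (n := n) Ψ y u : Rn n) = (push (n := n) (chartAt (Rn n) p).symm (chartAt (Rn n) p (Ψ y))
      (fderiv ℝ (fun z ↦ chartAt (Rn n) p (Ψ z)) y u) : Rn n) :=
  (push_congr (h.eventually_chart hp) u).trans (push_comp (h.cInf_chart hp)
    (smoothNear_chartAt_symm p ((chartAt (Rn n) p).map_source hp)) u)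

lemma IsParam.det_jac_chart (h : IsParam n Ψ y) {p : N} (hp : Ψ y ∈ (chartAt (Rn n) p).source) :
    (jac (fun z ↦ chartAt (Rn n) p (Ψ z)) y).det ≠ 0 := by
  intro h0
  obtain ⟨v, hv, h1⟩ := Matrix.exists_mulVec_eq_zero_iff.2 h0
  have h2 : fderiv ℝ (fun z ↦ chartAt (Rn n) p (Ψ z)) y (WithLp.toLp 2 v) = 0 :=
    WithLp.ofLp_injective 2
      ((ofLp_fderiv (h.smooth.cInf_chart hp).differentiableAt (WithLp.toLp 2 v)).trans h1)
  have h3 := push_eq_push_chart h.smooth hp (WithLp.toLp 2 v)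
  rw [h2] at h3
  have h4 : (push (n := n) (chartAt (Rn n) p).symm (chartAt (Rn n) p (Ψ y)) 0 : Rn n) = 0 :=
    map_zero (mfderiv (𝓡 n) (𝓡 n) (chartAt (Rn n) p).symm (chartAt (Rn n) p (Ψ y)))
  have h5 : (push (n := n) Ψ y 0 : Rn n) = 0 := map_zero (mfderiv (𝓡 n) (𝓡 n) Ψ y)
  exact hv (congrArg WithLp.ofLp (h.bijective.1 (h3.trans (h4.trans h5.symm))))

/-- Nonvanishing of a Jacobian determinant is an open condition, so this criterion shows that
parametrizations remain parametrizations at nearby points. -/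
lemma isParam_of_det_jac_chart (h : SmoothNear n Ψ y) {p : N}
    (hp : Ψ y ∈ (chartAt (Rn n) p).source)
    (hd : (jac (fun z ↦ chartAt (Rn n) p (Ψ z)) y).det ≠ 0) : IsParam n Ψ y := by
  refine ⟨h, ?_⟩
  have h1 : Function.Injective (push (n := n) Ψ y) := by
    intro u w huw
    have h2 : (push (n := n) Ψ y u : Rn n) = (push (n := n) Ψ y w : Rn n) := huw
    rw [push_eq_push_chart h hp, push_eq_push_chart h hp] at h2
    have h3 := (push_chartAt_symm_bijective p ((chartAt (Rn n) p).map_source hp)).1 h2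
    have h4 := congrArg WithLp.ofLp h3
    rw [ofLp_fderiv (h.cInf_chart hp).differentiableAt,
      ofLp_fderiv (h.cInf_chart hp).differentiableAt] at h4
    exact WithLp.ofLp_injective 2
      (Matrix.mulVec_injective_of_isUnit ((Matrix.isUnit_iff_isUnit_det _).2
        (isUnit_iff_ne_zero.2 hd)) h4)
  exact ⟨h1, surjective_push_of_injective h1⟩

lemma IsParam.eventually (h : IsParam n Ψ y) : ∀ᶠ z in 𝓝 y, IsParam n Ψ z := by
  have hp := mem_chart_source (Rn n) (Ψ y)
  filter_upwards [h.smooth.eventually,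
    h.smooth.continuousAt.eventually ((chartAt (Rn n) (Ψ y)).open_source.mem_nhds hp),
    (h.smooth.cInf_chart hp).jac.det.continuousAt.eventually_ne (h.det_jac_chart hp)]
    with z h1 h2 h3
  exact isParam_of_det_jac_chart h1 h2 h3

/-- A parametrization differs from the preferred chart by a local diffeomorphism of `ℝⁿ`, so all
transformation laws of `IsPull` become available on the manifold. -/
lemma IsMetric.isPull (hg : IsMetric g) (h : IsParam n Ψ y) {p : N}
    (hp : Ψ y ∈ (chartAt (Rn n) p).source) :
    IsPull (metricMatrix g (chartAt (Rn n) p)) (pullMatrix g Ψ)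
      (fun z ↦ chartAt (Rn n) p (Ψ z)) y where
  smooth := h.smooth.cInf_chart hp
  det := h.det_jac_chart hp
  metric := hg.metricAt p ((chartAt (Rn n) p).map_source hp)
  eq := pullMatrix_eq_metricMatrix g h.smooth hp

lemma IsMetric.metricAt_pullMatrix (hg : IsMetric g) (h : IsParam n Ψ y) :
    MetricAt (pullMatrix g Ψ) y :=
  (hg.isPull h (mem_chart_source (Rn n) (Ψ y))).metricAt

lemma coordComp_push (h : SmoothNear n Ψ y) {p : N} (hp : Ψ y ∈ (chartAt (Rn n) p).source)
    (u : Rn n) (i : Fin n) : coordComp (chartAt (Rn n) p) (Ψ y) (push Ψ y u) i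
      = fderiv ℝ (fun z ↦ chartAt (Rn n) p (Ψ z)) y u i := by
  have h1 := (contMDiffAt_of_mem_maximalAtlas
    (IsManifold.chart_mem_maximalAtlas (I := 𝓡 n) (n := ∞) p) hp).mdifferentiableAt (by simp)
  have h2 : MDifferentiableAt (𝓡 n) 𝓘(ℝ, ℝ) (fun x ↦ chartAt (Rn n) p x i) (Ψ y) :=
    ((EuclideanSpace.proj i : Rn n →L[ℝ] ℝ).differentiableAt.mdifferentiableAt).comp (Ψ y) h1
  refine (dif_push h2 h u).trans ?_
  have h3 := (((EuclideanSpace.proj i : Rn n →L[ℝ] ℝ).hasFDerivAt).comp y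
    (h.cInf_chart hp).differentiableAt.hasFDerivAt).fderiv
  exact congrArg (fun L : Rn n →L[ℝ] ℝ ↦ L u) h3

/-- Tensoriality: the Jacobian of the coordinate change in the law for `ric` is the one that
converts `u` and `w` into chart components. -/
lemma IsMetric.ricci_push (hg : IsMetric g) (h : IsParam n Ψ y) (u w : Rn n) :
    ricci g (Ψ y) (push Ψ y u) (push Ψ y w) = form (ric (pullMatrix g Ψ) y) u w := by
  have hp := mem_chart_source (Rn n) (Ψ y)
  rw [(hg.isPull h hp).ric_eq, ← form_fderiv (h.smooth.cInf_chart hp).differentiableAt]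
  simp only [ricci, coordComp_push h.smooth hp]
  rfl

lemma IsSmoothScalar.cInf_chart {f : N → ℝ} (hf : IsSmoothScalar (n := n) f) {p x : N}
    (hp : x ∈ (chartAt (Rn n) p).source) :
    CInf (fun z ↦ f ((chartAt (Rn n) p).symm z)) (chartAt (Rn n) p x) :=
  (smoothNear_chartAt_symm p ((chartAt (Rn n) p).map_source hp)).cInf_comp hf

variable {f f' : N → ℝ}

lemma IsMetric.hes_pull (hg : IsMetric g) (h : IsParam n Ψ y) (hf : IsSmoothScalar (n := n) f)
    {p : N} (hp : Ψ y ∈ (chartAt (Rn n) p).source) :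
    hes (pullMatrix g Ψ) (fun z ↦ f (Ψ z)) y
      = (jac (fun z ↦ chartAt (Rn n) p (Ψ z)) y).transpose *
        hes (metricMatrix g (chartAt (Rn n) p)) (fun z ↦ f ((chartAt (Rn n) p).symm z))
          (chartAt (Rn n) p (Ψ y)) * jac (fun z ↦ chartAt (Rn n) p (Ψ z)) y := by
  rw [← (hg.isPull h hp).hes_eq (hf.cInf_chart hp)]
  exact hes_congr (Filter.EventuallyEq.refl _ _) (h.smooth.eventually_comp_chart hp f)

lemma IsMetric.hess_push (hg : IsMetric g) (h : IsParam n Ψ y) (hf : IsSmoothScalar (n := n) f)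
    (u w : Rn n) : hess g f (Ψ y) (push Ψ y u) (push Ψ y w)
      = form (hes (pullMatrix g Ψ) (fun z ↦ f (Ψ z)) y) u w := by
  have hp := mem_chart_source (Rn n) (Ψ y)
  rw [hg.hes_pull h hf hp, ← form_fderiv (h.smooth.cInf_chart hp).differentiableAt]
  simp only [hess, coordComp_push h.smooth hp]
  rfl

lemma IsMetric.box_eq (hg : IsMetric g) (h : IsParam n Ψ y) (hf : IsSmoothScalar (n := n) f) :
    box g f (Ψ y) = mtr (pullMatrix g Ψ y) (hes (pullMatrix g Ψ) (fun z ↦ f (Ψ z)) y) := by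
  have hp := mem_chart_source (Rn n) (Ψ y)
  rw [hg.hes_pull h hf hp, (hg.isPull h hp).mtr_eq]
  rfl

lemma IsMetric.gradProd_eq (hg : IsMetric g) (h : IsParam n Ψ y)
    (hf : IsSmoothScalar (n := n) f) (hf' : IsSmoothScalar (n := n) f') :
    gradProd g f f' (Ψ y)
      = mtr (pullMatrix g Ψ y) (grd (fun z ↦ f (Ψ z)) (fun z ↦ f' (Ψ z)) y) := by
  have hp := mem_chart_source (Rn n) (Ψ y)
  rw [grd_congr (h.smooth.eventually_comp_chart hp f) (h.smooth.eventually_comp_chart hp f'),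
    grd_comp (Ψ := fun z ↦ chartAt (Rn n) (Ψ y) (Ψ z)) (h.smooth.cInf_chart hp)
      (f := fun z ↦ f ((chartAt (Rn n) (Ψ y)).symm z)) (hf.cInf_chart hp)
      (g := fun z ↦ f' ((chartAt (Rn n) (Ψ y)).symm z)) (hf'.cInf_chart hp),
    (hg.isPull h hp).mtr_eq]
  simp only [gradProd, mtr, grd, Matrix.of_apply, ← mul_assoc]
  rfl

/-- An equation for the Ricci tensor, in terms of components. -/
lemma IsMetric.ricci_eq_iff (hg : IsMetric g) (h : IsParam n Ψ y)
    {F : TangentSpace (𝓡 n) (Ψ y) → TangentSpace (𝓡 n) (Ψ y) → ℝ} {S : Matrix (Fin n) (Fin n) ℝ}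
    (hF : ∀ u w, F (push Ψ y u) (push Ψ y w) = form S u w) :
    (∀ v w, ricci g (Ψ y) v w = F v w) ↔ ric (pullMatrix g Ψ) y = S := by
  constructor
  · intro H
    refine form_injective fun u w ↦ ?_
    rw [← hg.ricci_push h, H, hF]
  · intro H v w
    obtain ⟨u, rfl⟩ := h.bijective.2 v
    obtain ⟨u', rfl⟩ := h.bijective.2 w
    rw [hg.ricci_push h, H, hF]

lemma IsMetric.ricci_box_iff (hg : IsMetric g) (h : IsParam n Ψ y)
    (hf : IsSmoothScalar (n := n) f) (κ : ℝ) :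
    ((∀ v w, ricci g (Ψ y) v w = κ * (dif f (Ψ y) v * dif f (Ψ y) w)) ∧ box g f (Ψ y) = 0) ↔
      ric (pullMatrix g Ψ) y = κ • grd (fun z ↦ f (Ψ z)) (fun z ↦ f (Ψ z)) y ∧
        mtr (pullMatrix g Ψ y) (hes (pullMatrix g Ψ) (fun z ↦ f (Ψ z)) y) = 0 := by
  rw [hg.ricci_eq_iff h (S := κ • grd (fun z ↦ f (Ψ z)) (fun z ↦ f (Ψ z)) y), hg.box_eq h hf]
  intro u w
  rw [dif_mul_dif_push h hf hf, form_smul]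

lemma IsMetric.reduced_iff (hg : IsMetric g) (h : IsParam n Ψ y) {l : N → ℝ}
    (hl : IsSmoothScalar (n := n) l) (hf : IsSmoothScalar (n := n) f) (κ : ℝ) :
    ((∀ v w, ricci g (Ψ y) v w = (1 / 2) * (l (Ψ y))⁻¹ * hess g l (Ψ y) v w
        - (1 / 4) * (l (Ψ y))⁻¹ ^ 2 * (dif l (Ψ y) v * dif l (Ψ y) w)
        + κ * (dif f (Ψ y) v * dif f (Ψ y) w)) ∧
      box g f (Ψ y) = -((1 / 2) * (l (Ψ y))⁻¹ * gradProd g f l (Ψ y)) ∧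
      box g l (Ψ y) = (1 / 2) * (l (Ψ y))⁻¹ * gradProd g l l (Ψ y)) ↔
    ric (pullMatrix g Ψ) y
        = ((1 / 2) * (l (Ψ y))⁻¹) • hes (pullMatrix g Ψ) (fun z ↦ l (Ψ z)) y
          - ((1 / 4) * (l (Ψ y))⁻¹ ^ 2) • grd (fun z ↦ l (Ψ z)) (fun z ↦ l (Ψ z)) y
          + κ • grd (fun z ↦ f (Ψ z)) (fun z ↦ f (Ψ z)) y ∧
      mtr (pullMatrix g Ψ y) (hes (pullMatrix g Ψ) (fun z ↦ f (Ψ z)) y)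
        = -((1 / 2) * (l (Ψ y))⁻¹ *
          mtr (pullMatrix g Ψ y) (grd (fun z ↦ f (Ψ z)) (fun z ↦ l (Ψ z)) y)) ∧
      mtr (pullMatrix g Ψ y) (hes (pullMatrix g Ψ) (fun z ↦ l (Ψ z)) y)
        = (1 / 2) * (l (Ψ y))⁻¹ *
          mtr (pullMatrix g Ψ y) (grd (fun z ↦ l (Ψ z)) (fun z ↦ l (Ψ z)) y) := by
  rw [hg.box_eq h hf, hg.box_eq h hl, hg.gradProd_eq h hf hl, hg.gradProd_eq h hl hl]
  refine and_congr_left' (hg.ricci_eq_iff h fun u w ↦ ?_)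
  rw [dif_mul_dif_push h hf hf, dif_mul_dif_push h hl hl, hg.hess_push h hl, form_add, form_sub,
    form_smul, form_smul, form_smul]

lemma IsMetric.rescaled_iff (hg : IsMetric g) (h : IsParam n Ψ y) {l : N → ℝ}
    (hl : IsSmoothScalar (n := n) l) (hf : IsSmoothScalar (n := n) f) (κ : ℝ) :
    ((∀ v w, ricci g (Ψ y) v w = (1 / 2) * (dif l (Ψ y) v * dif l (Ψ y) w)
        + κ * (dif f (Ψ y) v * dif f (Ψ y) w)) ∧
      box g f (Ψ y) = 0 ∧ box g l (Ψ y) = 0) ↔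
    ric (pullMatrix g Ψ) y
        = (1 / 2 : ℝ) • grd (fun z ↦ l (Ψ z)) (fun z ↦ l (Ψ z)) y
          + κ • grd (fun z ↦ f (Ψ z)) (fun z ↦ f (Ψ z)) y ∧
      mtr (pullMatrix g Ψ y) (hes (pullMatrix g Ψ) (fun z ↦ f (Ψ z)) y) = 0 ∧
      mtr (pullMatrix g Ψ y) (hes (pullMatrix g Ψ) (fun z ↦ l (Ψ z)) y) = 0 := by
  rw [hg.box_eq h hf, hg.box_eq h hl]
  refine and_congr_left' (hg.ricci_eq_iff h fun u w ↦ ?_)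
  rw [dif_mul_dif_push h hf hf, dif_mul_dif_push h hl hl, form_add, form_smul, form_smul]

end ParametrizedTensors

/-! ### Coordinates adapted to a vector field. -/

section FlowBox

variable {n : ℕ} {N : Type*} [TopologicalSpace N]

/-- The inclusion of `ℝⁿ` as the hyperplane `x₀ = 0`. -/
def sec : Rn n →L[ℝ] Rn (n + 1) :=
  LinearMap.toContinuousLinearMap
    { toFun := fun y ↦ WithLp.toLp 2 (Fin.cons 0 y.ofLp)
      map_add' := fun _ _ ↦ by
        ext i; refine Fin.cases ?_ (fun j ↦ ?_) i <;> simp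
      map_smul' := fun _ _ ↦ by
        ext i; refine Fin.cases ?_ (fun j ↦ ?_) i <;> simp }

@[simp] lemma sec_zero_apply (x : Rn n) : sec x 0 = 0 := rfl

@[simp] lemma sec_succ_apply (x : Rn n) (i : Fin n) : sec x i.succ = x i := rfl

@[simp] lemma tl_sec (x : Rn n) : tl (sec x) = x := by
  ext i; simp

lemma sec_single (i : Fin n) (c : ℝ) :
    sec (EuclideanSpace.single i c) = EuclideanSpace.single i.succ c := by
  ext j; refine Fin.cases ?_ (fun k ↦ ?_) j <;> simp

lemma eq_smul_add_sec (w : Rn (n + 1)) :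
    w = w 0 • EuclideanSpace.single 0 (1 : ℝ) + sec (tl w) := by
  ext j; refine Fin.cases ?_ (fun k ↦ ?_) j <;> simp

/-- The components of a vector field in a preferred chart. -/
def chartField [ChartedSpace (Rn n) N] (p : N) (ξ : VField n N) (z : Rn n) : Rn n :=
  mfderiv (𝓡 n) (𝓡 n) (chartAt (Rn n) p) ((chartAt (Rn n) p).symm z)
    (ξ ((chartAt (Rn n) p).symm z))

lemma push_chartField [ChartedSpace (Rn n) N] [IsManifold (𝓡 n) ∞ N] (ξ : VField n N) (p : N)
    {z : Rn n} (hz : z ∈ (chartAt (Rn n) p).target) :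
    push (n := n) (chartAt (Rn n) p).symm z (chartField p ξ z)
      = ξ ((chartAt (Rn n) p).symm z) := by
  have h1 := (mdifferentiable_chart (I := 𝓡 n) p).symm_comp_deriv
    ((chartAt (Rn n) p).map_target hz)
  have h2 := congrArg (fun L : Rn n →L[ℝ] Rn n ↦ L (ξ ((chartAt (Rn n) p).symm z))) h1
  rw [(chartAt (Rn n) p).right_inv hz] at h2
  exact h2

lemma cInf_chartField [ChartedSpace (Rn n) N] [IsManifold (𝓡 n) ∞ N] {ξ : VField n N}
    (hξ : IsSmoothVField ξ) (p : N) {y : Rn n} (hy : y ∈ (chartAt (Rn n) p).target) :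
    CInf (chartField p ξ) y := by
  filter_upwards [(chartAt (Rn n) p).open_target.mem_nhds hy] with z hz
  have hz' := (chartAt (Rn n) p).map_target hz
  have h1 := ((Trivialization.contMDiffAt_iff
    (e := trivializationAt (Rn n) (TangentSpace (𝓡 n) (M := N)) p)
    (by simpa using hz')).1 (hξ ((chartAt (Rn n) p).symm z))).2
  have h2 := (h1.comp z (smoothNear_chartAt_symm p hz).self_of_nhds).contDiffAt
  refine h2.congr_of_eventuallyEq ?_
  filter_upwards [(chartAt (Rn n) p).open_target.mem_nhds hz] with w hw
  have hw' := (chartAt (Rn n) p).map_target hw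
  have h3 := TangentBundle.continuousLinearMapAt_trivializationAt (I := 𝓡 n) (x₀ := p) hw'
  have h4 := congrArg (fun L : Rn n →L[ℝ] Rn n ↦ L (ξ ((chartAt (Rn n) p).symm w))) h3
  simp only [mfld_simps] at h4
  refine h4.symm.trans ?_
  exact Trivialization.continuousLinearMapAt_apply_of_mem ℝ
    (trivializationAt (Rn n) (TangentSpace (𝓡 n)) p) (show (chartAt (Rn n) p).symm w ∈ (trivializationAt (Rn n) (TangentSpace (𝓡 n)) p).baseSet
      from hw') _

lemma vField_congr [ChartedSpace (Rn n) N] (ξ : VField n N) {x x' : N} (h : x = x') :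
    (ξ x : Rn n) = (ξ x' : Rn n) := by
  subst h; rfl

lemma push_add {k : ℕ} [ChartedSpace (Rn n) N] (Ψ : Rn k → N) (z u w : Rn k) :
    push (n := n) Ψ z (u + w) = push Ψ z u + push Ψ z w :=
  map_add (mfderiv (𝓡 k) (𝓡 n) Ψ z) u w

lemma push_smul {k : ℕ} [ChartedSpace (Rn n) N] (Ψ : Rn k → N) (z : Rn k) (c : ℝ) (u : Rn k) :
    push (n := n) Ψ z (c • u) = c • push Ψ z u :=
  map_smul (mfderiv (𝓡 k) (𝓡 n) Ψ z) c u

variable [ChartedSpace (Rn (n + 1)) N] [IsManifold (𝓡 (n + 1)) ∞ N]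

/-- A parametrization `Ψ` near `y` is adapted to a vector field if it maps `∂₀` to it. -/
structure IsAdapted (ξ : VField (n + 1) N) (Ψ : Rn (n + 1) → N) (y : Rn (n + 1)) : Prop where
  isParam : IsParam (n + 1) Ψ y
  push_eq : ∀ᶠ z in 𝓝 y, push Ψ z (EuclideanSpace.single 0 1) = ξ (Ψ z)

lemma IsAdapted.eventually {ξ : VField (n + 1) N} {Ψ : Rn (n + 1) → N} {y : Rn (n + 1)}
    (h : IsAdapted ξ Ψ y) : ∀ᶠ z in 𝓝 y, IsAdapted ξ Ψ z := by
  filter_upwards [h.isParam.eventually, h.push_eq.eventually_nhds] with z h1 h2 using ⟨h1, h2⟩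

/-- A flow box for a vector field, built on a transverse hypersurface. -/
theorem exists_flowBox {ξ : VField (n + 1) N} (hξ : IsSmoothVField ξ) {σ : Rn n → N} {y : Rn n}
    (hσ : SmoothNear (n + 1) σ y)
    (htr : ∀ (c : ℝ) (u : Rn n), c • ξ (σ y) + push σ y u = 0 → c = 0 ∧ u = 0) :
    ∃ Ψ : Rn (n + 1) → N, IsAdapted ξ Ψ (sec y) ∧ ∀ᶠ x in 𝓝 y, Ψ (sec x) = σ x := by
  have hp := mem_chart_source (Rn (n + 1)) (σ y)
  set e := chartAt (Rn (n + 1)) (σ y) with he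
  have hs := hσ.cInf_chart hp
  have hx0 : e (σ y) ∈ e.target := e.map_source hp
  obtain ⟨Φ, hΦ, hΦ0, hΦv⟩ := exists_smooth_flow (cInf_chartField hξ (σ y) hx0)
  -- In the chart, the point with coordinates `(t, x)` is obtained by flowing `σ x` for time `t`.
  let β : Rn (n + 1) → ℝ × Rn (n + 1) := fun w ↦ (w 0, e (σ (tl w)))
  let τ : Rn (n + 1) → Rn (n + 1) := fun w ↦ Φ (β w)
  have hβy : β (sec y) = (0, e (σ y)) := by simp [β]
  have hβ : CInf β (sec y) := by
    have h1 : CInf (fun w : Rn (n + 1) ↦ e (σ (tl w))) (sec y) :=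
      CInf.comp (g := fun x ↦ e (σ x)) (by rw [tl_sec]; exact hs) cInf_tl
    filter_upwards [h1] with z hz
    exact (EuclideanSpace.proj (0 : Fin (n + 1)) : Rn (n + 1) →L[ℝ] ℝ).contDiff.contDiffAt.prodMk hz
  have hτ : CInf τ (sec y) := CInf.comp (by rw [hβy]; exact hΦ) hβ
  have hτsec : ∀ᶠ x in 𝓝 y, τ (sec x) = e (σ x) := by
    filter_upwards [hs.continuousAt.eventually hΦ0] with x hx
    simpa [τ, β] using hx
  have hτy : τ (sec y) = e (σ y) := hτsec.self_of_nhds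
  have hτt : ∀ᶠ w in 𝓝 (sec y), τ w ∈ e.target :=
    hτ.continuousAt.eventually (e.open_target.mem_nhds (by rw [hτy]; exact hx0))
  have hτd : ∀ᶠ w in 𝓝 (sec y),
      fderiv ℝ τ w (EuclideanSpace.single 0 1) = chartField (σ y) ξ (τ w) := by
    have h1 := hβ.continuousAt
    rw [ContinuousAt, hβy] at h1
    filter_upwards [h1.eventually hΦv, hτ] with w h2 h3
    have h4 : HasDerivAt (fun t : ℝ ↦ w + t • EuclideanSpace.single (0 : Fin (n + 1)) (1 : ℝ))
        (EuclideanSpace.single 0 1) 0 := by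
      simpa using ((hasDerivAt_id (0 : ℝ)).smul_const
        (EuclideanSpace.single (0 : Fin (n + 1)) (1 : ℝ))).const_add w
    have h5 := (h3.differentiableAt (by simp)).hasFDerivAt.comp_hasDerivAt_of_eq (0 : ℝ) h4
      (by simp)
    have h6 : HasDerivAt (fun t : ℝ ↦ Φ (w 0 + t, e (σ (tl w)))) (chartField (σ y) ξ (τ w)) 0 := by
      refine HasDerivAt.comp_const_add (f := fun t ↦ Φ (t, e (σ (tl w)))) (w 0) 0 ?_
      rw [add_zero]
      exact h2
    refine h5.unique (h6.congr_of_eventuallyEq (Filter.Eventually.of_forall fun t ↦ ?_))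
    simp [τ, β, tl_single_zero, map_add, map_smul]
  have hΨs : SmoothNear (n + 1) (fun w ↦ e.symm (τ w)) (sec y) :=
    SmoothNear.comp hτ (smoothNear_chartAt_symm _ hτt.self_of_nhds)
  have hΨsec : ∀ᶠ x in 𝓝 y, e.symm (τ (sec x)) = σ x := by
    filter_upwards [hτsec, hσ.continuousAt.eventually (e.open_source.mem_nhds hp)] with x h1 h2
    rw [h1, e.left_inv h2]
  have hpush : ∀ᶠ z in 𝓝 (sec y), push (n := n + 1) (fun w ↦ e.symm (τ w)) z
      (EuclideanSpace.single 0 1) = ξ (e.symm (τ z)) := by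
    filter_upwards [hτd, hτt, hτ.eventually] with w h1 h2 h3
    rw [push_comp h3 (smoothNear_chartAt_symm _ h2), h1, push_chartField _ _ h2]
  refine ⟨fun w ↦ e.symm (τ w), ⟨⟨hΨs, ?_⟩, hpush⟩, hΨsec⟩
  let D : Rn (n + 1) →L[ℝ] Rn (n + 1) :=
    mfderiv (𝓡 (n + 1)) (𝓡 (n + 1)) (fun w ↦ e.symm (τ w)) (sec y)
  have hD0 : D (EuclideanSpace.single 0 1) = (ξ (σ y) : Rn (n + 1)) :=
    hpush.self_of_nhds.trans (vField_congr ξ hΨsec.self_of_nhds)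
  have hDs : ∀ u, D (sec u) = (push (n := n + 1) σ y u : Rn (n + 1)) := fun u ↦ by
    have h1 := push_comp (n := n + 1) (τ := (sec : Rn n → Rn (n + 1))) (y := y)
      (Ψ := fun w ↦ e.symm (τ w)) sec.contDiff.cInf hΨs u
    rw [sec.fderiv] at h1
    exact h1.symm.trans (push_congr hΨsec u)
  -- On the slice the differential sends `∂₀` to `ξ` and the remaining directions to the image of
  -- the differential of `σ`; transversality is exactly its injectivity.
  have hinj : Function.Injective D := by
    refine (injective_iff_map_eq_zero D).2 fun w hw ↦ ?_
    rw [eq_smul_add_sec w, map_add, map_smul, hD0, hDs] at hw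
    obtain ⟨h1, h2⟩ := htr _ _ hw
    rw [eq_smul_add_sec w, h1, h2]
    simp
  exact ⟨hinj, surjective_push_of_injective (Ψ := fun w ↦ e.symm (τ w)) hinj⟩

/-- A flow box around a point where the vector field does not vanish. -/
theorem exists_flowBox_of_ne_zero {ξ : VField (n + 1) N} (hξ : IsSmoothVField ξ) (p : N)
    (h0 : ξ p ≠ 0) :
    ∃ (Ψ : Rn (n + 1) → N) (x : Rn n), IsAdapted ξ Ψ (sec x) ∧ Ψ (sec x) = p := by
  have hp := mem_chart_source (Rn (n + 1)) p
  have hx0 := (chartAt (Rn (n + 1)) p).map_source hp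
  set x₀ := chartAt (Rn (n + 1)) p p
  have hpx : (chartAt (Rn (n + 1)) p).symm x₀ = p := (chartAt (Rn (n + 1)) p).left_inv hp
  let V : Rn (n + 1) := chartField p ξ x₀
  have hV : push (n := n + 1) (chartAt (Rn (n + 1)) p).symm x₀ V
      = ξ ((chartAt (Rn (n + 1)) p).symm x₀) := push_chartField ξ p hx0
  have hb := push_chartAt_symm_bijective p hx0
  have hz : push (n := n + 1) (chartAt (Rn (n + 1)) p).symm x₀ 0 = 0 := map_zero _
  have hV0 : V ≠ 0 := by
    intro h
    rw [h, hz] at hV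
    exact h0 ((vField_congr ξ hpx).symm.trans hV.symm)
  -- Any linear complement of the field direction in the chart gives an affine slice transverse to
  -- the field.
  obtain ⟨W, hW⟩ := Submodule.exists_isCompl (ℝ ∙ V)
  have hdim : Module.finrank ℝ W = n := by
    have := Submodule.finrank_add_eq_of_isCompl hW
    rw [finrank_span_singleton hV0, finrank_euclideanSpace_fin] at this
    omega
  let b : Rn n ≃L[ℝ] W := ContinuousLinearEquiv.ofFinrankEq (by simp [hdim])
  let L : Rn n →L[ℝ] Rn (n + 1) := W.subtypeL.comp (b : Rn n →L[ℝ] W)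
  let τ : Rn n → Rn (n + 1) := fun u ↦ x₀ + L u
  have hτ : CInf τ 0 := (contDiff_const.add L.contDiff).cInf
  have hτ0 : τ 0 = x₀ := by simp [τ]
  have hτd : ∀ u, fderiv ℝ τ 0 u = L u := fun u ↦ by
    rw [(L.hasFDerivAt.const_add x₀ : HasFDerivAt τ L 0).fderiv]
  have hsm : SmoothNear (n + 1) (chartAt (Rn (n + 1)) p).symm (τ 0) := by
    rw [hτ0]; exact smoothNear_chartAt_symm p hx0
  obtain ⟨Ψ, h1, h2⟩ := exists_flowBox hξ (σ := fun u ↦ (chartAt (Rn (n + 1)) p).symm (τ u))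
    (y := 0) (SmoothNear.comp hτ hsm) (by
      intro c u hcu
      rw [push_comp hτ hsm, hτd] at hcu
      have h3 : push (n := n + 1) (chartAt (Rn (n + 1)) p).symm x₀ (c • V + L u) = 0 := by
        have h4 : push (n := n + 1) (chartAt (Rn (n + 1)) p).symm x₀ (c • V + L u)
            = c • push (n := n + 1) (chartAt (Rn (n + 1)) p).symm x₀ V
              + push (n := n + 1) (chartAt (Rn (n + 1)) p).symm x₀ (L u) := by
          rw [push_add, push_smul]
        rw [h4, hV]
        rw [hτ0] at hcu
        exact hcu
      have h5 : c • V + L u = 0 := hb.1 (h3.trans hz.symm)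
      have h6 : c • V ∈ W := by
        rw [eq_neg_of_add_eq_zero_left h5]
        exact W.neg_mem (b u).2
      have h7 : c • V = 0 := (Submodule.disjoint_def.1 hW.disjoint) _
        (Submodule.smul_mem _ _ (Submodule.mem_span_singleton_self V)) h6
      refine ⟨(smul_eq_zero.1 h7).resolve_right hV0, ?_⟩
      rw [h7, zero_add] at h5
      have h8 : b u = 0 := Subtype.ext h5
      simpa using h8)
  refine ⟨Ψ, 0, h1, h2.self_of_nhds.trans ?_⟩
  rw [hτ0, hpx]

end FlowBox

/-! ### Killing fields in adapted coordinates. -/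

section Killing

lemma mlieBracket_const {n : ℕ} (u v x : Rn n) :
    VectorField.mlieBracket (𝓡 n) (fun _ : Rn n ↦ u) (fun _ : Rn n ↦ v) x = 0 := by
  have h : VectorField.lieBracketWithin ℝ (fun _ : Rn n ↦ u) (fun _ : Rn n ↦ v) Set.univ x = 0 := by
    simp [VectorField.lieBracketWithin]
  exact (congrFun VectorField.mlieBracketWithin_univ x).symm.trans
    ((congrFun (VectorField.mlieBracketWithin_eq_lieBracketWithin (V := fun _ ↦ u)
      (W := fun _ ↦ v)) x).trans h)

variable {n : ℕ} {N : Type*} [TopologicalSpace N] [ChartedSpace (Rn n) N]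
  [IsManifold (𝓡 n) ∞ N]

/-- A local parametrization has a smooth local inverse. -/
lemma IsParam.exists_inverse {Ψ : Rn n → N} {y : Rn n} (h : IsParam n Ψ y) :
    ∃ F : N → Rn n, ∀ᶠ z in 𝓝 y, ContMDiffAt (𝓡 n) (𝓡 n) ∞ F (Ψ z) ∧ F (Ψ z) = z ∧
      ∀ᶠ x in 𝓝 (Ψ z), Ψ (F x) = x := by
  have hp := mem_chart_source (Rn n) (Ψ y)
  set e := chartAt (Rn n) (Ψ y)
  have hτ := h.smooth.cInf_chart hp
  have hd := h.det_jac_chart hp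
  set τ : Rn n → Rn n := fun z ↦ e (Ψ z) with hτdef
  have hinj : Function.Injective (fderiv ℝ τ y) := fun u w huw ↦
    WithLp.ofLp_injective 2 (Matrix.mulVec_injective_of_isUnit
      ((Matrix.isUnit_iff_isUnit_det _).2 (isUnit_iff_ne_zero.2 hd)) (by
        rw [← ofLp_fderiv hτ.differentiableAt, ← ofLp_fderiv hτ.differentiableAt]
        exact congrArg WithLp.ofLp huw))
  let H' : Rn n ≃L[ℝ] Rn n := (LinearEquiv.ofInjectiveEndo
    ((fderiv ℝ τ y : Rn n →L[ℝ] Rn n) : Rn n →ₗ[ℝ] Rn n) hinj).toContinuousLinearEquiv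
  have hH : HasFDerivAt τ (H' : Rn n →L[ℝ] Rn n) y := by
    have : (H' : Rn n →L[ℝ] Rn n) = fderiv ℝ τ y := by ext u; rfl
    rw [this]; exact hτ.differentiableAt.hasFDerivAt
  obtain ⟨E, hE, hyE, -, hEs⟩ := hτ.exists_openPartialHomeomorph hH
  refine ⟨fun x ↦ E.symm (e x), ?_⟩
  filter_upwards [E.open_source.mem_nhds hyE,
    h.smooth.mono fun _ hz ↦ hz.continuousAt, h.smooth.continuousAt.eventually (e.open_source.mem_nhds hp)]
    with z hzE hzc hze
  have hEz : E z = e (Ψ z) := congrFun hE z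
  have hmem : e (Ψ z) ∈ E.target := hEz ▸ E.map_source hzE
  have hFz : E.symm (e (Ψ z)) = z := by rw [← hEz]; exact E.left_inv hzE
  have hec : ContMDiffAt (𝓡 n) (𝓡 n) ∞ e (Ψ z) :=
    contMDiffAt_of_mem_maximalAtlas (IsManifold.chart_mem_maximalAtlas (Ψ y)) hze
  have hFc : ContMDiffAt (𝓡 n) (𝓡 n) ∞ (fun x ↦ E.symm (e x)) (Ψ z) :=
    ContMDiffAt.comp (Ψ z) ((hEs.contDiffAt (E.open_target.mem_nhds hmem)).contMDiffAt) hec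
  refine ⟨hFc, hFz, ?_⟩
  have h1 : ∀ᶠ x in 𝓝 (Ψ z), Ψ (E.symm (e x)) ∈ e.source := by
    have h2 : ContinuousAt (fun x ↦ Ψ (E.symm (e x))) (Ψ z) :=
      ContinuousAt.comp (g := Ψ) (by rw [hFz]; exact hzc) hFc.continuousAt
    exact h2.eventually (e.open_source.mem_nhds (by
      change Ψ (E.symm (e (Ψ z))) ∈ e.source
      rw [hFz]; exact hze))
  filter_upwards [h1, e.open_source.mem_nhds hze,
    hec.continuousAt.eventually (E.open_target.mem_nhds hmem)] with x h2 h3 h4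
  refine e.injOn h2 h3 ?_
  have h5 := E.right_inv h4
  rwa [hE] at h5

/-- In an adapted parametrization, the components of the metric are constant along a Killing
field. -/
lemma IsKilling.pd_pullMatrix {g : Tensor2 n N} {ξ : VField n N} (hξ : IsKilling g ξ)
    (hg : IsMetric g) {Ψ : Rn n → N} {y : Rn n} (h : IsParam n Ψ y) (k : Fin n)
    (hk : ∀ᶠ z in 𝓝 y, push Ψ z (EuclideanSpace.single k 1) = ξ (Ψ z)) (i j : Fin n) :
    ∀ᶠ z in 𝓝 y, pd k (fun w ↦ pullMatrix g Ψ w i j) z = 0 := by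
  have h12 : (1 : WithTop ℕ∞) ≤ ∞ := by exact_mod_cast le_top
  have h22 : (2 : WithTop ℕ∞) ≤ ∞ :=
    show ((2 : ℕ∞) : WithTop ℕ∞) ≤ ((⊤ : ℕ∞) : WithTop ℕ∞) from WithTop.coe_le_coe.2 le_top
  have : IsManifold (𝓡 n) (minSmoothness ℝ 2) N := by
    rw [minSmoothness_of_isRCLikeNormedField]; exact IsManifold.of_le (n := ∞) h22
  obtain ⟨F, hF⟩ := h.exists_inverse
  -- The coordinate fields of `Ψ`, obtained on the manifold by pulling constant fields back along
  -- the local inverse `F`.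
  let X : Fin n → VField n N := fun a ↦
    VectorField.mpullback (𝓡 n) (𝓡 n) F (fun _ ↦ (EuclideanSpace.single a (1 : ℝ) : Rn n))
  filter_upwards [hF.eventually_nhds, hk.eventually_nhds, h.eventually.eventually_nhds]
    with z h1 h2 h3
  obtain ⟨hFc, hFz, hΨF⟩ := h1.self_of_nhds
  have hFcont : Filter.Tendsto F (𝓝 (Ψ z)) (𝓝 z) := by
    have := hFc.continuousAt; rwa [ContinuousAt, hFz] at this
  have hinv : ∀ w, IsParam n Ψ w → (∀ᶠ w' in 𝓝 w, F (Ψ w') = w') →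
      ContMDiffAt (𝓡 n) (𝓡 n) ∞ F (Ψ w) → (∀ᶠ x in 𝓝 (Ψ w), Ψ (F x) = x) →
      (mfderiv (𝓡 n) (𝓡 n) F (Ψ w)).IsInvertible ∧
      ∀ a, X a (Ψ w) = push Ψ w (EuclideanSpace.single a 1) := by
    intro w hw hw1 hw2 hw3
    let A : Rn n →L[ℝ] Rn n := mfderiv (𝓡 n) (𝓡 n) F (Ψ w)
    let B : Rn n →L[ℝ] Rn n := mfderiv (𝓡 n) (𝓡 n) Ψ w
    have hAB : A ∘L B = .id ℝ (Rn n) := by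
      have h4 := mfderiv_comp w (hw2.mdifferentiableAt (by simp)) hw.smooth.mdifferentiableAt
      rw [(show F ∘ Ψ =ᶠ[𝓝 w] id from hw1).mfderiv_eq, mfderiv_id] at h4
      exact h4.symm
    have hBA : B ∘L A = .id ℝ (Rn n) := by
      have h5 : ∀ u, A (B u) = u := fun u ↦ congrArg (fun L : Rn n →L[ℝ] Rn n ↦ L u) hAB
      ext1 v
      obtain ⟨u, rfl⟩ := hw.bijective.2 v
      exact congrArg B (h5 u)
    refine ⟨⟨ContinuousLinearEquiv.equivOfInverse' A B hAB hBA, rfl⟩, fun a ↦ ?_⟩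
    have h6 : A.inverse = B := ContinuousLinearMap.inverse_eq hAB hBA
    exact congrArg (fun L : Rn n →L[ℝ] Rn n ↦ L (EuclideanSpace.single a 1)) h6
  have hgood : ∀ᶠ w in 𝓝 z, (mfderiv (𝓡 n) (𝓡 n) F (Ψ w)).IsInvertible ∧
      ∀ a, X a (Ψ w) = push Ψ w (EuclideanSpace.single a 1) := by
    filter_upwards [h1.eventually_nhds, h3] with w h4 h5
    exact hinv w h5 (h4.mono fun _ h ↦ h.2.1) h4.self_of_nhds.1 h4.self_of_nhds.2.2
  have hconst : ∀ (a : Fin n) (x : Rn n), ContMDiffAt (𝓡 n) (𝓡 n).tangent ∞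
      (fun w : Rn n ↦ (⟨w, EuclideanSpace.single a (1 : ℝ)⟩ : TangentBundle (𝓡 n) (Rn n))) x :=
    fun a x ↦ contMDiffAt_vectorSpace_iff_contDiffAt.2 contDiffAt_const
  have hXs : ∀ a, VFieldDiffAt (X a) (Ψ z) := fun a ↦
    (ContMDiffAt.mpullback_vectorField_preimage (m := 1) ((hconst a _).of_le h12) hFc
      hgood.self_of_nhds.1 (by rwa [one_add_one_eq_two])).mdifferentiableAt (by simp)
  have hXξ : ξ =ᶠ[𝓝 (Ψ z)] X k := by
    filter_upwards [hFcont.eventually hgood, hFcont.eventually h2, hΨF] with x h4 h5 h6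
    rw [← h6, h4.2, h5]
  -- Near the point `ξ` is the coordinate field `X k`, and pullback preserves brackets, so this
  -- reduces to the vanishing bracket of constant fields. The Killing identity then says that `ξ`
  -- annihilates `g(X_i, X_j)`.
  have hbr : ∀ a, VectorField.mlieBracket (𝓡 n) ξ (X a) (Ψ z) = 0 := fun a ↦ by
    rw [Filter.EventuallyEq.mlieBracket_vectorField_eq hXξ (Filter.EventuallyEq.refl _ (X a)),
      ← VectorField.mpullback_mlieBracket ((hconst k _).mdifferentiableAt (by simp))
        ((hconst a _).mdifferentiableAt (by simp)) hFc
        (by rwa [minSmoothness_of_isRCLikeNormedField])]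
    have h4 : VectorField.mlieBracket (𝓡 n) (fun _ : Rn n ↦ (EuclideanSpace.single k (1 : ℝ) : Rn n))
        (fun _ : Rn n ↦ (EuclideanSpace.single a (1 : ℝ) : Rn n)) (F (Ψ z)) = 0 := by
      exact mlieBracket_const _ _ _
    rw [VectorField.mpullback_apply, h4, map_zero]
  have hK := hξ.lie_eq_zero (X i) (X j) (Ψ z) (hXs i) (hXs j)
  rw [hbr, hbr, map_zero, map_zero, zero_apply, add_zero] at hK
  let G : N → ℝ := fun x ↦ g x (X i x) (X j x)
  have hGΨ : ∀ w, (∀ a, X a (Ψ w) = push Ψ w (EuclideanSpace.single a 1)) →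
      G (Ψ w) = pullMatrix g Ψ w i j := fun w hw ↦ by
    simp only [G, hw]; rfl
  have hGF : G =ᶠ[𝓝 (Ψ z)] fun x ↦ pullMatrix g Ψ (F x) i j := by
    filter_upwards [hFcont.eventually hgood, hΨF] with x h4 h5
    rw [← hGΨ (F x) h4.2, h5]
  have hsm : ContMDiffAt (𝓡 n) 𝓘(ℝ, ℝ) ∞ (fun w ↦ pullMatrix g Ψ w i j) (F (Ψ z)) := by
    rw [hFz]
    exact ((hg.metricAt_pullMatrix h3.self_of_nhds).smooth i j).contDiffAt.contMDiffAt
  have hGd : MDifferentiableAt (𝓡 n) 𝓘(ℝ, ℝ) G (Ψ z) :=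
    ((hsm.comp (Ψ z) hFc).congr_of_eventuallyEq hGF).mdifferentiableAt (by simp)
  have h4 := dif_push hGd h3.self_of_nhds.smooth (EuclideanSpace.single k 1)
  rw [h2.self_of_nhds] at h4
  have h5 : (fun w ↦ pullMatrix g Ψ w i j) =ᶠ[𝓝 z] fun w ↦ G (Ψ w) :=
    hgood.mono fun w hw ↦ (hGΨ w hw.2).symm
  exact (pd_congr h5).trans (h4.symm.trans hK)

end Killing

/-! ### Independence of the first variable and propagation of the field equations. -/

section Stationary

variable {n : ℕ}

/-- A function with vanishing derivative along `∂₀` depends only on the remaining variables. -/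
lemma eventually_eq_sec {F : Rn (n + 1) → ℝ} {x : Rn n} (hF : CInf F (sec x))
    (h : ∀ᶠ z in 𝓝 (sec x), pd 0 F z = 0) : ∀ᶠ z in 𝓝 (sec x), F z = F (sec (tl z)) := by
  obtain ⟨ε, hε, hB⟩ := Metric.eventually_nhds_iff_ball.1 (hF.and h)
  have h1 : ∀ᶠ z in 𝓝 (sec x), sec (tl z) ∈ Metric.ball (sec x) ε := by
    have hc : ContinuousAt (fun z : Rn (n + 1) ↦ sec (tl z)) (sec x) := by fun_prop
    exact hc.eventually (by
      simp only [tl_sec]; exact Metric.ball_mem_nhds (sec x) hε)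
  filter_upwards [Metric.ball_mem_nhds (sec x) hε, h1] with z hz hz'
  -- The segment from the projection of `z` on the slice to `z` is parallel to `∂₀` and stays in the
  -- ball, so `F` has zero derivative along it.
  let ℓ : ℝ →ᵃ[ℝ] Rn (n + 1) := AffineMap.lineMap (sec (tl z)) z
  have hz0 : z - sec (tl z) = z 0 • EuclideanSpace.single 0 (1 : ℝ) := by
    conv_lhs => rw [eq_smul_add_sec z]
    simp [tl_single_zero]
  have hd : ∀ t ∈ ℓ ⁻¹' Metric.ball (sec x) ε,
      HasDerivWithinAt (fun t ↦ F (ℓ t)) 0 (ℓ ⁻¹' Metric.ball (sec x) ε) t := by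
    intro t ht
    have h2 := (((hB _ ht).1.differentiableAt (by simp)).hasFDerivAt.comp_hasDerivAt t
      (AffineMap.hasDerivAt_lineMap (a := sec (tl z)) (b := z) (x := t)))
    rw [hz0, map_smul, show fderiv ℝ F (ℓ t) (EuclideanSpace.single 0 1) = 0 from (hB _ ht).2,
      smul_zero] at h2
    exact h2.hasDerivWithinAt
  have h3 := ((convex_ball (sec x) ε).affine_preimage ℓ).norm_image_sub_le_of_norm_hasDerivWithin_le
    (C := 0) hd (by simp) (x := 0) (y := 1) (by simpa [ℓ] using hz') (by simpa [ℓ] using hz)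
  simpa [ℓ, sub_eq_zero] using h3

lemma fderiv_add_const (c z u : Rn n) : fderiv ℝ (fun w : Rn n ↦ w + c) z u = u := by
  have h : HasFDerivAt (fun w : Rn n ↦ w + c) (ContinuousLinearMap.id ℝ (Rn n)) z :=
    (hasFDerivAt_id z).add_const c
  rw [h.fderiv]; rfl

lemma IsParam.translate {N : Type*} [TopologicalSpace N]
    [ChartedSpace (Rn n) N] {Ψ : Rn n → N}
    {z c : Rn n} (h : IsParam n Ψ (z + c)) : IsParam n (fun w ↦ Ψ (w + c)) z := by
  have hc : CInf (fun w : Rn n ↦ w + c) z := (contDiff_id.add contDiff_const).cInf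
  refine ⟨SmoothNear.comp hc h.smooth, ?_⟩
  have : push (n := n) (fun w ↦ Ψ (w + c)) z = push Ψ (z + c) := by
    ext1 u
    rw [push_comp hc h.smooth, fderiv_add_const]
  rw [this]
  exact h.bijective

lemma pullMatrix_translate {N : Type*} [TopologicalSpace N]
    [ChartedSpace (Rn n) N] (g : Tensor2 n N) {Ψ : Rn n → N}
    {z c : Rn n} (h : SmoothNear n Ψ (z + c)) :
    pullMatrix g (fun w ↦ Ψ (w + c)) z = pullMatrix g Ψ (z + c) := by
  have hc : CInf (fun w : Rn n ↦ w + c) z := (contDiff_id.add contDiff_const).cInf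
  ext i j
  simp only [pullMatrix, Matrix.of_apply, push_comp hc h, fderiv_add_const]

variable {N : Type*} [TopologicalSpace N] [ChartedSpace (Rn (n + 1)) N]

/-- The differential of the inverse of an adapted parametrization sends `ξ` to `∂₀`, so integral
curves become straight lines of unit speed. -/
lemma hasDerivAt_inverse_integralCurve {ξ : VField (n + 1) N} {γ : ℝ → N} {s : ℝ} {Ψ : Rn (n + 1) → N}
    {F : N → Rn (n + 1)} {z : Rn (n + 1)} (h : IsAdapted ξ Ψ z)
    (hF : MDifferentiableAt (𝓡 (n + 1)) (𝓡 (n + 1)) F (Ψ z)) (hFΨ : ∀ᶠ w in 𝓝 z, F (Ψ w) = w)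
    (hγ : HasMFDerivAt 𝓘(ℝ, ℝ) (𝓡 (n + 1)) γ s ((1 : ℝ →L[ℝ] ℝ).smulRight (ξ (γ s))))
    (hz : Ψ z = γ s) :
    HasDerivAt (fun t ↦ F (γ t)) (EuclideanSpace.single 0 1) s := by
  have h1 : (mfderiv (𝓡 (n + 1)) (𝓡 (n + 1)) F (Ψ z)) (ξ (Ψ z))
      = (EuclideanSpace.single 0 1 : Rn (n + 1)) := by
    have h2 := mfderiv_comp z hF h.isParam.smooth.mdifferentiableAt
    rw [(show F ∘ Ψ =ᶠ[𝓝 z] id from hFΨ).mfderiv_eq, mfderiv_id] at h2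
    rw [← h.push_eq.self_of_nhds]
    exact (congrArg (fun L : Rn (n + 1) →L[ℝ] Rn (n + 1) ↦ L (EuclideanSpace.single 0 1)) h2).symm
  rw [hz] at h1 hF
  let A : Rn (n + 1) →L[ℝ] Rn (n + 1) := mfderiv (𝓡 (n + 1)) (𝓡 (n + 1)) F (γ s)
  let v : Rn (n + 1) := ξ (γ s)
  have h3 : HasFDerivAt (fun t ↦ F (γ t)) (A.comp ((1 : ℝ →L[ℝ] ℝ).smulRight v)) s :=
    (hF.hasMFDerivAt.comp s hγ).hasFDerivAt
  refine h3.hasDerivAt.congr_deriv (Eq.trans ?_ h1)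
  change A ((1 : ℝ) • v) = A v
  rw [one_smul]

variable [IsManifold (𝓡 (n + 1)) ∞ N]

/-- The equations `R_{ab} = κ ∇_a f ∇_b f` and `□ f = 0` at a point. -/
def ScalarGravityAt {n : ℕ} {N : Type*} [TopologicalSpace N] [ChartedSpace (Rn n) N] (κ : ℝ)
    (g : Tensor2 n N) (f : N → ℝ) (x : N) : Prop :=
  (∀ v w, ricci g x v w = κ * (dif f x v * dif f x w)) ∧ box g f x = 0

variable {g : Tensor2 (n + 1) N} {ξ : VField (n + 1) N} {f : N → ℝ}

/-- In a flow box of a Killing field the metric does not depend on the first variable. -/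
lemma IsAdapted.pullMatrix_eq (hg : IsMetric g) (hξ : IsKilling g ξ) {Ψ : Rn (n + 1) → N}
    {x : Rn n} (h : IsAdapted ξ Ψ (sec x)) :
    pullMatrix g Ψ =ᶠ[𝓝 (sec x)] fun z ↦ pullMatrix g Ψ (sec (tl z)) := by
  have h1 : ∀ i j, ∀ᶠ z in 𝓝 (sec x), pullMatrix g Ψ z i j = pullMatrix g Ψ (sec (tl z)) i j :=
    fun i j ↦ eventually_eq_sec ((hg.metricAt_pullMatrix h.isParam).smooth i j)
      (hξ.pd_pullMatrix hg h.isParam 0 h.push_eq i j)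
  filter_upwards [Filter.eventually_all.2 fun i ↦ Filter.eventually_all.2 (h1 i)] with z hz
  ext i j; exact hz i j

lemma IsAdapted.comp_eq (hf : IsSmoothScalar (n := n + 1) f) (hξf : ∀ x, dif f x (ξ x) = 0)
    {Ψ : Rn (n + 1) → N} {x : Rn n} (h : IsAdapted ξ Ψ (sec x)) :
    (fun z ↦ f (Ψ z)) =ᶠ[𝓝 (sec x)] fun z ↦ f (Ψ (sec (tl z))) := by
  refine eventually_eq_sec (h.isParam.smooth.cInf_comp hf) ?_
  filter_upwards [h.eventually] with z hz
  have h1 := dif_push (hf.mdifferentiableAt (Ψ z)) hz.isParam.smooth (EuclideanSpace.single 0 1)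
  rw [hz.push_eq.self_of_nhds, hξf] at h1
  exact h1.symm

/-- The field equations propagate along a Killing field, in a flow box. -/
lemma IsAdapted.scalarGravityAt_iff (hg : IsMetric g) (hξ : IsKilling g ξ)
    (hf : IsSmoothScalar (n := n + 1) f) (hξf : ∀ x, dif f x (ξ x) = 0) (κ : ℝ)
    {Ψ : Rn (n + 1) → N} {x : Rn n} (h : IsAdapted ξ Ψ (sec x)) :
    ∀ᶠ z in 𝓝 (sec x), tl z = x →
      (ScalarGravityAt κ g f (Ψ z) ↔ ScalarGravityAt κ g f (Ψ (sec x))) := by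
  filter_upwards [h.eventually, h.pullMatrix_eq hg hξ |>.eventually_nhds,
    (h.comp_eq hf hξf).eventually_nhds] with z h1 h2 h3 hz
  have hzc : sec x + (z - sec x) = z := by abel
  have htl : tl (z - sec x) = 0 := by rw [map_sub, hz, tl_sec, sub_self]
  set c := z - sec x
  -- Translating `Ψ` by a multiple of `∂₀` gives a parametrization around the other point with the
  -- same metric components and the same scalar as `Ψ` near `sec x`; the component equations
  -- therefore coincide.
  have h4 : IsParam (n + 1) (fun w ↦ Ψ (w + c)) (sec x) :=
    IsParam.translate (by rw [hzc]; exact h1.isParam)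
  have hT : Filter.Tendsto (fun w ↦ w + c) (𝓝 (sec x)) (𝓝 z) := by
    have : ContinuousAt (fun w ↦ w + c) (sec x) := by fun_prop
    rwa [ContinuousAt, hzc] at this
  have e1 : pullMatrix g (fun w ↦ Ψ (w + c)) =ᶠ[𝓝 (sec x)] pullMatrix g Ψ := by
    filter_upwards [hT.eventually h1.isParam.smooth.eventually, hT.eventually h2,
      h.pullMatrix_eq hg hξ] with w h5 h6 h7
    rw [pullMatrix_translate g h5, h6, h7, map_add, htl, add_zero]
  have e2 : (fun w ↦ f (Ψ (w + c))) =ᶠ[𝓝 (sec x)] fun w ↦ f (Ψ w) := by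
    filter_upwards [hT.eventually h3, h.comp_eq hf hξf] with w h6 h7
    rw [h6, h7, map_add, htl, add_zero]
  have h8 := hg.ricci_box_iff h4 hf κ
  rw [ric_congr e1, grd_congr e2 e2, hes_congr e1 e2, e1.self_of_nhds,
    ← hg.ricci_box_iff h.isParam hf κ, hzc] at h8
  exact h8

/-- The field equations propagate along the integral curves of a Killing field. -/
theorem scalarGravityAt_integralCurve (hg : IsMetric g) (hξ : IsKilling g ξ)
    (hξ0 : ∀ x, ξ x ≠ 0) (hf : IsSmoothScalar (n := n + 1) f) (hξf : ∀ x, dif f x (ξ x) = 0)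
    (κ : ℝ) {γ : ℝ → N} {a b : ℝ} (hγ : IsMIntegralCurveOn (I := 𝓡 (n + 1)) γ ξ (Set.Ioo a b))
    {s t : ℝ} (hs : s ∈ Set.Ioo a b) (ht : t ∈ Set.Ioo a b) :
    ScalarGravityAt κ g f (γ s) ↔ ScalarGravityAt κ g f (γ t) := by
  -- Having the same truth value is an equivalence relation on times, so by connectedness of the
  -- interval it is enough to compare each `r` with nearby times.
  refine isPreconnected_Ioo.induction₂
    (fun s t ↦ ScalarGravityAt κ g f (γ s) ↔ ScalarGravityAt κ g f (γ t)) ?_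
    (fun _ _ _ _ _ _ h h' ↦ h.trans h') (fun _ _ _ _ h ↦ h.symm) hs ht
  intro r hr
  have hγ' : ∀ u ∈ Set.Ioo a b,
      HasMFDerivAt 𝓘(ℝ, ℝ) (𝓡 (n + 1)) γ u ((1 : ℝ →L[ℝ] ℝ).smulRight (ξ (γ u))) :=
    fun u hu ↦ (hγ u hu).hasMFDerivAt (isOpen_Ioo.mem_nhds hu)
  have hγc := (hγ' r hr).continuousAt
  obtain ⟨Ψ, x, hΨ, hΨx⟩ := exists_flowBox_of_ne_zero hξ.smooth (γ r) (hξ0 _)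
  obtain ⟨F, hF⟩ := hΨ.isParam.exists_inverse
  obtain ⟨hF1, hF2, hF3⟩ := hF.self_of_nhds
  have hFγ : Filter.Tendsto (fun u ↦ F (γ u)) (𝓝 r) (𝓝 (sec x)) := by
    have : ContinuousAt F (γ r) := by rw [← hΨx]; exact hF1.continuousAt
    have h1 := ContinuousAt.comp (g := F) this hγc
    rw [ContinuousAt] at h1
    simpa only [Function.comp_def, ← hΨx, hF2] using h1
  rw [hΨx] at hF3
  have hd : ∀ᶠ u in 𝓝 r, HasDerivAt (fun u ↦ F (γ u)) (EuclideanSpace.single 0 1) u := by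
    filter_upwards [hFγ.eventually hΨ.eventually, hFγ.eventually hF.eventually_nhds,
      hγc.eventually hF3, isOpen_Ioo.mem_nhds hr] with u h1 h2 h3 h4
    exact hasDerivAt_inverse_integralCurve h1 (h2.self_of_nhds.1.mdifferentiableAt (by simp))
      (h2.mono fun _ h ↦ h.2.1) (hγ' u h4) h3
  -- Since the curve moves in the direction `∂₀`, its transverse coordinates have zero derivative
  -- and stay equal to `x`.
  have hconst : ∀ᶠ u in 𝓝 r, tl (F (γ u)) = x := by
    obtain ⟨ε, hε, hB⟩ := Metric.eventually_nhds_iff_ball.1 hd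
    filter_upwards [Metric.ball_mem_nhds r hε] with u hu
    have h1 : ∀ w ∈ Metric.ball r ε, HasDerivWithinAt (fun u ↦ tl (F (γ u))) 0
        (Metric.ball r ε) w := fun w hw ↦ by
      have := (tl : Rn (n + 1) →L[ℝ] Rn n).hasFDerivAt.comp_hasDerivAt w (hB w hw)
      rw [tl_single_zero] at this
      exact this.hasDerivWithinAt
    have h2 := (convex_ball r ε).norm_image_sub_le_of_norm_hasDerivWithin_le (C := 0) h1 (by simp)
      (Metric.mem_ball_self hε) hu
    rw [zero_mul, norm_le_zero_iff, sub_eq_zero, ← hΨx, hF2, tl_sec] at h2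
    exact h2
  refine Filter.Eventually.filter_mono nhdsWithin_le_nhds ?_
  filter_upwards [hFγ.eventually (hΨ.scalarGravityAt_iff hg hξ hf hξf κ), hconst,
    hγc.eventually hF3] with u h1 h2 h3
  have h4 := h1 h2
  rw [h3, hΨx] at h4
  exact h4.symm

end Stationary

/-! ### Composition with an immersion and smoothness of the scalars. -/

section Immersions

variable {k n : ℕ} {N : Type*} [TopologicalSpace N] [ChartedSpace (Rn n) N]
  {M : Type*} [TopologicalSpace M] [ChartedSpace (Rn k) M]

lemma SmoothNear.comp_manifold {j : ℕ} {ι : M → N} (hι : ContMDiff (𝓡 k) (𝓡 n) ∞ ι)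
    {Ψ : Rn j → M} {y : Rn j} (h : SmoothNear k Ψ y) : SmoothNear n (fun z ↦ ι (Ψ z)) y := by
  filter_upwards [h] with z hz using (hι _).comp z hz

lemma push_comp_manifold {j : ℕ} {ι : M → N} (hι : ContMDiff (𝓡 k) (𝓡 n) ∞ ι)
    {Ψ : Rn j → M} {y : Rn j} (h : SmoothNear k Ψ y) (u : Rn j) :
    push (n := n) (fun z ↦ ι (Ψ z)) y u = mfderiv (𝓡 k) (𝓡 n) ι (Ψ y) (push Ψ y u) := by
  have := mfderiv_comp y ((hι (Ψ y)).mdifferentiableAt (by simp)) h.mdifferentiableAt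
  exact congrArg (fun L : Rn j →L[ℝ] Rn n ↦ L u) this

lemma IsSmoothScalar.comp {f : N → ℝ} (hf : IsSmoothScalar (n := n) f) {ι : M → N}
    (hι : ContMDiff (𝓡 k) (𝓡 n) ∞ ι) : IsSmoothScalar (n := k) (fun m ↦ f (ι m)) :=
  ContMDiff.comp hf hι

lemma IsSmoothScalar.log {f : N → ℝ} (hf : IsSmoothScalar (n := n) f) (h0 : ∀ x, f x ≠ 0) :
    IsSmoothScalar (n := n) (fun x ↦ Real.log (f x)) := fun x ↦
  ((Real.contDiffAt_log.2 (h0 x)).contMDiffAt).comp x (hf x)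

lemma IsSmoothScalar.const_mul {f : N → ℝ} (hf : IsSmoothScalar (n := n) f) (c : ℝ) :
    IsSmoothScalar (n := n) (fun x ↦ c * f x) := fun x ↦
  (contDiff_const.mul contDiff_id : ContDiff ℝ ∞ fun t : ℝ ↦ c * t).contMDiff.contMDiffAt.comp x
    (hf x)

lemma dif_const_mul {f : N → ℝ} (hf : IsSmoothScalar (n := n) f) (c : ℝ) (x : N)
    (v : TangentSpace (𝓡 n) x) : dif (fun x ↦ c * f x) x v = c * dif f x v := by
  have h1 := (hf.mdifferentiableAt x).hasMFDerivAt
  have h2 := HasMFDerivAt.const_smul h1 c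
  have h3 := h2.mfderiv
  exact congrArg (fun L : Rn n →L[ℝ] ℝ ↦ L v) h3

/-- In suitable charts an immersion is the linear inclusion `u ↦ (u, 0)` followed by a linear
equivalence. That inclusion is injective, and so is the differential of the domain chart. -/
lemma mfderiv_injective_of_isImmersionAt {ι : M → N} {m : M}
    (h : Manifold.IsImmersionAt (𝓡 k) (𝓡 n) ∞ ι m) :
    Function.Injective (mfderiv (𝓡 k) (𝓡 n) ι m) := by
  have hD : h.domChart.MDifferentiable (𝓡 k) (𝓡 k) :=
    ⟨(contMDiffOn_of_mem_maximalAtlas h.domChart_mem_maximalAtlas).mdifferentiableOn (by simp),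
      (contMDiffOn_symm_of_mem_maximalAtlas h.domChart_mem_maximalAtlas).mdifferentiableOn
        (by simp)⟩
  have hC : MDifferentiableAt (𝓡 n) (𝓡 n) h.codChart (ι m) :=
    (contMDiffAt_of_mem_maximalAtlas h.codChart_mem_maximalAtlas
      h.mem_codChart_source).mdifferentiableAt (by simp)
  have hι : MDifferentiableAt (𝓡 k) (𝓡 n) ι m := h.contMDiffAt.mdifferentiableAt (by simp)
  let L : Rn k →L[ℝ] Rn n := (h.equiv : (Rn k × h.complement) →L[ℝ] Rn n).comp
    (ContinuousLinearMap.inl ℝ (Rn k) h.complement)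
  have heq : h.codChart ∘ ι =ᶠ[𝓝 m] fun x ↦ L (h.domChart x) := by
    filter_upwards [h.domChart.open_source.mem_nhds h.mem_domChart_source] with x hx
    have hx' : h.domChart x ∈ (h.domChart.extend (𝓡 k)).target := by
      simpa only [mfld_simps] using h.domChart.map_source hx
    have h1 := h.writtenInCharts hx'
    simp only [mfld_simps, h.domChart.left_inv hx] at h1
    exact h1
  have h1 := mfderiv_comp m hC hι
  have h2 : mfderiv (𝓡 k) (𝓡 n) (fun x ↦ L (h.domChart x)) m
      = L.comp (mfderiv (𝓡 k) (𝓡 k) h.domChart m) := by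
    have := mfderiv_comp m (g := L) (L.differentiableAt.mdifferentiableAt)
      (hD.mdifferentiableAt h.mem_domChart_source)
    rw [mfderiv_eq_fderiv, L.fderiv] at this
    exact this
  rw [heq.mfderiv_eq, h2] at h1
  have hL : Function.Injective L := fun u w huw ↦ by
    have := h.equiv.injective huw
    exact congrArg Prod.fst this
  refine fun v w hvw ↦ hD.mfderiv_injective h.mem_domChart_source (hL ?_)
  have h3 := fun v ↦ congrArg (fun A : Rn k →L[ℝ] Rn n ↦ A v) h1
  refine (h3 v).trans (Eq.trans ?_ (h3 w).symm)
  exact congrArg (mfderiv (𝓡 n) (𝓡 n) h.codChart (ι m)) hvw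

variable [IsManifold (𝓡 n) ∞ N]

lemma IsSmoothTensor.msm_pullMatrix {g : Tensor2 n N} (hg : IsSmoothTensor g) {Ψ : Rn k → N}
    {y : Rn k} (h : SmoothNear n Ψ y) : MSm (pullMatrix g Ψ) y := by
  have hp := mem_chart_source (Rn n) (Ψ y)
  have h1 := h.cInf_chart hp
  exact ((h1.jac.transpose.mul ((hg.msm _ ((chartAt (Rn n) (Ψ y)).map_source hp)).comp h1)).mul
    h1.jac).congr (pullMatrix_eq_metricMatrix g h hp)

lemma isSmoothScalar_of_cInf {f : N → ℝ} (h : ∀ p : N,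
    CInf (fun z ↦ f ((chartAt (Rn n) p).symm z)) (chartAt (Rn n) p p)) :
    IsSmoothScalar (n := n) f := by
  intro p
  have h1 := (h p).contDiffAt.contMDiffAt.comp p (contMDiffAt_of_mem_maximalAtlas
    (IsManifold.chart_mem_maximalAtlas (I := 𝓡 n) (n := ∞) p) (mem_chart_source (Rn n) p))
  refine h1.congr_of_eventuallyEq ?_
  filter_upwards [(chartAt (Rn n) p).open_source.mem_nhds (mem_chart_source (Rn n) p)] with x hx
  simp [(chartAt (Rn n) p).left_inv hx]

lemma isSmoothScalar_normSq {g : Tensor2 n N} (hg : IsSmoothTensor g) {ξ : VField n N}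
    (hξ : IsSmoothVField ξ) : IsSmoothScalar (n := n) (normSq g ξ) := by
  refine isSmoothScalar_of_cInf fun p ↦ ?_
  have hx := (chartAt (Rn n) p).map_source (mem_chart_source (Rn n) p)
  have hV := cInf_chartField hξ p hx
  have h1 : CInf (fun z ↦ form (metricMatrix g (chartAt (Rn n) p) z) (chartField p ξ z)
      (chartField p ξ z)) (chartAt (Rn n) p p) :=
    CInf.sum fun i _ ↦ CInf.sum fun j _ ↦ ((hg.msm p hx i j).mul (hV.coord i)).mul (hV.coord j)
  refine h1.congr ?_
  filter_upwards [(chartAt (Rn n) p).open_target.mem_nhds hx] with z hz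
  rw [metricMatrix_eq_pullMatrix, form_pullMatrix, push_chartField ξ p hz, normSq]

end Immersions

/-! ### Scaling the scalar field by a constant. -/

section ConstMul

variable {n : ℕ} {N : Type*} [TopologicalSpace N] [ChartedSpace (Rn n) N]
  [IsManifold (𝓡 n) ∞ N]

lemma hes_const_mul {A : Rn n → Matrix (Fin n) (Fin n) ℝ} {f : Rn n → ℝ} {y : Rn n}
    (hf : CInf f y) (c : ℝ) : hes A (fun z ↦ c * f z) y = c • hes A f y := by
  have h1 : ∀ i, pd i (fun z ↦ c * f z) =ᶠ[𝓝 y] fun z ↦ c * pd i f z := fun i ↦ by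
    filter_upwards [hf.eventually] with z hz using pd_const_mul i c hz.differentiableAt
  ext i j
  rw [Matrix.smul_apply, hes_apply, hes_apply, pd_congr (h1 j),
    pd_const_mul i c (hf.pd j).differentiableAt, smul_eq_mul, mul_sub, Finset.mul_sum]
  congr 1
  refine Finset.sum_congr rfl fun k _ ↦ ?_
  rw [(h1 k).self_of_nhds]; ring

lemma IsMetric.box_const_mul {g : Tensor2 n N} (hg : IsMetric g) {f : N → ℝ}
    (hf : IsSmoothScalar (n := n) f) (c : ℝ) (x : N) :
    box g (fun x ↦ c * f x) x = c * box g f x := by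
  have hp := mem_chart_source (Rn n) x
  have h := isParam_chartAt_symm (n := n) x ((chartAt (Rn n) x).map_source hp)
  have h1 := hg.box_eq h (hf.const_mul c)
  have h2 := hg.box_eq h hf
  rw [hes_const_mul (h.smooth.cInf_comp hf), mtr_smul, ← h2, (chartAt (Rn n) x).left_inv hp] at h1
  exact h1

/-- The factor is forced by `8πG = ½ · (√(16πG))²`; being nonzero, it does not affect the wave
equation. -/
lemma IsMetric.rescaledEquations_iff_twoScalar {M : Type*} [TopologicalSpace M]
    [ChartedSpace (Rn 3) M] [IsManifold (𝓡 3) ∞ M] {h : Tensor2 3 M} (hh : IsMetric h)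
    {l f : M → ℝ} (hf : IsSmoothScalar (n := 3) f) {G : ℝ} (hG : 0 < G) :
    RescaledEquations G h l f ↔
      TwoScalarEKG3 h (fun x ↦ Real.log (l x)) (fun x ↦ Real.sqrt (16 * Real.pi * G) * f x) := by
  have hpos : 0 < 16 * Real.pi * G := by positivity
  have hs : Real.sqrt (16 * Real.pi * G) ≠ 0 := (Real.sqrt_pos.2 hpos).ne'
  have hsq := Real.mul_self_sqrt hpos.le
  set c := Real.sqrt (16 * Real.pi * G)
  have e : ∀ (x : M) (v w : TangentSpace (𝓡 3) x) (a : ℝ),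
      (1 / 2) * a + 8 * Real.pi * G * (dif f x v * dif f x w)
        = (1 / 2) * (a + c * dif f x v * (c * dif f x w)) := fun x v w a ↦ by
    linear_combination (-(1 / 2) * (dif f x v * dif f x w)) * hsq
  simp only [RescaledEquations, TwoScalarEKG3, hh.box_const_mul hf, dif_const_mul hf, e,
    mul_eq_zero, hs, false_or]
  rw [and_comm (a := ∀ x : M, box h f x = 0)]

end ConstMul

/-! ### The static form of the metric near an orthogonal hypersurface. -/

section StaticForm

variable {n : ℕ} {N : Type*} [TopologicalSpace N] [ChartedSpace (Rn (n + 1)) N]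
  [IsManifold (𝓡 (n + 1)) ∞ N] {g : Tensor2 (n + 1) N} {ξ : VField (n + 1) N} {f : N → ℝ}

/-- In a flow box built on a hypersurface orthogonal to a Killing field the metric is static. -/
lemma IsAdapted.pullMatrix_eq_stat (hg : IsMetric g) (hξ : IsKilling g ξ)
    {Ψ : Rn (n + 1) → N} {x : Rn n} (h : IsAdapted ξ Ψ (sec x)) {σ : Rn n → N}
    (hσ : ∀ᶠ z in 𝓝 x, Ψ (sec z) = σ z)
    (hort : ∀ᶠ z in 𝓝 x, ∀ u, g (σ z) (ξ (σ z)) (push σ z u) = 0) :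
    pullMatrix g Ψ =ᶠ[𝓝 (sec x)] stat (fun z ↦ normSq g ξ (σ z)) (pullMatrix g σ) := by
  -- The components need only be found on the slice, where `∂₀` is `ξ` and orthogonality removes the
  -- mixed blocks; independence of the first variable extends the result off the slice.
  have hslice : ∀ᶠ z in 𝓝 x, pullMatrix g Ψ (sec z)
      = blk (normSq g ξ (σ z)) 0 0 (pullMatrix g σ z) := by
    have hc : ContinuousAt (sec : Rn n → Rn (n + 1)) x := sec.continuous.continuousAt
    filter_upwards [hc.eventually h.eventually, hσ.eventually_nhds, hort] with z h1 h2 h3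
    have hz := h2.self_of_nhds
    have e0 : (push Ψ (sec z) (EuclideanSpace.single 0 1) : Rn (n + 1)) = ξ (σ z) :=
      h1.push_eq.self_of_nhds.trans (vField_congr ξ hz)
    have es : ∀ i : Fin n, (push Ψ (sec z) (EuclideanSpace.single i.succ 1) : Rn (n + 1))
        = push (n := n + 1) σ z (EuclideanSpace.single i 1) := fun i ↦ by
      have h4 := push_comp (n := n + 1) (τ := (sec : Rn n → Rn (n + 1))) (y := z) (Ψ := Ψ)
        sec.contDiff.cInf h1.isParam.smooth (EuclideanSpace.single i 1)
      rw [sec.fderiv, sec_single] at h4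
      exact h4.symm.trans (push_congr h2 _)
    ext i j
    refine (tensor_congr g hz _ _).trans ?_
    refine Fin.cases ?_ (fun i ↦ ?_) i <;> refine Fin.cases ?_ (fun j ↦ ?_) j
    · rw [e0]; rfl
    · rw [e0, es]; exact h3 _
    · rw [e0, es, hg.symm]; exact h3 _
    · rw [es, es]; rfl
  have ht : Filter.Tendsto (tl : Rn (n + 1) → Rn n) (𝓝 (sec x)) (𝓝 x) := by
    have : ContinuousAt (tl : Rn (n + 1) → Rn n) (sec x) := tl.continuous.continuousAt
    rwa [ContinuousAt, tl_sec] at this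
  filter_upwards [h.pullMatrix_eq hg hξ, ht.eventually hslice] with z h1 h2
  rw [h1, h2, stat]

/-- The reduced form of the field equations on a hypersurface orthogonal to a Killing field. -/
theorem scalarGravityAt_iff_reduced (hg : IsMetric g) (hξ : IsKilling g ξ)
    (hξ0 : ∀ x, normSq g ξ x ≠ 0) (hf : IsSmoothScalar (n := n + 1) f)
    (hξf : ∀ x, dif f x (ξ x) = 0) (κ : ℝ) {σ : Rn n → N} {y : Rn n}
    (hσ : SmoothNear (n + 1) σ y) (hinj : Function.Injective (push (n := n + 1) σ y))
    (hort : ∀ᶠ z in 𝓝 y, ∀ u, g (σ z) (ξ (σ z)) (push σ z u) = 0)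
    (hh : MetricAt (pullMatrix g σ) y) :
    ScalarGravityAt κ g f (σ y) ↔
      (ric (pullMatrix g σ) y
        = ((1 / 2) * (normSq g ξ (σ y))⁻¹) • hes (pullMatrix g σ) (fun z ↦ normSq g ξ (σ z)) y
          - ((1 / 4) * (normSq g ξ (σ y))⁻¹ ^ 2) •
            grd (fun z ↦ normSq g ξ (σ z)) (fun z ↦ normSq g ξ (σ z)) y
          + κ • grd (fun z ↦ f (σ z)) (fun z ↦ f (σ z)) y) ∧
      mtr (pullMatrix g σ y) (hes (pullMatrix g σ) (fun z ↦ f (σ z)) y)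
        = -((1 / 2) * (normSq g ξ (σ y))⁻¹ *
          mtr (pullMatrix g σ y) (grd (fun z ↦ f (σ z)) (fun z ↦ normSq g ξ (σ z)) y)) ∧
      mtr (pullMatrix g σ y) (hes (pullMatrix g σ) (fun z ↦ normSq g ξ (σ z)) y)
        = (1 / 2) * (normSq g ξ (σ y))⁻¹ *
          mtr (pullMatrix g σ y) (grd (fun z ↦ normSq g ξ (σ z))
            (fun z ↦ normSq g ξ (σ z)) y) := by
  -- Transversality: pairing the relation with `ξ` removes the tangential part and leaves `c * λ =
  -- 0`; injectivity of the differential of `σ` then gives `u = 0`.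
  obtain ⟨Ψ, hΨ, hΨσ⟩ := exists_flowBox hξ.smooth hσ (by
    intro c u hcu
    have h1 := congrArg (g (σ y) (ξ (σ y))) hcu
    rw [map_add, map_smul, hort.self_of_nhds u, map_zero, add_zero, smul_eq_mul] at h1
    have hc : c = 0 := (mul_eq_zero.1 h1).resolve_right (hξ0 _)
    rw [hc, zero_smul, zero_add] at hcu
    have hz : push (n := n + 1) σ y 0 = 0 := map_zero (mfderiv (𝓡 n) (𝓡 (n + 1)) σ y)
    exact ⟨hc, hinj (hcu.trans hz.symm)⟩)
  have hy := hΨσ.self_of_nhds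
  have e1 := hΨ.pullMatrix_eq_stat hg hξ hΨσ hort
  have ht : Filter.Tendsto (tl : Rn (n + 1) → Rn n) (𝓝 (sec y)) (𝓝 y) := by
    have : ContinuousAt (tl : Rn (n + 1) → Rn n) (sec y) := tl.continuous.continuousAt
    rwa [ContinuousAt, tl_sec] at this
  have e2 : (fun z ↦ f (Ψ z)) =ᶠ[𝓝 (sec y)] fun z ↦ f (σ (tl z)) := by
    filter_upwards [hΨ.comp_eq hf hξf, ht.eventually hΨσ] with z h1 h2
    rw [h1, h2]
  have h1 := hg.ricci_box_iff hΨ.isParam hf κ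
  rw [ric_congr e1, grd_congr e2 e2, hes_congr e1 e2, e1.self_of_nhds, hy] at h1
  refine h1.trans ?_
  have h2 := static_equations_iff (y := sec y) (l := fun z ↦ normSq g ξ (σ z))
    (f := fun z ↦ f (σ z)) (h := pullMatrix g σ) (by rwa [tl_sec])
    (by rw [tl_sec]; exact hσ.cInf_comp (isSmoothScalar_normSq hg.smooth hξ.smooth)) (hξ0 _)
    (by rw [tl_sec]; exact hσ.cInf_comp hf) κ
  rw [tl_sec] at h2
  exact h2

end StaticForm

/-! ### The hypersurface as orbit space. -/

section Reduction

variable {N : Type*} [TopologicalSpace N] [ChartedSpace (Rn 4) N]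
  {M : Type*} [TopologicalSpace M] [ChartedSpace (Rn 3) M]
  {g : Tensor2 4 N} {ξ : VField 4 N} {ι : M → N}

lemma IsOrbitHypersurface.contMDiff (hι : IsOrbitHypersurface g ξ ι) :
    ContMDiff (𝓡 3) (𝓡 4) ∞ ι := hι.embedding.isImmersion.contMDiff

lemma IsOrbitHypersurface.mfderiv_injective (hι : IsOrbitHypersurface g ξ ι) (m : M) :
    Function.Injective (mfderiv (𝓡 3) (𝓡 4) ι m) :=
  mfderiv_injective_of_isImmersionAt (hι.embedding.isImmersion.isImmersionAt m)

/-- The covector `ξ_a` vanishes on vectors tangent to the hypersurface, so the subtracted term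
disappears under the pullback. -/
lemma IsOrbitHypersurface.inducedMetric_apply (hι : IsOrbitHypersurface g ξ ι) (m : M)
    (v w : TangentSpace (𝓡 3) m) : inducedMetric g ξ ι m v w
      = g (ι m) (mfderiv (𝓡 3) (𝓡 4) ι m v) (mfderiv (𝓡 3) (𝓡 4) ι m w) := by
  have h1 : inducedMetric g ξ ι m v w
      = g (ι m) (mfderiv (𝓡 3) (𝓡 4) ι m v) (mfderiv (𝓡 3) (𝓡 4) ι m w)
        - (normSq g ξ (ι m))⁻¹ * (g (ι m) (ξ (ι m)) (mfderiv (𝓡 3) (𝓡 4) ι m v)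
          * g (ι m) (ξ (ι m)) (mfderiv (𝓡 3) (𝓡 4) ι m w)) := rfl
  rw [h1, hι.orthogonal, zero_mul, mul_zero, sub_zero]

lemma IsOrbitHypersurface.pullMatrix_inducedMetric (hι : IsOrbitHypersurface g ξ ι)
    {Ψ : Rn 3 → M} {y : Rn 3} (h : SmoothNear 3 Ψ y) :
    pullMatrix (inducedMetric g ξ ι) Ψ y = pullMatrix g (fun z ↦ ι (Ψ z)) y := by
  ext i j
  simp only [pullMatrix, Matrix.of_apply, hι.inducedMetric_apply, push_comp_manifold hι.contMDiff h]

lemma pullMatrix_rescaledMetric (Ψ : Rn 3 → M) (y : Rn 3) :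
    pullMatrix (rescaledMetric g ξ ι) Ψ y
      = normSq g ξ (ι (Ψ y)) • pullMatrix (inducedMetric g ξ ι) Ψ y := rfl

variable [IsManifold (𝓡 4) ∞ N]

/-- Every point is joined to the hypersurface by an integral curve, along which the validity of the
equations is constant. `ξ` has no zeros because its norm is positive. -/
lemma IsOrbitHypersurface.ekg4_iff (hι : IsOrbitHypersurface g ξ ι)
    (hg : IsLorentzMetric g) (hξ : IsKilling g ξ) (hξ0 : ∀ x, 0 < normSq g ξ x) {f : N → ℝ}
    (hf : IsSmoothScalar (n := 4) f) (hξf : ∀ x, dif f x (ξ x) = 0) (G : ℝ) :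
    EKG4 G g f ↔ ∀ m, ScalarGravityAt (8 * Real.pi * G) g f (ι m) := by
  refine ⟨fun h m ↦ ⟨h.1 _, h.2 _⟩, fun h ↦ ?_⟩
  have h1 : ∀ p, ScalarGravityAt (8 * Real.pi * G) g f p := by
    intro p
    obtain ⟨m, ⟨γ, a, b, hγ, s, hs, t, ht, rfl, htm⟩, -⟩ := hι.existsUnique p
    refine (scalarGravityAt_integralCurve (n := 3) hg.isMetric hξ (fun x hx ↦ ?_) hf hξf _ hγ
      hs ht).2 (htm ▸ h m)
    have := hξ0 x
    rw [normSq, hx, map_zero] at this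
    exact this.ne' rfl
  exact ⟨fun x ↦ (h1 x).1, fun x ↦ (h1 x).2⟩

variable [IsManifold (𝓡 3) ∞ M]

/-- Take a vector `t` negative for the 4-metric and remove its component along `ξ`. As `ξ` is
spacelike this only lowers the square, so the projection is still negative; tangent vectors
orthogonal to the projection are orthogonal to `t`, hence positive unless zero. -/
lemma IsOrbitHypersurface.isLorentzMetric_inducedMetric (hι : IsOrbitHypersurface g ξ ι)
    (hg : IsLorentzMetric g) (hξ : ∀ x, 0 < normSq g ξ x) :
    IsLorentzMetric (inducedMetric g ξ ι) where
  symm m v w := by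
    rw [hι.inducedMetric_apply, hι.inducedMetric_apply, hg.symm]
  smooth := isSmoothTensor_of_msm fun p ↦ by
    have hy := (chartAt (Rn 3) p).map_source (mem_chart_source (Rn 3) p)
    have h1 := smoothNear_chartAt_symm p hy
    refine (IsSmoothTensor.msm_pullMatrix (g := g) hg.smooth
      (h1.comp_manifold hι.contMDiff)).congr ?_
    filter_upwards [h1.eventually] with z hz using hι.pullMatrix_inducedMetric hz
  signature m := by
    obtain ⟨t, ht, hpos⟩ := hg.signature (ι m)
    let D : Rn 3 →L[ℝ] Rn 4 := mfderiv (𝓡 3) (𝓡 4) ι m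
    let B : Rn 4 →L[ℝ] Rn 4 →L[ℝ] ℝ := g (ι m)
    let v : Rn 4 := ξ (ι m)
    have hv : 0 < B v v := hξ (ι m)
    have hBs : ∀ a b, B a b = B b a := hg.symm (ι m)
    have hort : ∀ u, B v (D u) = 0 := hι.orthogonal m
    have hDinj : Function.Injective D := hι.mfderiv_injective m
    -- The map `(c, u) ↦ c ξ + dι(u)` is injective by orthogonality and by the immersion property,
    -- hence surjective by dimension; it decomposes `t` into its normal and tangential parts.
    let A : Rn 4 →ₗ[ℝ] Rn 4 :=
      (((EuclideanSpace.proj (0 : Fin 4) : Rn 4 →L[ℝ] ℝ).smulRight v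
        + D.comp (tl : Rn 4 →L[ℝ] Rn 3) : Rn 4 →L[ℝ] Rn 4) : Rn 4 →ₗ[ℝ] Rn 4)
    have hA : ∀ w, A w = w 0 • v + D (tl w) := fun w ↦ rfl
    have hBA : ∀ w, B v (A w) = w 0 * B v v := fun w ↦ by
      rw [hA, map_add, map_smul, hort, add_zero, smul_eq_mul]
    have hAinj : Function.Injective A := by
      refine (injective_iff_map_eq_zero A).2 fun w hw ↦ ?_
      have h1 := hBA w
      rw [hw, map_zero] at h1
      have h2 : w 0 = 0 := (mul_eq_zero.1 h1.symm).resolve_right hv.ne'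
      rw [hA, h2, zero_smul, zero_add] at hw
      have h3 : tl w = 0 := hDinj (hw.trans (map_zero D).symm)
      rw [eq_smul_add_sec w, h2, h3, zero_smul, map_zero, add_zero]
    obtain ⟨w, hw⟩ := (LinearMap.injective_iff_surjective.1 hAinj) (t : Rn 4)
    have ht' : (t : Rn 4) = w 0 • v + D (tl w) := hw.symm
    have hBt : B (t : Rn 4) (t : Rn 4) < 0 := ht
    refine ⟨(tl w : Rn 3), (hι.inducedMetric_apply m _ _).trans_lt ?_, fun u hu hu0 ↦ ?_⟩
    · change B (D (tl w)) (D (tl w)) < 0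
      have h1 : B (t : Rn 4) (t : Rn 4) = w 0 ^ 2 * B v v + B (D (tl w)) (D (tl w)) := by
        rw [ht']
        simp only [map_add, map_smul, add_apply, smul_apply, smul_eq_mul, hort,
          hBs (D (tl w)) v]
        ring
      nlinarith [sq_nonneg (w 0)]
    · rw [hι.inducedMetric_apply]
      refine hpos _ ?_ fun h0 ↦ hu0 (hDinj (h0.trans (map_zero D).symm))
      have key : ∀ u' : Rn 3, B (D (tl w)) (D u') = 0 → B (t : Rn 4) (D u') = 0 := by
        intro u' hu'
        rw [ht', map_add, map_smul, add_apply, smul_apply, hort, hu', smul_zero, add_zero]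
      exact key u ((hι.inducedMetric_apply m _ _).symm.trans hu)

lemma IsOrbitHypersurface.isLorentzMetric_rescaledMetric (hι : IsOrbitHypersurface g ξ ι)
    (hg : IsLorentzMetric g) (hξs : IsSmoothVField ξ) (hξ : ∀ x, 0 < normSq g ξ x) :
    IsLorentzMetric (rescaledMetric g ξ ι) where
  symm m v w :=
    congrArg (normSq g ξ (ι m) * ·) ((hι.isLorentzMetric_inducedMetric hg hξ).symm m v w)
  smooth := isSmoothTensor_of_msm fun p ↦ by
    have hy := (chartAt (Rn 3) p).map_source (mem_chart_source (Rn 3) p)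
    have h1 := smoothNear_chartAt_symm p hy
    exact MSm.smul (h1.cInf_comp ((isSmoothScalar_normSq hg.smooth hξs).comp hι.contMDiff))
      (IsSmoothTensor.msm (hι.isLorentzMetric_inducedMetric hg hξ).smooth p hy)
  signature m := by
    obtain ⟨t, ht, hpos⟩ := (hι.isLorentzMetric_inducedMetric hg hξ).signature m
    have hm := hξ (ι m)
    refine ⟨t, mul_neg_of_pos_of_neg hm ht, fun v hv hv0 ↦ mul_pos hm (hpos v ?_ hv0)⟩
    exact (mul_eq_zero.1 hv).resolve_left hm.ne'

/-- At corresponding points, the 4-dimensional field equations are equivalent to the reduced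
ones. -/
theorem IsOrbitHypersurface.scalarGravityAt_iff (hι : IsOrbitHypersurface g ξ ι)
    (hg : IsLorentzMetric g) (hξ : IsKilling g ξ) (hξ0 : ∀ x, 0 < normSq g ξ x) {f : N → ℝ}
    (hf : IsSmoothScalar (n := 4) f) (hξf : ∀ x, dif f x (ξ x) = 0) (κ : ℝ) (m : M) :
    (ScalarGravityAt κ g f (ι m) ↔
      (∀ v w, ricci (inducedMetric g ξ ι) m v w
        = (1 / 2) * (normSq g ξ (ι m))⁻¹ *
            hess (inducedMetric g ξ ι) (fun m ↦ normSq g ξ (ι m)) m v w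
          - (1 / 4) * (normSq g ξ (ι m))⁻¹ ^ 2 *
            (dif (fun m ↦ normSq g ξ (ι m)) m v * dif (fun m ↦ normSq g ξ (ι m)) m w)
          + κ * (dif (fun m ↦ f (ι m)) m v * dif (fun m ↦ f (ι m)) m w)) ∧
      box (inducedMetric g ξ ι) (fun m ↦ f (ι m)) m = -((1 / 2) * (normSq g ξ (ι m))⁻¹ *
        gradProd (inducedMetric g ξ ι) (fun m ↦ f (ι m)) (fun m ↦ normSq g ξ (ι m)) m) ∧
      box (inducedMetric g ξ ι) (fun m ↦ normSq g ξ (ι m)) m = (1 / 2) * (normSq g ξ (ι m))⁻¹ *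
        gradProd (inducedMetric g ξ ι) (fun m ↦ normSq g ξ (ι m))
          (fun m ↦ normSq g ξ (ι m)) m) ∧
    (ScalarGravityAt κ g f (ι m) ↔
      (∀ v w, ricci (rescaledMetric g ξ ι) m v w
        = (1 / 2) * (dif (fun m ↦ Real.log (normSq g ξ (ι m))) m v *
            dif (fun m ↦ Real.log (normSq g ξ (ι m))) m w)
          + κ * (dif (fun m ↦ f (ι m)) m v * dif (fun m ↦ f (ι m)) m w)) ∧
      box (rescaledMetric g ξ ι) (fun m ↦ f (ι m)) m = 0 ∧
      box (rescaledMetric g ξ ι) (fun m ↦ Real.log (normSq g ξ (ι m))) m = 0) := by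
  have hm := mem_chart_source (Rn 3) m
  set e := chartAt (Rn 3) m
  have hy := e.map_source hm
  have hp : IsParam 3 e.symm (e m) := isParam_chartAt_symm m hy
  have hem : e.symm (e m) = m := e.left_inv hm
  have hl := (isSmoothScalar_normSq hg.smooth hξ.smooth).comp hι.contMDiff
  have hlog := hl.log fun m ↦ (hξ0 (ι m)).ne'
  have hfι := hf.comp hι.contMDiff
  have hg3 := (hι.isLorentzMetric_inducedMetric hg hξ0).isMetric
  have hgr := (hι.isLorentzMetric_rescaledMetric hg hξ.smooth hξ0).isMetric
  have hσ : SmoothNear 4 (fun z ↦ ι (e.symm z)) (e m) := hp.smooth.comp_manifold hι.contMDiff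
  have hA : pullMatrix (inducedMetric g ξ ι) e.symm =ᶠ[𝓝 (e m)]
      pullMatrix g fun z ↦ ι (e.symm z) := by
    filter_upwards [hp.smooth.eventually] with z hz using hι.pullMatrix_inducedMetric hz
  have hh := (hg3.metricAt_pullMatrix hp).congr hA.symm
  -- The preferred chart at `m` composed with `ι` serves as the parametrized hypersurface for the
  -- static computation.
  have h1 := scalarGravityAt_iff_reduced (n := 3) hg.isMetric hξ (fun x ↦ (hξ0 x).ne') hf hξf κ hσ
    (by
      intro u w huw
      rw [push_comp_manifold hι.contMDiff hp.smooth, push_comp_manifold hι.contMDiff hp.smooth]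
        at huw
      exact hp.bijective.1 (hι.mfderiv_injective _ huw))
    (by
      filter_upwards [hp.smooth.eventually] with z hz u
      rw [push_comp_manifold hι.contMDiff hz]
      exact hι.orthogonal _ _) hh
  have h2 := hg3.reduced_iff hp hl hfι κ
  rw [ric_congr hA, hes_congr hA (Filter.EventuallyEq.refl _ fun z ↦ f (ι (e.symm z))),
    hes_congr hA (Filter.EventuallyEq.refl _ fun z ↦ normSq g ξ (ι (e.symm z))),
    hA.self_of_nhds, hem] at h2
  have hB : pullMatrix (rescaledMetric g ξ ι) e.symm =ᶠ[𝓝 (e m)]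
      fun z ↦ normSq g ξ (ι (e.symm z)) • pullMatrix g (fun z ↦ ι (e.symm z)) z := by
    filter_upwards [hA] with z hz
    rw [pullMatrix_rescaledMetric, hz]
  have h3 := hgr.rescaled_iff hp hlog hfι κ
  rw [ric_congr hB, hes_congr hB (Filter.EventuallyEq.refl _ fun z ↦ f (ι (e.symm z))),
    hes_congr hB (Filter.EventuallyEq.refl _ fun z ↦ Real.log (normSq g ξ (ι (e.symm z)))),
    hB.self_of_nhds] at h3
  beta_reduce at h3
  rw [hem] at h3
  have h4 := rescaled_equations_iff (l := fun z ↦ normSq g ξ (ι (e.symm z)))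
    (f := fun z ↦ f (ι (e.symm z))) hh (hp.smooth.cInf_comp hl) (hξ0 _).ne' κ
  rw [hem] at h1 h4
  exact ⟨h1.trans h2.symm, h1.trans (h4.trans h3.symm)⟩

end Reduction

end Spacetime

end

/-! ### The main theorem, assembled from the pointwise equivalences. -/

theorem theoremA2
    {N : Type*} [TopologicalSpace N] [T2Space N] [ChartedSpace (Spacetime.Rn 4) N]
    [IsManifold (𝓡 4) ∞ N]
    {M : Type*} [TopologicalSpace M] [ChartedSpace (Spacetime.Rn 3) M]
    [IsManifold (𝓡 3) ∞ M]
    (g₄ : Spacetime.Tensor2 4 N) (hg₄ : Spacetime.IsLorentzMetric g₄)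
    (ξ : Spacetime.VField 4 N) (hξ : Spacetime.IsKilling g₄ ξ)
    (hspacelike : ∀ x : N, 0 < Spacetime.normSq g₄ ξ x)
    (horth : Spacetime.IsHypersurfaceOrthogonal g₄ ξ)
    (ι : M → N) (hι : Spacetime.IsOrbitHypersurface g₄ ξ ι)
    (G : ℝ) (hG : 0 < G)
    (φ : N → ℝ) (hφ : Spacetime.IsSmoothScalar (n := 4) φ)
    (hLieφ : ∀ x : N, Spacetime.dif φ x (ξ x) = 0) :
    Spacetime.IsLorentzMetric (Spacetime.inducedMetric g₄ ξ ι) ∧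
    Spacetime.IsLorentzMetric (Spacetime.rescaledMetric g₄ ξ ι) ∧
    (Spacetime.EKG4 G g₄ φ ↔
      Spacetime.ReducedEquations G (Spacetime.inducedMetric g₄ ξ ι)
        (fun m ↦ Spacetime.normSq g₄ ξ (ι m)) (fun m ↦ φ (ι m))) ∧
    (Spacetime.EKG4 G g₄ φ ↔
      Spacetime.RescaledEquations G (Spacetime.rescaledMetric g₄ ξ ι)
        (fun m ↦ Spacetime.normSq g₄ ξ (ι m)) (fun m ↦ φ (ι m))) ∧
    (Spacetime.EKG4 G g₄ φ ↔
      Spacetime.TwoScalarEKG3 (Spacetime.rescaledMetric g₄ ξ ι)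
        (fun m ↦ Real.log (Spacetime.normSq g₄ ξ (ι m)))
        (fun m ↦ Real.sqrt (16 * Real.pi * G) * φ (ι m))) := by
  have hg3 := hι.isLorentzMetric_inducedMetric hg₄ hspacelike
  have hgr := hι.isLorentzMetric_rescaledMetric hg₄ hξ.smooth hspacelike
  have hE := hι.ekg4_iff hg₄ hξ hspacelike hφ hLieφ G
  have hP := hι.scalarGravityAt_iff hg₄ hξ hspacelike hφ hLieφ (8 * Real.pi * G)
  have h3 : Spacetime.EKG4 G g₄ φ ↔
      Spacetime.RescaledEquations G (Spacetime.rescaledMetric g₄ ξ ι)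
        (fun m ↦ Spacetime.normSq g₄ ξ (ι m)) (fun m ↦ φ (ι m)) := by
    rw [hE, forall_congr' fun m ↦ (hP m).2, forall_and, forall_and]
    rfl
  refine ⟨hg3, hgr, ?_, h3, h3.trans ?_⟩
  · rw [hE, forall_congr' fun m ↦ (hP m).1, forall_and, forall_and]
    rfl
  · exact hgr.isMetric.rescaledEquations_iff_twoScalar (hφ.comp hι.contMDiff) hG
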